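/- Let $\mathfrak g$ be a finite-dimensional simple Lie algebra over $\mathbb C$ with a fixed non-degenerate, invariant, symmetric bilinear form $(\cdot,\cdot)$. Let $\mathfrak h\subset\mathfrak g$ be a Cartan subalgebra, $\{\alpha_i\}_{i\in I}$ a base of simple roots, and $R_+$ the corresponding set of positive roots. For $\alpha\in R_+$ choose $x_\alpha^\pm\in\mathfrak g_{\pm\alpha}$ with $(x_\alpha^+,x_\alpha^-)=1$; write $x_i^\pm=x_{\alpha_i}^\pm$ and $t_i=[x_i^+,x_i^-]\in\mathfrak h$. For $h\in\mathfrak h$ put $$\nu(h)=\tfrac12\sum_{\alpha\in R_+}\alpha(h)\,x_\alpha^-x_\alpha^+\in U(\mathfrak g).$$ Let $\Omega\in\mathfrak g\otimes\mathfrak g$ be the Casimir tensor of $(\cdot,\cdot)$, that is, $\Omega=\sum_k v_k\otimes v^k$ for a basis $(v_k)$ of $\mathfrak g$ and its dual basis $(v^k)$. Equip the current algebra $\mathfrak g[u]=\bigoplus_{n\ge0}\mathfrak g u^n$ with the Lie cobracket $\delta(xu^n)=\sum_{a+b=n-1}[x\otimes1,\Omega]u^av^b\in(\mathfrak g\otimes\mathfrak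 g)[u,v]\cong\mathfrak g[u]\otimes\mathfrak g[u]$. A homogeneous quantization of $(\mathfrak g[u],\delta)$ is an $\mathbb N$-graded Hopf algebra $\mathcal H=\bigoplus_{n\ge0}\mathcal H_n$ over the graded ring $\mathbb C[\hbar]$, $\deg\hbar=1$, such that $\mathcal H$ is torsion free over $\mathbb C[\hbar]$; $\mathcal H/\hbar\mathcal H\cong U(\mathfrak g[u])$ as graded Hopf algebras; and $\delta(x)=\hbar^{-1}\bigl(\Delta(\tilde x)-\Delta^{21}(\tilde x)\bigr)\bmod\hbar\,\mathcal H\otimes\mathcal H$ for every $x\in\mathfrak g[u]$ and every $\tilde x\in\mathcal H$ with $\tilde x\equiv x\bmod\hbar$. For such $\mathcal H$, identify $U(\mathfrak g)$ with $\mathcal H_0$ by means of the unique algebra embedding $U(\mathfrak g)\to\mathcal H$ with image $\mathcal H_0$ which lifts the inclusion $U(\mathfrak g)\subset U(\mathfrak g[u])\cong\mathcal H/\hbar\mathcal H$. **Theorem.** Let $\mathcal H$ be a homogeneous quantization of $(\mathfrak g[u],\delta)$, and let $\mathcal J:\mathfrak g\to\mathcal H_1$ be any linear map such that, for all $x,y\in\mathfrak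 g$, $\mathcal J([x,y])=[x,\mathcal J(y)]$, $\mathcal J(x)\equiv xu\bmod\hbar$, and $$\Delta(\mathcal J(x))=\mathcal J(x)\otimes1+1\otimes\mathcal J(x)+\tfrac{\hbar}{2}[x\otimes1,\Omega].$$ 1. If $\mathfrak g\not\cong\mathfrak{sl}_2$, then $[\mathcal J(t_i),\mathcal J(t_j)]=\hbar^2[\nu(t_j),\nu(t_i)]$ for all $i,j\in I$. 2. If $\mathfrak g\cong\mathfrak{sl}_2$, write $I=\{i\}$, $e=x_i^+$, $f=x_i^-$, $h=t_i$. Then $$[[\mathcal J(e),\mathcal J(f)],\mathcal J(h)]=\Bigl(\tfrac{(h,h)}{2}\Bigr)^{2}\hbar^2\,(f\mathcal J(e)-\mathcal J(f)e)h.$$ In particular, if the form is normalized by $(h,h)=2$ (equivalently, $e,f,h$ is an $\mathfrak{sl}_2$-triple), then $[[\mathcal J(e),\mathcal J(f)],\mathcal J(h)]=\hbar^2(f\mathcal J(e)-\mathcal J(f)e)h$. -/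

import Mathlib

open scoped TensorProduct Polynomial

noncomputable section

section Envelope

attribute [local instance 100] LieRing.ofAssociativeRing

variable (L : Type*) [LieRing L] [LieAlgebra ℂ L]

/-- The canonical linear map `L → U(L)`. -/
def envIncl : L →ₗ[ℂ] UniversalEnvelopingAlgebra ℂ L :=
  (UniversalEnvelopingAlgebra.ι ℂ : L →ₗ⁅ℂ⁆ UniversalEnvelopingAlgebra ℂ L)

/-- The comultiplication of `U(L)`: the algebra map with `x ↦ x ⊗ 1 + 1 ⊗ x` for `x ∈ L`. -/
def envComul : UniversalEnvelopingAlgebra ℂ L →ₐ[ℂ]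
    UniversalEnvelopingAlgebra ℂ L ⊗[ℂ] UniversalEnvelopingAlgebra ℂ L :=
  UniversalEnvelopingAlgebra.lift ℂ
    { toFun := fun x => UniversalEnvelopingAlgebra.ι ℂ x ⊗ₜ[ℂ] 1 +
        1 ⊗ₜ[ℂ] UniversalEnvelopingAlgebra.ι ℂ x
      map_add' := fun x y => by
        simp only [map_add, TensorProduct.add_tmul, TensorProduct.tmul_add]; abel
      map_smul' := fun c x => by
        simp only [map_smul, TensorProduct.smul_tmul', TensorProduct.tmul_smul, smul_add,
          RingHom.id_apply]
      map_lie' := fun {x y} => by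
        simp only [LieHom.map_lie, LieRing.of_associative_ring_bracket, add_mul, mul_add,
          Algebra.TensorProduct.tmul_mul_tmul, mul_one, one_mul, TensorProduct.sub_tmul,
          TensorProduct.tmul_sub]
        abel }

/-- The counit of `U(L)`: the algebra map with `x ↦ 0` for `x ∈ L`. -/
def envCounit : UniversalEnvelopingAlgebra ℂ L →ₐ[ℂ] ℂ :=
  UniversalEnvelopingAlgebra.lift ℂ (0 : L →ₗ⁅ℂ⁆ ℂ)

/-- The antipode of `U(L)` as an algebra map into the opposite algebra: `x ↦ -x` for `x ∈ L`. -/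
def envAntipodeOp : UniversalEnvelopingAlgebra ℂ L →ₐ[ℂ]
    (UniversalEnvelopingAlgebra ℂ L)ᵐᵒᵖ :=
  UniversalEnvelopingAlgebra.lift ℂ
    { toFun := fun x => MulOpposite.op (-UniversalEnvelopingAlgebra.ι ℂ x)
      map_add' := fun x y => by
        simp only [map_add, neg_add, MulOpposite.op_add]
      map_smul' := fun c x => by
        simp only [map_smul, RingHom.id_apply, ← smul_neg, MulOpposite.op_smul]
      map_lie' := fun {x y} => by
        simp only [LieHom.map_lie, LieRing.of_associative_ring_bracket, ← MulOpposite.op_mul,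
          ← MulOpposite.op_sub, neg_mul_neg, neg_sub] }

/-- The antipode of `U(L)`. -/
def envAntipode (y : UniversalEnvelopingAlgebra ℂ L) : UniversalEnvelopingAlgebra ℂ L :=
  MulOpposite.unop (envAntipodeOp L y)

end Envelope

section Current

variable (g : Type*) [LieRing g] [LieAlgebra ℂ g]

/-- The polynomial current algebra `g[u]`, realised as `ℂ[u] ⊗ g` with
`[p ⊗ x, q ⊗ y] = p q ⊗ [x, y]`. -/
abbrev Current : Type _ := ℂ[X] ⊗[ℂ] g

/-- The enveloping algebra `U(g[u])`. -/
abbrev CurrentEnv : Type _ := UniversalEnvelopingAlgebra ℂ (Current g)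

variable {g}

/-- The linear map `x ↦ x uⁿ` from `g` to `g[u]`. -/
def currentMonomial (n : ℕ) : g →ₗ[ℂ] Current g :=
  TensorProduct.mk ℂ ℂ[X] g (Polynomial.X ^ n)

variable (g) in
/-- The degree `n` component of `U(g[u])`: the span of the products `(x₁ u^{n₁}) ⋯ (x_k u^{n_k})`
with `n₁ + ⋯ + n_k = n`. -/
def currentEnvDeg (n : ℕ) : Submodule ℂ (CurrentEnv g) :=
  Submodule.span ℂ {y | ∃ l : List (ℕ × g), (l.map Prod.fst).sum = n ∧
    y = (l.map fun p => envIncl (Current g) (currentMonomial p.1 p.2)).prod}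

variable [FiniteDimensional ℂ g]

/-- The Casimir tensor `Ω = ∑ᵢ vᵢ ⊗ vⁱ` of a nondegenerate bilinear form, for a basis `(vᵢ)` and its
dual basis `(vⁱ)` with respect to the form (the tensor does not depend on the basis). -/
def casimirTensor (B : LinearMap.BilinForm ℂ g) (hB : B.Nondegenerate) : g ⊗[ℂ] g :=
  ∑ i, Module.finBasis ℂ g i ⊗ₜ[ℂ] B.dualBasis hB (Module.finBasis ℂ g) i

/-- The linear map `x ↦ [x ⊗ 1, Ω] = (ad x ⊗ id) Ω` from `g` to `g ⊗ g`. -/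
def casimirBracket (B : LinearMap.BilinForm ℂ g) (hB : B.Nondegenerate) : g →ₗ[ℂ] g ⊗[ℂ] g where
  toFun x := (LieAlgebra.ad ℂ g x).rTensor g (casimirTensor B hB)
  map_add' x y := by simp [LinearMap.rTensor_add]
  map_smul' c x := by simp [LinearMap.rTensor_smul]

/-- The Lie cobracket of `g[u]`, given by `δ(x uⁿ) = ∑_{a + b = n - 1} [x ⊗ 1, Ω] uᵃ vᵇ`
(so `δ(x) = 0` for `x ∈ g`), where `(y ⊗ z) uᵃ vᵇ` stands for `y uᵃ ⊗ z uᵇ`. -/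
def currentCobracket (B : LinearMap.BilinForm ℂ g) (hB : B.Nondegenerate) :
    Current g →ₗ[ℂ] Current g ⊗[ℂ] Current g :=
  TensorProduct.lift ((Polynomial.basisMonomials ℂ).constr ℂ fun n : ℕ =>
    ∑ a ∈ Finset.range n,
      TensorProduct.map (currentMonomial a) (currentMonomial (n - 1 - a)) ∘ₗ casimirBracket B hB)

end Current

section Quantization

variable {g : Type*} [LieRing g] [LieAlgebra ℂ g] [FiniteDimensional ℂ g]

/-- `ℕ`-gradings of a Hopf algebra `A` over the graded ring `ℂ[ħ]`, `deg ħ = 1`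
(the polynomial variable `X` is `ħ`). -/
structure HopfGrading (A : Type*) [Ring A] [HopfAlgebra ℂ[X] A] [Algebra ℂ A]
    [IsScalarTower ℂ ℂ[X] A] where
  /-- The homogeneous components. -/
  deg : ℕ → Submodule ℂ A
  one_mem : 1 ∈ deg 0
  mul_mem : ∀ ⦃m n : ℕ⦄ ⦃a b : A⦄, a ∈ deg m → b ∈ deg n → a * b ∈ deg (m + n)
  isInternal : DirectSum.IsInternal deg
  hbar_smul_mem : ∀ ⦃n : ℕ⦄ ⦃a : A⦄, a ∈ deg n → (Polynomial.X : ℂ[X]) • a ∈ deg (n + 1)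
  counit_mem : ∀ ⦃n : ℕ⦄ ⦃a : A⦄, a ∈ deg n →
    Coalgebra.counit (R := ℂ[X]) a ∈ Submodule.span ℂ {(Polynomial.X : ℂ[X]) ^ n}
  comul_mem : ∀ ⦃n : ℕ⦄ ⦃a : A⦄, a ∈ deg n → Coalgebra.comul (R := ℂ[X]) a ∈
    Submodule.span ℂ {t : A ⊗[ℂ[X]] A | ∃ i j : ℕ, i + j = n ∧
      ∃ y ∈ deg i, ∃ z ∈ deg j, t = y ⊗ₜ[ℂ[X]] z}
  antipode_mem : ∀ ⦃n : ℕ⦄ ⦃a : A⦄, a ∈ deg n → HopfAlgebra.antipode ℂ[X] a ∈ deg n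

/-- A `ℂ`-algebra map that kills `ħ A` is semilinear along the evaluation `ℂ[ħ] → ℂ`, `ħ ↦ 0`. -/
def semilinearAtZero {A E : Type*} [Ring A] [Algebra ℂ[X] A] [Algebra ℂ A]
    [IsScalarTower ℂ ℂ[X] A] [Ring E] [Algebra ℂ E] (p : A →ₐ[ℂ] E)
    (hp : ∀ a : A, p ((Polynomial.X : ℂ[X]) • a) = 0) :
    A →ₛₗ[Polynomial.evalRingHom (0 : ℂ)] E where
  toFun := p
  map_add' := map_add p
  map_smul' f a := by
    have h : f • a = (Polynomial.X : ℂ[X]) • (f.divX • a) + f.coeff 0 • a := by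
      conv_lhs => rw [← Polynomial.X_mul_divX_add f]
      rw [add_smul, mul_smul, Polynomial.C_eq_algebraMap, algebraMap_smul]
    rw [h, map_add, hp, zero_add, map_smul, Polynomial.coe_evalRingHom,
      ← Polynomial.coeff_zero_eq_eval_zero]

/-- A homogeneous quantization of the Lie bialgebra `(g[u], δ)`: an `ℕ`-graded Hopf algebra `A` over
`ℂ[ħ]` which is torsion free, together with an isomorphism `A / ħ A ≅ U(g[u])` of graded Hopf
algebras, recorded as the quotient map `proj : A → U(g[u])`, such that `δ` is the semiclassical
limit of the coproduct. -/
structure HomogeneousQuantization (B : LinearMap.BilinForm ℂ g) (hB : B.Nondegenerate)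
    (A : Type*) [Ring A] [HopfAlgebra ℂ[X] A] [Algebra ℂ A] [IsScalarTower ℂ ℂ[X] A]
    extends HopfGrading A where
  torsionFree : Module.IsTorsionFree ℂ[X] A
  /-- The quotient map `A → A / ħ A ≅ U(g[u])`. -/
  proj : A →ₐ[ℂ] CurrentEnv g
  proj_surjective : Function.Surjective proj
  proj_hbar : ∀ a : A, proj ((Polynomial.X : ℂ[X]) • a) = 0
  exists_of_proj_eq_zero : ∀ a : A, proj a = 0 → ∃ b : A, a = (Polynomial.X : ℂ[X]) • b
  proj_deg : ∀ n : ℕ, (deg n).map proj.toLinearMap = currentEnvDeg g n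
  proj_counit : ∀ a : A,
    envCounit (Current g) (proj a) = (Coalgebra.counit (R := ℂ[X]) a).eval 0
  proj_comul : ∀ a : A, envComul (Current g) (proj a) =
    TensorProduct.map (semilinearAtZero proj proj_hbar) (semilinearAtZero proj proj_hbar)
      (Coalgebra.comul (R := ℂ[X]) a)
  proj_antipode : ∀ a : A,
    envAntipode (Current g) (proj a) = proj (HopfAlgebra.antipode ℂ[X] a)
  /-- `δ(x) = (Δ(x̃) - Δ²¹(x̃)) / ħ` modulo `ħ`, for every lift `x̃` of `x ∈ g[u]`. -/
  semiclassical : ∀ (x : Current g) (a : A), proj a = envIncl (Current g) x →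
    ∃ t : A ⊗[ℂ[X]] A,
      Coalgebra.comul (R := ℂ[X]) a -
          TensorProduct.comm ℂ[X] A A (Coalgebra.comul (R := ℂ[X]) a) =
        (Polynomial.X : ℂ[X]) • t ∧
      TensorProduct.map (semilinearAtZero proj proj_hbar) (semilinearAtZero proj proj_hbar) t =
        TensorProduct.map (envIncl (Current g)) (envIncl (Current g)) (currentCobracket B hB x)

namespace HomogeneousQuantization

attribute [local instance 100] LieRing.ofAssociativeRing

variable {B : LinearMap.BilinForm ℂ g} {hB : B.Nondegenerate}
  {A : Type*} [Ring A] [HopfAlgebra ℂ[X] A] [Algebra ℂ A] [IsScalarTower ℂ ℂ[X] A]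
  (Q : HomogeneousQuantization B hB A)

theorem eq_zero_of_proj {a : A} (ha : a ∈ Q.deg 0) (h : Q.proj a = 0) : a = 0 := by
  classical
  obtain ⟨b, rfl⟩ := Q.exists_of_proj_eq_zero a h
  obtain ⟨d, rfl⟩ := Q.isInternal.surjective b
  set m : (n : ℕ) → Q.deg n →+ Q.deg (n + 1) := fun n =>
    { toFun := fun y => ⟨(Polynomial.X : ℂ[X]) • (y : A), Q.hbar_smul_mem y.2⟩
      map_zero' := by simp
      map_add' := fun y z => by ext; simp } with hm
  set s : (DirectSum ℕ fun n => Q.deg n) →+ DirectSum ℕ fun n => Q.deg n :=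
    DirectSum.toAddMonoid fun n => (DirectSum.of (fun n => Q.deg n) (n + 1)).comp (m n) with hs
  have h1 : ∀ d, DirectSum.coeAddMonoidHom Q.deg (s d) =
      (Polynomial.X : ℂ[X]) • DirectSum.coeAddMonoidHom Q.deg d := by
    intro d
    induction d using DirectSum.induction_on with
    | zero => simp
    | of n y => simp [hs, hm]
    | add y z hy hz => simp [map_add, hy, hz, smul_add]
  have h2 : ∀ d, s d 0 = 0 := by
    intro d
    induction d using DirectSum.induction_on with
    | zero => simp
    | of n y =>
      simp only [hs, DirectSum.toAddMonoid_of, AddMonoidHom.comp_apply]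
      exact DirectSum.of_eq_of_ne _ _ _ (Nat.succ_ne_zero n).symm
    | add y z hy hz => simp [map_add, hy, hz]
  have h3 : s d = DirectSum.of (fun n => Q.deg n) 0 ⟨_, ha⟩ := by
    apply Q.isInternal.injective
    rw [h1, DirectSum.coeAddMonoidHom_of]
  have h4 := h2 d
  rw [h3, DirectSum.of_eq_same] at h4
  exact congrArg Subtype.val h4

theorem eq_of_proj {a b : A} (ha : a ∈ Q.deg 0) (hb : b ∈ Q.deg 0) (h : Q.proj a = Q.proj b) :
    a = b :=
  sub_eq_zero.1 (Q.eq_zero_of_proj (sub_mem ha hb) (by rw [map_sub, h, sub_self]))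

theorem exists_lift (x : g) :
    ∃ a ∈ Q.deg 0, Q.proj a = envIncl (Current g) (currentMonomial 0 x) := by
  have h : envIncl (Current g) (currentMonomial 0 x) ∈ (Q.deg 0).map Q.proj.toLinearMap := by
    rw [Q.proj_deg]
    exact Submodule.subset_span ⟨[(0, x)], by simp⟩
  exact h

/-- The element of `A₀` which lifts `x ∈ g ⊆ U(g[u])`; it is unique by `eq_of_proj`. -/
def lift (x : g) : A := (Q.exists_lift x).choose

theorem lift_mem (x : g) : Q.lift x ∈ Q.deg 0 := (Q.exists_lift x).choose_spec.1

theorem proj_lift (x : g) :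
    Q.proj (Q.lift x) = envIncl (Current g) (currentMonomial 0 x) :=
  (Q.exists_lift x).choose_spec.2

/-- The Lie algebra map `g → A` with image in `A₀` that lifts the inclusion `g ⊆ U(g[u])`. -/
def lieLift : g →ₗ⁅ℂ⁆ A where
  toFun := Q.lift
  map_add' x y := Q.eq_of_proj (Q.lift_mem _) (add_mem (Q.lift_mem _) (Q.lift_mem _)) (by
    simp only [map_add, proj_lift])
  map_smul' c x := Q.eq_of_proj (Q.lift_mem _) (Submodule.smul_mem _ _ (Q.lift_mem _)) (by
    simp only [map_smul, proj_lift, RingHom.id_apply])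
  map_lie' := fun {x y} => Q.eq_of_proj (Q.lift_mem _)
    (sub_mem (Q.mul_mem (Q.lift_mem x) (Q.lift_mem y)) (Q.mul_mem (Q.lift_mem y) (Q.lift_mem x))) (by
      have h : (currentMonomial 0 ⁅x, y⁆ : Current g) =
          ⁅(currentMonomial 0 x : Current g), (currentMonomial 0 y : Current g)⁆ := by
        simp [currentMonomial]
      have h' : Q.proj (Q.lift x * Q.lift y - Q.lift y * Q.lift x) =
          Q.proj (Q.lift x) * Q.proj (Q.lift y) - Q.proj (Q.lift y) * Q.proj (Q.lift x) := by
        rw [map_sub, map_mul, map_mul]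
      rw [LieRing.of_associative_ring_bracket, h', proj_lift, proj_lift, proj_lift, h]
      simp only [envIncl, LieHom.coe_toLinearMap, LieHom.map_lie,
        LieRing.of_associative_ring_bracket])

/-- The embedding `U(g) → A` with image `A₀` for which the composite with `A → A / ħ A ≅ U(g[u])`
is the natural inclusion `U(g) ⊆ U(g[u])`. -/
def embed : UniversalEnvelopingAlgebra ℂ g →ₐ[ℂ] A :=
  UniversalEnvelopingAlgebra.lift ℂ Q.lieLift

/-- The image in `A ⊗ A` of a tensor in `g ⊗ g`. -/
def embedTensor : g ⊗[ℂ] g →ₗ[ℂ] A ⊗[ℂ[X]] A :=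
  TensorProduct.mapOfCompatibleSMul ℂ[X] ℂ ℂ A A ∘ₗ
    TensorProduct.map (Q.embed.toLinearMap ∘ₗ envIncl g) (Q.embed.toLinearMap ∘ₗ envIncl g)

/-- The maps `J : g → A₁` that are `g`-module homomorphisms, reduce to `x ↦ x u` modulo `ħ`, and
satisfy `Δ(J(x)) = J(x) ⊗ 1 + 1 ⊗ J(x) + (ħ / 2) [x ⊗ 1, Ω]`. -/
structure IsDegreeOneGenerator (J : g →ₗ[ℂ] A) : Prop where
  mem_deg : ∀ x : g, J x ∈ Q.deg 1
  map_lie : ∀ x y : g, J ⁅x, y⁆ = ⁅Q.embed (envIncl g x), J y⁆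
  proj_eq : ∀ x : g, Q.proj (J x) = envIncl (Current g) (currentMonomial 1 x)
  comul_eq : ∀ x : g, Coalgebra.comul (R := ℂ[X]) (J x) =
    J x ⊗ₜ[ℂ[X]] 1 + 1 ⊗ₜ[ℂ[X]] J x +
      ((1 / 2 : ℂ) • (Polynomial.X : ℂ[X])) •
        ⁅Q.embed (envIncl g x) ⊗ₜ[ℂ[X]] (1 : A), Q.embedTensor (casimirTensor B hB)⁆

end HomogeneousQuantization

end Quantization

section Roots

variable {g : Type*} [LieRing g] [LieAlgebra ℂ g] [FiniteDimensional ℂ g]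
  {H : LieSubalgebra ℂ g} [H.IsCartanSubalgebra]

/-- A choice, for each root `α`, of root vectors `x_α⁺ ∈ g_α` and `x_α⁻ ∈ g_{-α}` with
`(x_α⁺, x_α⁻) = 1`. -/
structure RootVectors (H : LieSubalgebra ℂ g) [H.IsCartanSubalgebra]
    (B : LinearMap.BilinForm ℂ g) where
  /-- The vectors `x_α⁺`. -/
  pos : H.root → g
  /-- The vectors `x_α⁻`. -/
  neg : H.root → g
  pos_mem : ∀ α : H.root, pos α ∈ LieAlgebra.rootSpace H (α.1 : H → ℂ)
  neg_mem : ∀ α : H.root, neg α ∈ LieAlgebra.rootSpace H (-(α.1 : H → ℂ))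
  form_eq_one : ∀ α : H.root, B (pos α) (neg α) = 1

namespace RootVectors

variable {B : LinearMap.BilinForm ℂ g} (r : RootVectors H B)

theorem lie_mem (α : H.root) : ⁅r.pos α, r.neg α⁆ ∈ H := by
  have h := LieAlgebra.lie_mem_genWeightSpace_of_mem_genWeightSpace (r.pos_mem α) (r.neg_mem α)
  rw [add_neg_cancel] at h
  have h' : ⁅r.pos α, r.neg α⁆ ∈ LieAlgebra.zeroRootSubalgebra ℂ g H := h
  exact (LieAlgebra.zeroRootSubalgebra_eq_of_is_cartan ℂ g H).le h'

/-- The Cartan element `t_α = [x_α⁺, x_α⁻]`. -/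
def t (α : H.root) : H := ⟨⁅r.pos α, r.neg α⁆, r.lie_mem α⟩

open scoped Classical in
/-- The element `ν(h) = (1 / 2) ∑_{α > 0} α(h) x_α⁻ x_α⁺` of `U(g)`. -/
def nu [LieAlgebra.IsSimple ℂ g] (b : (LieAlgebra.IsKilling.rootSystem H).Base) (h : H) :
    UniversalEnvelopingAlgebra ℂ g :=
  (1 / 2 : ℂ) • ∑ α : H.root with b.IsPos α,
    (α.1 : H → ℂ) h • (envIncl g (r.neg α) * envIncl g (r.pos α))

end RootVectors

end Roots

end

/-! The engine is a rigidity statement, `exists_lift_of_primitive`: a primitive element of degree n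
in a homogeneous quantization is ħⁿx with x ∈ g. Its reduction modulo ħ is primitive in U(g[u]),
hence of the form x uⁿ; its coproduct is symmetric, so δ(x uⁿ) = 0, and for n > 0 this forces x = 0.
The element is then divisible by ħ, and torsion-freeness makes the quotient primitive again. Both
relations follow one pattern: a suitable commutator is primitive, so it equals ħⁿx, and the adjoint
action of g excludes x ≠ 0.

For part 1 put T(h) = J(h) - ħν(h) and r(h) = ∑_{α>0} α(h) x_α⁻ ⊗ x_α⁺. The correction makes the
coproduct one-sided: Δ(T(h)) = T(h) ⊗ 1 + 1 ⊗ T(h) - ħ r(h). Primitivity of [T(h), T(h')]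
(`comul_bracket_corrected`) reduces to 2[r, r'] + [A, r'] + [r, A'] = 0 with A = 2(ν ⊗ 1 + 1 ⊗ ν)
(`lowerTensor_identity`). Invariance of Ω shows that this expression equals its mirror image, in
which x_α⁺ and x_α⁻ are exchanged between the tensor factors; one has negative and the other
nonnegative weights in the first factor, so both vanish.

Thus [T(h), T(t_i)] = ħ²x with x in the Cartan subalgebra. If α_i(h) = 0, then T(h) commutes with
x_i^±, and T(t_i) agrees, up to a multiple of x_i⁻x_i⁺, with an element on which ad x_i⁻ ad x_i⁺
acts by α_i(t_i), as it does on t_i. So x is proportional to t_i (`exists_bracket_corrected_t`). By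
antisymmetry [T(t_i), T(t_j)] lies on the lines of t_i and of t_j, hence is zero; expanding T gives
the relation for J.

For part 2 the right-hand side is what turns [[J(e), J(f)], J(h)] into the commutator [[E, F], T] of
corrected generators with one-sided coproducts (`sl2_corrected_bracket`). A computation with these
coproducts shows that the difference D of the two sides is primitive, so D = ħ³w with w of weight
zero in the adjoint representation, where ad f ad e acts by c = (h, h). But D lies in a space on
which ad f ad e has only the eigenvalues 0 and 3c, those of spins 0 and 2
(`exists_ad_f_ad_e_companion`). Hence D = 0. -/

noncomputable section

/-! ### Primitive elements of an enveloping algebra. -/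

section PrimitiveElements

attribute [local instance 100] LieRing.ofAssociativeRing

variable (L : Type*) [LieRing L] [LieAlgebra ℂ L]

local notation "U" => UniversalEnvelopingAlgebra ℂ L

theorem envIncl_lie (x y : L) :
    envIncl L ⁅x, y⁆ = envIncl L x * envIncl L y - envIncl L y * envIncl L x := by
  simp only [envIncl, LieHom.coe_toLinearMap, LieHom.map_lie,
    LieRing.of_associative_ring_bracket]

theorem lift_envIncl {M : Type*} [Ring M] [Algebra ℂ M] (φ : L →ₗ⁅ℂ⁆ M) (x : L) :
    UniversalEnvelopingAlgebra.lift ℂ φ (envIncl L x) = φ x :=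
  UniversalEnvelopingAlgebra.lift_ι_apply ℂ φ x

theorem envComul_envIncl (x : L) :
    envComul L (envIncl L x) = envIncl L x ⊗ₜ[ℂ] 1 + 1 ⊗ₜ[ℂ] envIncl L x :=
  lift_envIncl L _ x

theorem envAlgHom_ext {M : Type*} [Ring M] [Algebra ℂ M] {φ ψ : U →ₐ[ℂ] M}
    (h : ∀ x, φ (envIncl L x) = ψ (envIncl L x)) : φ = ψ :=
  UniversalEnvelopingAlgebra.hom_ext ℂ (LieHom.ext h)

/-- The span of the products of at most `n` elements of `L`. -/
def envFiltration (n : ℕ) : Submodule ℂ U := (1 ⊔ LinearMap.range (envIncl L)) ^ n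

theorem envFiltration_succ (n : ℕ) :
    envFiltration L (n + 1) = envFiltration L 1 * envFiltration L n := by
  rw [envFiltration, envFiltration, envFiltration, pow_succ', pow_one]

theorem envFiltration_add (m n : ℕ) :
    envFiltration L (m + n) = envFiltration L m * envFiltration L n := pow_add _ _ _

theorem one_le_envFiltration_one : (1 : Submodule ℂ U) ≤ envFiltration L 1 := by
  rw [envFiltration, pow_one]; exact le_sup_left

theorem envIncl_mem_envFiltration (x : L) : envIncl L x ∈ envFiltration L 1 := by
  rw [envFiltration, pow_one]
  exact Submodule.mem_sup_right ⟨x, rfl⟩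

theorem envFiltration_le_succ (n : ℕ) : envFiltration L n ≤ envFiltration L (n + 1) := by
  rw [envFiltration_succ]
  calc envFiltration L n = 1 * envFiltration L n := (one_mul _).symm
    _ ≤ _ := mul_le_mul' (one_le_envFiltration_one L) le_rfl

theorem envFiltration_mono : Monotone (envFiltration L) :=
  monotone_nat_of_le_succ (envFiltration_le_succ L)

theorem mem_envFiltration_one {u : U} :
    u ∈ envFiltration L 1 ↔ ∃ (c : ℂ) (x : L), u = algebraMap ℂ U c + envIncl L x := by
  rw [envFiltration, pow_one, Submodule.mem_sup]
  constructor
  · rintro ⟨_, h, _, ⟨x, rfl⟩, rfl⟩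
    obtain ⟨c, rfl⟩ := Submodule.mem_one.1 h
    exact ⟨c, x, rfl⟩
  · rintro ⟨c, x, rfl⟩
    exact ⟨_, Submodule.mem_one.2 ⟨c, rfl⟩, _, ⟨x, rfl⟩, rfl⟩

/-- Induction on the length of a product in the enveloping algebra. -/
theorem envFiltration_succ_induction {n : ℕ} {p : U → Prop}
    (base : ∀ u ∈ envFiltration L n, p u)
    (mul : ∀ (x : L), ∀ u ∈ envFiltration L n, p (envIncl L x * u))
    (add : ∀ u v, p u → p v → p (u + v)) {u : U} (hu : u ∈ envFiltration L (n + 1)) : p u := by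
  rw [envFiltration_succ] at hu
  induction hu using Submodule.mul_induction_on' with
  | mem_mul_mem a ha v hv =>
    obtain ⟨c, x, rfl⟩ := (mem_envFiltration_one L).1 ha
    rw [add_mul]
    refine add _ _ (base _ ?_) (mul x v hv)
    rw [← Algebra.smul_def]
    exact Submodule.smul_mem _ _ hv
  | add u _ v _ hu hv => exact add u v hu hv

theorem exists_mem_envFiltration (u : U) : ∃ n, u ∈ envFiltration L n := by
  let S : Subalgebra ℂ U :=
    { carrier := {u | ∃ n, u ∈ envFiltration L n}
      mul_mem' := by
        rintro a b ⟨m, ha⟩ ⟨n, hb⟩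
        exact ⟨m + n, by rw [envFiltration_add]; exact Submodule.mul_mem_mul ha hb⟩
      add_mem' := by
        rintro a b ⟨m, ha⟩ ⟨n, hb⟩
        exact ⟨max m n, add_mem (envFiltration_mono L (le_max_left _ _) ha)
          (envFiltration_mono L (le_max_right _ _) hb)⟩
      algebraMap_mem' := fun c => ⟨0, by
        rw [envFiltration, pow_zero]; exact Submodule.mem_one.2 ⟨c, rfl⟩⟩ }
  let φ : L →ₗ⁅ℂ⁆ S :=
    { toFun := fun x => ⟨envIncl L x, 1, envIncl_mem_envFiltration L x⟩
      map_add' := fun x y => Subtype.ext (map_add _ _ _)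
      map_smul' := fun c x => Subtype.ext (map_smul _ _ _)
      map_lie' := fun {x y} => Subtype.ext (envIncl_lie L x y) }
  have h : S.val.comp (UniversalEnvelopingAlgebra.lift ℂ φ) = AlgHom.id ℂ U :=
    envAlgHom_ext L fun x => by
      rw [AlgHom.comp_apply, lift_envIncl]
      rfl
  have := (UniversalEnvelopingAlgebra.lift ℂ φ u).2
  rwa [show ((UniversalEnvelopingAlgebra.lift ℂ φ u : S) : U) = u from DFunLike.congr_fun h u]
    at this

/-- The adjoint action is a derivation preserving L, so it does not lengthen products. This makes
the error term in `envAdams_mul` of lower order. -/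
theorem commutator_mem_envFiltration (x : L) {n : ℕ} {u : U} (hu : u ∈ envFiltration L n) :
    envIncl L x * u - u * envIncl L x ∈ envFiltration L n := by
  induction n generalizing u with
  | zero =>
    rw [envFiltration, pow_zero] at hu
    obtain ⟨c, rfl⟩ := Submodule.mem_one.1 hu
    rw [Algebra.commutes, sub_self]
    exact zero_mem _
  | succ n ih =>
    refine envFiltration_succ_induction L (p := fun u =>
      envIncl L x * u - u * envIncl L x ∈ envFiltration L (n + 1)) ?_ ?_ ?_ hu
    · exact fun u hu => envFiltration_le_succ L n (ih hu)
    · intro y u hu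
      have : envIncl L x * (envIncl L y * u) - envIncl L y * u * envIncl L x =
          envIncl L ⁅x, y⁆ * u + envIncl L y * (envIncl L x * u - u * envIncl L x) := by
        rw [envIncl_lie]; noncomm_ring
      rw [this, envFiltration_succ]
      exact add_mem (Submodule.mul_mem_mul (envIncl_mem_envFiltration L _) hu)
        (Submodule.mul_mem_mul (envIncl_mem_envFiltration L _) (ih hu))
    · intro u v hu hv
      have : envIncl L x * (u + v) - (u + v) * envIncl L x =
        (envIncl L x * u - u * envIncl L x) + (envIncl L x * v - v * envIncl L x) := by
        noncomm_ring
      rw [this]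
      exact add_mem hu hv

/-- The tensors of total filtration degree at most `n`. -/
def envTensorFiltration (n : ℕ) : Submodule ℂ (U ⊗[ℂ] U) :=
  Submodule.span ℂ {t | ∃ i j, i + j = n ∧ ∃ a ∈ envFiltration L i, ∃ b ∈ envFiltration L j,
    t = a ⊗ₜ[ℂ] b}

theorem envTensorFiltration_le_succ (n : ℕ) :
    envTensorFiltration L n ≤ envTensorFiltration L (n + 1) := by
  refine Submodule.span_le.2 ?_
  rintro _ ⟨i, j, rfl, a, ha, b, hb, rfl⟩
  exact Submodule.subset_span ⟨i + 1, j, by ring, a, envFiltration_le_succ L i ha, b, hb, rfl⟩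

theorem mul_mem_envTensorFiltration (x : L) {n : ℕ} {t : U ⊗[ℂ] U}
    (ht : t ∈ envTensorFiltration L n) :
    envComul L (envIncl L x) * t ∈ envTensorFiltration L (n + 1) := by
  induction ht using Submodule.span_induction with
  | mem t ht =>
    obtain ⟨i, j, rfl, a, ha, b, hb, rfl⟩ := ht
    rw [envComul_envIncl, add_mul, Algebra.TensorProduct.tmul_mul_tmul,
      Algebra.TensorProduct.tmul_mul_tmul, one_mul, one_mul]
    refine add_mem (Submodule.subset_span ⟨i + 1, j, by ring, _, ?_, b, hb, rfl⟩)
      (Submodule.subset_span ⟨i, j + 1, by ring, a, ha, _, ?_, rfl⟩) <;>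
    · rw [envFiltration_succ]
      exact Submodule.mul_mem_mul (envIncl_mem_envFiltration L _) ‹_›
  | zero => rw [mul_zero]; exact zero_mem _
  | add s t _ _ hs ht => rw [mul_add]; exact add_mem hs ht
  | smul c t _ ht => rw [mul_smul_comm]; exact Submodule.smul_mem _ _ ht

theorem envComul_mem_envTensorFiltration {n : ℕ} {u : U} (hu : u ∈ envFiltration L n) :
    envComul L u ∈ envTensorFiltration L n := by
  induction n generalizing u with
  | zero =>
    rw [envFiltration, pow_zero] at hu
    obtain ⟨c, rfl⟩ := Submodule.mem_one.1 hu
    rw [AlgHom.commutes, Algebra.algebraMap_eq_smul_one]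
    have h1 : (1 : U) ∈ envFiltration L 0 := by
      rw [envFiltration, pow_zero]; exact Submodule.one_le.1 le_rfl
    exact Submodule.smul_mem _ _ (Submodule.subset_span ⟨0, 0, rfl, 1, h1, 1, h1, rfl⟩)
  | succ n ih =>
    refine envFiltration_succ_induction L
      (p := fun u => envComul L u ∈ envTensorFiltration L (n + 1)) ?_ ?_ ?_ hu
    · exact fun u hu => envTensorFiltration_le_succ L n (ih hu)
    · intro x u hu
      rw [map_mul]
      exact mul_mem_envTensorFiltration L x (ih hu)
    · intro u v hu hv
      rw [map_add]; exact add_mem hu hv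

/-- The second Adams operator `u ↦ u₍₁₎ u₍₂₎` of the enveloping algebra. -/
def envAdams : U →ₗ[ℂ] U := LinearMap.mul' ℂ U ∘ₗ (envComul L).toLinearMap

theorem envAdams_apply (u : U) : envAdams L u = LinearMap.mul' ℂ U (envComul L u) := rfl

/-- The linear map `a ⊗ b ↦ [x, a] b`. -/
def commutatorMul (x : L) : U ⊗[ℂ] U →ₗ[ℂ] U :=
  LinearMap.mul' ℂ U ∘ₗ (LinearMap.mulLeft ℂ (envIncl L x) -
    LinearMap.mulRight ℂ (envIncl L x)).rTensor U

theorem commutatorMul_mem (x : L) {n : ℕ} {t : U ⊗[ℂ] U} (ht : t ∈ envTensorFiltration L n) :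
    commutatorMul L x t ∈ envFiltration L n := by
  suffices h : envTensorFiltration L n ≤ (envFiltration L n).comap (commutatorMul L x) from h ht
  refine Submodule.span_le.2 ?_
  rintro _ ⟨i, j, rfl, a, ha, b, hb, rfl⟩
  rw [envFiltration_add]
  exact Submodule.mul_mem_mul (commutator_mem_envFiltration L x ha) hb

/-- For Δ(u) = ∑ a ⊗ b the left side is ∑ (x a b + a x b), and moving x to the front in the second
term costs [x, a] b. -/
theorem envAdams_mul (x : L) (u : U) : envAdams L (envIncl L x * u) =
    (2 : ℂ) • (envIncl L x * envAdams L u) - commutatorMul L x (envComul L u) := by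
  rw [envAdams_apply, envAdams_apply, map_mul, envComul_envIncl]
  generalize envComul L u = t
  induction t using TensorProduct.induction_on with
  | zero => simp
  | tmul a b =>
    simp only [commutatorMul, add_mul, Algebra.TensorProduct.tmul_mul_tmul, one_mul, map_add,
      LinearMap.mul'_apply, LinearMap.comp_apply, LinearMap.rTensor_tmul, LinearMap.sub_apply,
      LinearMap.mulLeft_apply, LinearMap.mulRight_apply, two_smul]
    noncomm_ring
  | add s t hs ht =>
    rw [mul_add, map_add, hs, ht, map_add, map_add, mul_add, smul_add]
    abel

/-- Each factor from L contributes a 2 up to lower order, so the Adams operator acts by 2ⁿ⁺¹ on the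
graded piece of degree n + 1. This detects primitive elements without a PBW basis. -/
theorem envAdams_sub_mem {n : ℕ} {u : U} (hu : u ∈ envFiltration L (n + 1)) :
    envAdams L u - (2 : ℂ) ^ (n + 1) • u ∈ envFiltration L n := by
  induction n generalizing u with
  | zero =>
    obtain ⟨c, x, rfl⟩ := (mem_envFiltration_one L).1 hu
    have : envAdams L (algebraMap ℂ U c + envIncl L x) -
        (2 : ℂ) ^ (0 + 1) • (algebraMap ℂ U c + envIncl L x) = algebraMap ℂ U (-c) := by
      rw [envAdams_apply, map_add, AlgHom.commutes, envComul_envIncl, map_add, map_add,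
        Algebra.TensorProduct.algebraMap_apply, LinearMap.mul'_apply, LinearMap.mul'_apply,
        LinearMap.mul'_apply, mul_one, mul_one, one_mul, zero_add, pow_one, two_smul, map_neg]
      abel
    rw [this, envFiltration, pow_zero]
    exact Submodule.mem_one.2 ⟨_, rfl⟩
  | succ n ih =>
    refine envFiltration_succ_induction L (p := fun u =>
      envAdams L u - (2 : ℂ) ^ (n + 1 + 1) • u ∈ envFiltration L (n + 1)) ?_ ?_ ?_ hu
    · intro u hu
      have : envAdams L u - (2 : ℂ) ^ (n + 1 + 1) • u =
          (envAdams L u - (2 : ℂ) ^ (n + 1) • u) - (2 : ℂ) ^ (n + 1) • u := by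
        rw [pow_succ _ (n + 1)]; module
      rw [this]
      exact sub_mem (envFiltration_le_succ L n (ih hu)) (Submodule.smul_mem _ _ hu)
    · intro x u hu
      have : envAdams L (envIncl L x * u) - (2 : ℂ) ^ (n + 1 + 1) • (envIncl L x * u) =
          (2 : ℂ) • (envIncl L x * (envAdams L u - (2 : ℂ) ^ (n + 1) • u)) -
            commutatorMul L x (envComul L u) := by
        rw [envAdams_mul, mul_sub, mul_smul_comm, pow_succ _ (n + 1)]; module
      rw [this]
      refine sub_mem (Submodule.smul_mem _ _ ?_)
        (commutatorMul_mem L x (envComul_mem_envTensorFiltration L hu))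
      rw [envFiltration_succ]
      exact Submodule.mul_mem_mul (envIncl_mem_envFiltration L _) (ih hu)
    · intro u v hu hv
      rw [map_add, smul_add, add_sub_add_comm]
      exact add_mem hu hv

/-- The primitive elements of an enveloping algebra are the elements of the Lie algebra. -/
theorem exists_eq_envIncl_of_primitive {u : U}
    (hu : envComul L u = u ⊗ₜ[ℂ] 1 + 1 ⊗ₜ[ℂ] u) : ∃ x, u = envIncl L x := by
  have hA : envAdams L u = (2 : ℂ) • u := by
    rw [envAdams_apply, hu, map_add, LinearMap.mul'_apply, LinearMap.mul'_apply, mul_one, one_mul,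
      two_smul]
  have key : ∀ n, u ∈ envFiltration L (n + 1) → u ∈ envFiltration L 1 := by
    intro n
    induction n with
    | zero => exact id
    | succ n ih =>
      intro h
      apply ih
      have h1 := envAdams_sub_mem L h
      rw [hA, ← sub_smul] at h1
      -- A primitive u has Adams eigenvalue 2, while its top symbol would have eigenvalue 2ⁿ⁺²; as
      -- these differ, u already lies one step lower.
      have h2 : (2 : ℂ) - 2 ^ (n + 1 + 1) ≠ 0 := by
        rw [pow_succ', ← mul_one_sub, mul_ne_zero_iff]
        refine ⟨two_ne_zero, sub_ne_zero.2 fun h => ?_⟩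
        have : (1 : ℕ) = 2 ^ (n + 1) := by exact_mod_cast h
        exact absurd this.symm (Nat.one_lt_two_pow (Nat.succ_ne_zero n)).ne'
      exact (Submodule.smul_mem_iff _ h2).1 h1
  obtain ⟨n, hn⟩ := exists_mem_envFiltration L u
  obtain ⟨c, x, rfl⟩ := (mem_envFiltration_one L).1 (key n (envFiltration_le_succ L n hn))
  refine ⟨x, ?_⟩
  have h := hu
  rw [map_add, AlgHom.commutes, envComul_envIncl] at h
  -- Multiplying out the primitivity equation gives c + 2x = 2c + 2x.
  have h3 : algebraMap ℂ U c = 0 := by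
    have h4 := congrArg (LinearMap.mul' ℂ U) h
    simp only [map_add, Algebra.TensorProduct.algebraMap_apply, LinearMap.mul'_apply, mul_one,
      one_mul] at h4
    have h5 : algebraMap ℂ U c + (envIncl L x + envIncl L x) + algebraMap ℂ U c =
        algebraMap ℂ U c + (envIncl L x + envIncl L x) + 0 := by
      rw [add_zero]; conv_rhs => rw [h4]
      abel
    exact add_left_cancel h5
  rw [h3, zero_add]

end PrimitiveElements

/-! ### Tensors as endomorphisms: contraction against the form. -/

section CasimirContraction

attribute [local instance 100] LieRing.ofAssociativeRing

variable {g : Type*} [LieRing g] [LieAlgebra ℂ g]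

/-- The contraction `a ⊗ b ↦ (b, y) a` of a tensor against `y`. -/
def contractSecond (B : LinearMap.BilinForm ℂ g) (y : g) : g ⊗[ℂ] g →ₗ[ℂ] g :=
  TensorProduct.lift ((LinearMap.lsmul ℂ g).flip.compl₂ (B.flip y))

@[simp] theorem contractSecond_tmul (B : LinearMap.BilinForm ℂ g) (y a b : g) :
    contractSecond B y (a ⊗ₜ[ℂ] b) = B b y • a := rfl

theorem contractSecond_casimirTensor [FiniteDimensional ℂ g] (B : LinearMap.BilinForm ℂ g)
    (hB : B.Nondegenerate) (y : g) :
    contractSecond B y (casimirTensor B hB) = y := by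
  rw [casimirTensor, map_sum]
  simp only [contractSecond_tmul]
  conv_rhs => rw [← (Module.finBasis ℂ g).sum_repr y]
  refine Finset.sum_congr rfl fun i _ => ?_
  congr 1
  conv_lhs => rw [← (Module.finBasis ℂ g).sum_repr y]
  rw [map_sum]
  simp only [map_smul, LinearMap.BilinForm.apply_dualBasis_left, smul_eq_mul, mul_ite, mul_one,
    mul_zero, Finset.sum_ite_eq', Finset.mem_univ, if_true]

theorem contractSecond_rTensor (B : LinearMap.BilinForm ℂ g) (y : g) (φ : g →ₗ[ℂ] g)
    (t : g ⊗[ℂ] g) : contractSecond B y (φ.rTensor g t) = φ (contractSecond B y t) := by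
  induction t using TensorProduct.induction_on with
  | zero => simp
  | tmul a b => simp
  | add s t hs ht => simp [hs, ht]

theorem contractSecond_casimirBracket [FiniteDimensional ℂ g] (B : LinearMap.BilinForm ℂ g)
    (hB : B.Nondegenerate) (x y : g) : contractSecond B y (casimirBracket B hB x) = ⁅x, y⁆ := by
  change contractSecond B y ((LieAlgebra.ad ℂ g x).rTensor g (casimirTensor B hB)) = _
  rw [contractSecond_rTensor, contractSecond_casimirTensor, LieAlgebra.ad_apply]

/-- Contraction identifies g ⊗ g with End(g), taking Ω to the identity and [x ⊗ 1, Ω] to ad x.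
Tensor identities are thereby checked as identities of endomorphisms. -/
theorem eq_zero_of_contractSecond [FiniteDimensional ℂ g] (B : LinearMap.BilinForm ℂ g)
    (hB : B.Nondegenerate)
    {t : g ⊗[ℂ] g} (h : ∀ y, contractSecond B y t = 0) : t = 0 := by
  have key : ∀ t : g ⊗[ℂ] g, ∑ i, contractSecond B (Module.finBasis ℂ g i) t ⊗ₜ[ℂ]
      B.dualBasis hB (Module.finBasis ℂ g) i = t := by
    intro t
    induction t using TensorProduct.induction_on with
    | zero => simp
    | tmul a b =>
      simp only [contractSecond_tmul, TensorProduct.smul_tmul]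
      rw [← TensorProduct.tmul_sum]
      congr 1
      conv_rhs => rw [← (B.dualBasis hB (Module.finBasis ℂ g)).sum_repr b]
      refine Finset.sum_congr rfl fun i _ => ?_
      rw [LinearMap.BilinForm.dualBasis_repr_apply]
    | add s t hs ht =>
      simp only [map_add, TensorProduct.add_tmul, Finset.sum_add_distrib, hs, ht]
  rw [← key t]
  exact Finset.sum_eq_zero fun i _ => by rw [h, TensorProduct.zero_tmul]

theorem ad_injective_of_center_eq_bot (hc : LieAlgebra.center ℂ g = ⊥) :
    Function.Injective (LieAlgebra.ad ℂ g : g → Module.End ℂ g) := by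
  rw [injective_iff_map_eq_zero]
  intro x hx
  have : x ∈ LieAlgebra.center ℂ g := fun y => by
    rw [← lie_skew, ← LieAlgebra.ad_apply ℂ, hx, LinearMap.zero_apply, neg_zero]
  rw [hc] at this
  exact this

end CasimirContraction

/-! ### Graded primitive elements of U(g[u]) and injectivity of the cobracket. -/

section CurrentPrimitives

attribute [local instance 100] LieRing.ofAssociativeRing

variable {g : Type*} [LieRing g] [LieAlgebra ℂ g]

/-- The rescaling `u ↦ 2u` of the current algebra. -/
def currentScale : Current g →ₗ⁅ℂ⁆ Current g where
  toLinearMap := ((Polynomial.aeval (2 * Polynomial.X : ℂ[X])).toLinearMap).rTensor g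
  map_lie' := by
    intro s t
    change (LinearMap.rTensor g _) _ = ⁅(LinearMap.rTensor g _) s, (LinearMap.rTensor g _) t⁆
    induction s using TensorProduct.induction_on with
    | zero => simp
    | add s s' hs hs' => rw [add_lie, map_add, hs, hs', map_add, add_lie]
    | tmul p x =>
      induction t using TensorProduct.induction_on with
      | zero => simp
      | add s s' hs hs' => rw [lie_add, map_add, hs, hs', map_add, lie_add]
      | tmul q y => simp

theorem currentScale_currentMonomial (n : ℕ) (x : g) :
    currentScale (currentMonomial n x) = (2 : ℂ) ^ n • currentMonomial n x := by
  change (LinearMap.rTensor g _) ((Polynomial.X ^ n : ℂ[X]) ⊗ₜ[ℂ] x) =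
    (2 : ℂ) ^ n • ((Polynomial.X ^ n : ℂ[X]) ⊗ₜ[ℂ] x)
  rw [LinearMap.rTensor_tmul, AlgHom.toLinearMap_apply, map_pow, Polynomial.aeval_X, mul_pow,
    TensorProduct.smul_tmul', Algebra.smul_def, map_pow, map_ofNat]

/-- The evaluation `g[u] → g` at `u = 1`. -/
def currentEvalOne : Current g →ₗ⁅ℂ⁆ g where
  toLinearMap := TensorProduct.lift (LinearMap.lsmul ℂ g ∘ₗ (Polynomial.aeval (1 : ℂ)).toLinearMap)
  map_lie' := by
    intro s t
    change TensorProduct.lift _ _ = ⁅TensorProduct.lift _ s, TensorProduct.lift _ t⁆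
    induction s using TensorProduct.induction_on with
    | zero => simp
    | add s s' hs hs' => rw [add_lie, map_add, hs, hs', map_add, add_lie]
    | tmul p x =>
      induction t using TensorProduct.induction_on with
      | zero => simp
      | add s s' hs hs' => rw [lie_add, map_add, hs, hs', map_add, lie_add]
      | tmul q y => simp [smul_smul, mul_comm]

theorem currentEvalOne_currentMonomial (n : ℕ) (x : g) :
    currentEvalOne (currentMonomial n x) = x := by
  change TensorProduct.lift _ ((Polynomial.X ^ n : ℂ[X]) ⊗ₜ[ℂ] x) = x
  simp

variable (g) in
/-- The rescaling automorphism of `U(g[u])`. -/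
def currentEnvScale : CurrentEnv g →ₐ[ℂ] CurrentEnv g :=
  UniversalEnvelopingAlgebra.lift ℂ ((UniversalEnvelopingAlgebra.ι ℂ).comp currentScale)

theorem currentEnvScale_envIncl (n : ℕ) (x : g) :
    currentEnvScale g (envIncl (Current g) (currentMonomial n x)) =
      (2 : ℂ) ^ n • envIncl (Current g) (currentMonomial n x) := by
  rw [currentEnvScale, lift_envIncl, LieHom.comp_apply, currentScale_currentMonomial, map_smul]
  rfl

theorem currentEnvScale_of_mem_deg {n : ℕ} {u : CurrentEnv g} (hu : u ∈ currentEnvDeg g n) :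
    currentEnvScale g u = (2 : ℂ) ^ n • u := by
  induction hu using Submodule.span_induction with
  | mem u hu =>
    obtain ⟨l, rfl, rfl⟩ := hu
    induction l with
    | nil => simp
    | cons p l ih =>
      rw [List.map_cons, List.prod_cons, map_mul, ih, currentEnvScale_envIncl, List.map_cons,
        List.sum_cons, pow_add, smul_mul_smul_comm]
  | zero => simp
  | add s t _ _ hs ht => rw [map_add, hs, ht, smul_add]
  | smul c t _ ht => rw [map_smul, ht, smul_comm]

/-- The coefficient of `uⁿ`. -/
def currentCoeff (n : ℕ) : Current g →ₗ[ℂ] g :=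
  TensorProduct.lift (LinearMap.lsmul ℂ g ∘ₗ Polynomial.lcoeff ℂ n)

/-- A primitive element comes from g[u]. The rescaling u ↦ 2u acts by 2ᵏ in degree k, and
independence of its eigenspaces leaves only the coefficient of uⁿ. -/
theorem exists_currentMonomial_of_primitive {n : ℕ} {u : CurrentEnv g}
    (hdeg : u ∈ currentEnvDeg g n)
    (hu : envComul (Current g) u = u ⊗ₜ[ℂ] 1 + 1 ⊗ₜ[ℂ] u) :
    ∃ x : g, u = envIncl (Current g) (currentMonomial n x) := by
  obtain ⟨z, rfl⟩ := exists_eq_envIncl_of_primitive _ hu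
  refine ⟨currentCoeff n z, ?_⟩
  let V : ℕ → Submodule ℂ (CurrentEnv g) := fun k =>
    Module.End.eigenspace (currentEnvScale g).toLinearMap ((2 : ℂ) ^ k)
  have hV : iSupIndep V := (Module.End.eigenspaces_iSupIndep _).comp fun a b h => by
    have : (2 : ℕ) ^ a = 2 ^ b := by exact_mod_cast h
    exact Nat.pow_right_injective le_rfl this
  have hmon : ∀ k (x : g), envIncl (Current g) (currentMonomial k x) ∈ V k := fun k x =>
    Module.End.mem_eigenspace_iff.2 (currentEnvScale_envIncl k x)
  have h1 : envIncl (Current g) z - envIncl (Current g) (currentMonomial n (currentCoeff n z)) ∈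
      V n :=
    sub_mem (Module.End.mem_eigenspace_iff.2 (currentEnvScale_of_mem_deg hdeg)) (hmon _ _)
  -- Removing the uⁿ-part of z leaves a sum of eigenvectors for the other powers of 2.
  have h2 : ∀ z : Current g,
      envIncl (Current g) z - envIncl (Current g) (currentMonomial n (currentCoeff n z)) ∈
      ⨆ (j) (_ : j ≠ n), V j := by
    intro z
    have hadd : ∀ z z' : Current g,
        envIncl (Current g) (z + z') -
          envIncl (Current g) (currentMonomial n (currentCoeff n (z + z'))) =
        (envIncl (Current g) z - envIncl (Current g) (currentMonomial n (currentCoeff n z))) +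
        (envIncl (Current g) z' - envIncl (Current g) (currentMonomial n (currentCoeff n z'))) := by
      intro z z'
      simp only [map_add]; abel
    induction z using TensorProduct.induction_on with
    | zero => simp
    | add s t hs ht => rw [hadd]; exact add_mem hs ht
    | tmul p x =>
      induction p using Polynomial.induction_on' with
      | add p q hp hq => rw [TensorProduct.add_tmul, hadd]; exact add_mem hp hq
      | monomial k c =>
        have e1 : (Polynomial.monomial k c : ℂ[X]) ⊗ₜ[ℂ] x = currentMonomial k (c • x) := by
          rw [currentMonomial, TensorProduct.mk_apply, ← TensorProduct.smul_tmul,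
            Polynomial.smul_X_eq_monomial]
        have e2 : currentCoeff n (currentMonomial k (c • x)) = if k = n then c • x else 0 := by
          change TensorProduct.lift _ ((Polynomial.X ^ k : ℂ[X]) ⊗ₜ[ℂ] (c • x)) = _
          simp [Polynomial.coeff_X_pow, eq_comm]
        rw [e1, e2]
        split_ifs with h
        · rw [h, sub_self]; exact zero_mem _
        · rw [map_zero, map_zero, sub_zero]
          exact Submodule.mem_iSup_of_mem k (Submodule.mem_iSup_of_mem h (hmon _ _))
  exact sub_eq_zero.1 (Submodule.disjoint_def.1 (hV n) _ h1 (h2 z))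

theorem currentCobracket_currentMonomial [FiniteDimensional ℂ g] (B : LinearMap.BilinForm ℂ g)
    (hB : B.Nondegenerate) (n : ℕ) (x : g) :
    currentCobracket B hB (currentMonomial n x) = ∑ a ∈ Finset.range n,
      TensorProduct.map (currentMonomial a) (currentMonomial (n - 1 - a))
        (casimirBracket B hB x) := by
  rw [currentCobracket, currentMonomial, TensorProduct.mk_apply, TensorProduct.lift.tmul,
    show (Polynomial.X ^ n : ℂ[X]) = Polynomial.basisMonomials ℂ n by
      rw [Polynomial.coe_basisMonomials, Polynomial.X_pow_eq_monomial],
    Module.Basis.constr_basis, LinearMap.sum_apply]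
  rfl

/-- The action of `U(g[u])` on `g` through the evaluation at `u = 1`. -/
def currentEnvAd : CurrentEnv g →ₐ[ℂ] Module.End ℂ g :=
  UniversalEnvelopingAlgebra.lift ℂ ((LieAlgebra.ad ℂ g).comp currentEvalOne)

theorem currentEnvAd_envIncl (n : ℕ) (x : g) :
    currentEnvAd (envIncl (Current g) (currentMonomial n x)) = LieAlgebra.ad ℂ g x := by
  rw [currentEnvAd, lift_envIncl, LieHom.comp_apply, currentEvalOne_currentMonomial]

/-- The adjoint action through u = 1 recovers ad x, which determines x because the centre is zero;
PBW is not needed. -/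
theorem envIncl_currentMonomial_injective (hc : LieAlgebra.center ℂ g = ⊥)
    [FiniteDimensional ℂ g] (n : ℕ) :
    Function.Injective fun x : g => envIncl (Current g) (currentMonomial n x) := by
  intro x y h
  apply ad_injective_of_center_eq_bot hc
  rw [← currentEnvAd_envIncl n, ← currentEnvAd_envIncl n]
  exact congrArg _ h

/-- At u = v = 1 all n + 1 summands of the cobracket become [x ⊗ 1, Ω], which contracts to ad x. -/
theorem eq_zero_of_currentCobracket_eq_zero [FiniteDimensional ℂ g]
    (hc : LieAlgebra.center ℂ g = ⊥) (B : LinearMap.BilinForm ℂ g)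
    (hB : B.Nondegenerate) (n : ℕ) (x : g)
    (h : TensorProduct.map (envIncl (Current g)) (envIncl (Current g))
      (currentCobracket B hB (currentMonomial (n + 1) x)) = 0) : x = 0 := by
  have h1 := congrArg (TensorProduct.map (currentEnvAd (g := g)).toLinearMap
    (currentEnvAd (g := g)).toLinearMap) h
  have h2 : ∀ (a b : ℕ) (w : g ⊗[ℂ] g),
      TensorProduct.map (currentEnvAd (g := g)).toLinearMap (currentEnvAd (g := g)).toLinearMap
        (TensorProduct.map (envIncl (Current g)) (envIncl (Current g))
          (TensorProduct.map (currentMonomial a) (currentMonomial b) w)) =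
      TensorProduct.map (LieAlgebra.ad ℂ g).toLinearMap (LieAlgebra.ad ℂ g).toLinearMap w := by
    intro a b w
    induction w using TensorProduct.induction_on with
    | zero => simp
    | add s t hs ht => simp only [map_add, hs, ht]
    | tmul y z =>
      simp only [TensorProduct.map_tmul, AlgHom.toLinearMap_apply, currentEnvAd_envIncl]
      rfl
  rw [currentCobracket_currentMonomial, map_sum, map_sum, map_zero] at h1
  simp only [h2, Finset.sum_const, Finset.card_range] at h1
  rw [← Nat.cast_smul_eq_nsmul ℂ, smul_eq_zero] at h1
  have h3 := h1.resolve_left (Nat.cast_ne_zero.2 (Nat.succ_ne_zero n))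
  have hinj : Function.Injective (LieAlgebra.ad ℂ g).toLinearMap :=
    ad_injective_of_center_eq_bot hc
  have h4 : casimirBracket B hB x = 0 :=
    (map_eq_zero_iff _ (TensorProduct.map_injective_of_flat_flat _ _ hinj hinj)).1 h3
  apply hinj
  ext y
  change ⁅x, y⁆ = _
  rw [← contractSecond_casimirBracket B hB, h4, map_zero, map_zero]
  rfl

end CurrentPrimitives

/-! ### Primitive elements of a homogeneous quantization. -/

namespace HomogeneousQuantization

section Descent

attribute [local instance 100] LieRing.ofAssociativeRing

variable {g : Type*} [LieRing g] [LieAlgebra ℂ g] [FiniteDimensional ℂ g]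
  {B : LinearMap.BilinForm ℂ g} {hB : B.Nondegenerate}
  {A : Type*} [Ring A] [HopfAlgebra ℂ[X] A] [Algebra ℂ A] [IsScalarTower ℂ ℂ[X] A]
  (Q : HomogeneousQuantization B hB A)

/-- Over the principal ideal domain ℂ[ħ], torsion free means flat, and flatness passes to the tensor
square. -/
theorem hbar_smul_tensor_injective (Q : HomogeneousQuantization B hB A) :
    Function.Injective fun t : A ⊗[ℂ[X]] A => (Polynomial.X : ℂ[X]) • t := by
  have := Q.torsionFree
  have : Module.Flat ℂ[X] A := inferInstance
  have : Module.Flat ℂ[X] (A ⊗[ℂ[X]] A) := inferInstance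
  exact smul_right_injective _ Polynomial.X_ne_zero

theorem exists_mem_deg_of_proj_eq_zero {n : ℕ} {a : A} (ha : a ∈ Q.deg (n + 1))
    (h : Q.proj a = 0) : ∃ b ∈ Q.deg n, a = (Polynomial.X : ℂ[X]) • b := by
  classical
  obtain ⟨b, rfl⟩ := Q.exists_of_proj_eq_zero a h
  obtain ⟨d, rfl⟩ := Q.isInternal.surjective b
  set m : (n : ℕ) → Q.deg n →+ Q.deg (n + 1) := fun n =>
    { toFun := fun y => ⟨(Polynomial.X : ℂ[X]) • (y : A), Q.hbar_smul_mem y.2⟩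
      map_zero' := by simp
      map_add' := fun y z => by ext; simp } with hm
  set s : (DirectSum ℕ fun n => Q.deg n) →+ DirectSum ℕ fun n => Q.deg n :=
    DirectSum.toAddMonoid fun n => (DirectSum.of (fun n => Q.deg n) (n + 1)).comp (m n) with hs
  have h1 : ∀ d, DirectSum.coeAddMonoidHom Q.deg (s d) =
      (Polynomial.X : ℂ[X]) • DirectSum.coeAddMonoidHom Q.deg d := by
    intro d
    induction d using DirectSum.induction_on with
    | zero => simp
    | of n y => simp [hs, hm]
    | add y z hy hz => simp [map_add, hy, hz, smul_add]
  -- Here `s` is multiplication by ħ in terms of components. The quotient b need not be homogeneous,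
  -- but its component of degree n already serves as the witness.
  have h2 : ∀ d, s d (n + 1) = m n (d n) := by
    intro d
    induction d using DirectSum.induction_on with
    | zero => simp
    | of k y =>
      simp only [hs, DirectSum.toAddMonoid_of, AddMonoidHom.comp_apply]
      by_cases hk : k = n
      · subst hk
        rw [DirectSum.of_eq_same, DirectSum.of_eq_same]
      · rw [DirectSum.of_eq_of_ne _ _ _ (fun h => hk (Nat.succ_injective h.symm)),
          DirectSum.of_eq_of_ne _ _ _ (fun h => hk h.symm), map_zero]
    | add y z hy hz => simp [map_add, hy, hz]
  have h3 : s d = DirectSum.of (fun n => Q.deg n) (n + 1) ⟨_, ha⟩ := by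
    apply Q.isInternal.injective
    rw [h1, DirectSum.coeAddMonoidHom_of]
  have h4 := h2 d
  rw [h3, DirectSum.of_eq_same] at h4
  exact ⟨d n, (d n).2, congrArg Subtype.val h4⟩

theorem map_proj_tmul (a b : A) :
    TensorProduct.map (semilinearAtZero Q.proj Q.proj_hbar) (semilinearAtZero Q.proj Q.proj_hbar)
      (a ⊗ₜ[ℂ[X]] b) = Q.proj a ⊗ₜ[ℂ] Q.proj b := rfl

theorem proj_one_tmul (a : A) (h : Coalgebra.comul (R := ℂ[X]) a = a ⊗ₜ 1 + 1 ⊗ₜ a) :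
    envComul (Current g) (Q.proj a) = Q.proj a ⊗ₜ 1 + 1 ⊗ₜ Q.proj a := by
  rw [Q.proj_comul, h, map_add, map_proj_tmul, map_proj_tmul, map_one]

theorem proj_mem_deg {n : ℕ} {a : A} (ha : a ∈ Q.deg n) : Q.proj a ∈ currentEnvDeg g n := by
  rw [← Q.proj_deg]
  exact ⟨a, ha, rfl⟩

/-- Primitive elements of positive degree vanish modulo `ħ`. -/
theorem proj_eq_zero_of_primitive (hc : LieAlgebra.center ℂ g = ⊥) {n : ℕ} {a : A}
    (ha : a ∈ Q.deg (n + 1)) (h : Coalgebra.comul (R := ℂ[X]) a = a ⊗ₜ 1 + 1 ⊗ₜ a) :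
    Q.proj a = 0 := by
  obtain ⟨x, hx⟩ := exists_currentMonomial_of_primitive (Q.proj_mem_deg ha) (Q.proj_one_tmul a h)
  obtain ⟨t, ht, ht'⟩ := Q.semiclassical _ a hx
  -- A primitive element has a symmetric coproduct, so the cobracket of its reduction vanishes.
  have h0 : (Polynomial.X : ℂ[X]) • t = (Polynomial.X : ℂ[X]) • (0 : A ⊗[ℂ[X]] A) := by
    rw [← ht, h, map_add, TensorProduct.comm_tmul, TensorProduct.comm_tmul, smul_zero]
    abel
  have h1 : t = 0 := Q.hbar_smul_tensor_injective h0
  rw [h1, map_zero] at ht'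
  rw [hx, eq_zero_of_currentCobracket_eq_zero hc B hB n x ht'.symm, map_zero, map_zero]

/-- The primitive elements of degree `n` are the elements `ħⁿ x` with `x ∈ g`. -/
theorem exists_lift_of_primitive (hc : LieAlgebra.center ℂ g = ⊥) {n : ℕ} {a : A}
    (ha : a ∈ Q.deg n) (h : Coalgebra.comul (R := ℂ[X]) a = a ⊗ₜ 1 + 1 ⊗ₜ a) :
    ∃ x : g, a = (Polynomial.X ^ n : ℂ[X]) • Q.lift x := by
  induction n generalizing a with
  | zero =>
    obtain ⟨x, hx⟩ := exists_currentMonomial_of_primitive (Q.proj_mem_deg ha) (Q.proj_one_tmul a h)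
    refine ⟨x, ?_⟩
    rw [pow_zero, one_smul]
    exact Q.eq_of_proj ha (Q.lift_mem x) (by rw [hx, proj_lift])
  | succ n ih =>
    obtain ⟨b, hb, rfl⟩ :=
      Q.exists_mem_deg_of_proj_eq_zero ha (Q.proj_eq_zero_of_primitive hc ha h)
    obtain ⟨x, rfl⟩ := ih hb (Q.hbar_smul_tensor_injective (by
      simpa only [map_smul, TensorProduct.smul_tmul', TensorProduct.tmul_smul, smul_add] using h))
    exact ⟨x, by rw [smul_smul, pow_succ']⟩

theorem lift_injective (hc : LieAlgebra.center ℂ g = ⊥) : Function.Injective Q.lift := by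
  intro x y h
  have := congrArg Q.proj h
  rw [proj_lift, proj_lift] at this
  exact envIncl_currentMonomial_injective hc 0 this

theorem hbar_pow_smul_injective (Q : HomogeneousQuantization B hB A) (n : ℕ) :
    Function.Injective fun a : A => (Polynomial.X ^ n : ℂ[X]) • a := by
  have := Q.torsionFree
  exact smul_right_injective A (pow_ne_zero n Polynomial.X_ne_zero)

/-- Degree zero embeds in U(g[u]), and tensor products of injections over ℂ are injective. The
tensor comes from one over ℂ, where this applies. -/
theorem tensor_eq_zero_of_proj {t : A ⊗[ℂ[X]] A}
    (ht : t ∈ Submodule.span ℂ {t : A ⊗[ℂ[X]] A | ∃ y ∈ Q.deg 0, ∃ z ∈ Q.deg 0, t = y ⊗ₜ z})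
    (h : TensorProduct.map (semilinearAtZero Q.proj Q.proj_hbar)
      (semilinearAtZero Q.proj Q.proj_hbar) t = 0) : t = 0 := by
  let j : Q.deg 0 ⊗[ℂ] Q.deg 0 →ₗ[ℂ] A ⊗[ℂ[X]] A :=
    TensorProduct.mapOfCompatibleSMul ℂ[X] ℂ ℂ A A ∘ₗ
      TensorProduct.map (Q.deg 0).subtype (Q.deg 0).subtype
  have hj : t ∈ LinearMap.range j := by
    refine Submodule.span_le.2 ?_ ht
    rintro _ ⟨y, hy, z, hz, rfl⟩
    exact ⟨⟨y, hy⟩ ⊗ₜ ⟨z, hz⟩, rfl⟩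
  obtain ⟨s, rfl⟩ := hj
  let p : Q.deg 0 →ₗ[ℂ] CurrentEnv g := Q.proj.toLinearMap ∘ₗ (Q.deg 0).subtype
  have hp : Function.Injective p := fun a b hab =>
    Subtype.ext (Q.eq_of_proj a.2 b.2 hab)
  have key : ∀ s, TensorProduct.map (semilinearAtZero Q.proj Q.proj_hbar)
      (semilinearAtZero Q.proj Q.proj_hbar) (j s) = TensorProduct.map p p s := by
    intro s
    induction s using TensorProduct.induction_on with
    | zero => simp only [map_zero]
    | add s t hs ht => simp only [map_add, hs, ht]
    | tmul a b => rfl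
  rw [key] at h
  rw [(map_eq_zero_iff _ (TensorProduct.map_injective_of_flat_flat p p hp hp)).1 h, map_zero]

/-- Both sides have degree zero and agree modulo ħ, where nothing of degree zero is lost. -/
theorem comul_lift (x : g) :
    Coalgebra.comul (R := ℂ[X]) (Q.lift x) = Q.lift x ⊗ₜ 1 + 1 ⊗ₜ Q.lift x := by
  rw [← sub_eq_zero]
  refine Q.tensor_eq_zero_of_proj (sub_mem ?_ (add_mem ?_ ?_)) ?_
  · refine Submodule.span_mono ?_ (Q.comul_mem (Q.lift_mem x))
    rintro _ ⟨i, j, hij, y, hy, z, hz, rfl⟩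
    obtain ⟨rfl, rfl⟩ := Nat.add_eq_zero_iff.1 hij
    exact ⟨y, hy, z, hz, rfl⟩
  · exact Submodule.subset_span ⟨_, Q.lift_mem x, 1, Q.one_mem, rfl⟩
  · exact Submodule.subset_span ⟨1, Q.one_mem, _, Q.lift_mem x, rfl⟩
  · rw [map_sub, ← Q.proj_comul, proj_lift, envComul_envIncl, map_add, map_proj_tmul,
      map_proj_tmul, proj_lift, map_one, sub_self]

theorem embed_envIncl (x : g) : Q.embed (envIncl g x) = Q.lift x :=
  lift_envIncl g _ x

theorem lift_lie (x y : g) : Q.lift ⁅x, y⁆ = Q.lift x * Q.lift y - Q.lift y * Q.lift x :=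
  Q.lieLift.map_lie x y

theorem lift_smul (c : ℂ) (x : g) : Q.lift (c • x) = c • Q.lift x := map_smul Q.lieLift c x

theorem lift_add (x y : g) : Q.lift (x + y) = Q.lift x + Q.lift y := map_add Q.lieLift x y

theorem embedTensor_tmul (x y : g) :
    Q.embedTensor (x ⊗ₜ y) = Q.lift x ⊗ₜ[ℂ[X]] Q.lift y := by
  change Q.embed (envIncl g x) ⊗ₜ Q.embed (envIncl g y) = _
  rw [embed_envIncl, embed_envIncl]

end Descent

end HomogeneousQuantization

/-! ### Splitting by the sign of the real part of eigenvalues. -/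

section SpectralParts

variable {V W : Type*} [AddCommGroup V] [Module ℂ V] [AddCommGroup W] [Module ℂ W]

/-- The sum of the eigenspaces for eigenvalues with negative real part. -/
def negPart (f : Module.End ℂ V) : Submodule ℂ V :=
  ⨆ μ ∈ {μ : ℂ | μ.re < 0}, Module.End.eigenspace f μ

/-- The sum of the eigenspaces for eigenvalues with nonnegative real part. -/
def nonnegPart (f : Module.End ℂ V) : Submodule ℂ V :=
  ⨆ μ ∈ {μ : ℂ | 0 ≤ μ.re}, Module.End.eigenspace f μ

theorem eq_zero_of_mem_negPart_of_mem_nonnegPart {f : Module.End ℂ V} {x : V}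
    (h : x ∈ negPart f) (h' : x ∈ nonnegPart f) : x = 0 := by
  have hd : Disjoint {μ : ℂ | μ.re < 0} {μ : ℂ | 0 ≤ μ.re} :=
    Set.disjoint_left.2 fun μ (h1 : μ.re < 0) (h2 : 0 ≤ μ.re) => absurd h1 (not_lt.2 h2)
  exact Submodule.disjoint_def.1
    ((Module.End.eigenspaces_iSupIndep f).disjoint_biSup_biSup hd) x h h'

theorem mem_negPart {f : Module.End ℂ V} {x : V} {μ : ℂ} (h : f x = μ • x) (hμ : μ.re < 0) :
    x ∈ negPart f :=
  Submodule.mem_iSup_of_mem μ (Submodule.mem_iSup_of_mem hμ (Module.End.mem_eigenspace_iff.2 h))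

theorem mem_nonnegPart {f : Module.End ℂ V} {x : V} {μ : ℂ} (h : f x = μ • x) (hμ : 0 ≤ μ.re) :
    x ∈ nonnegPart f :=
  Submodule.mem_iSup_of_mem μ (Submodule.mem_iSup_of_mem hμ (Module.End.mem_eigenspace_iff.2 h))

theorem map_mem_negPart {f : Module.End ℂ V} {f' : Module.End ℂ W} (φ : V →ₗ[ℂ] W)
    (h : ∀ x, f' (φ x) = φ (f x)) {x : V} (hx : x ∈ negPart f) : φ x ∈ negPart f' := by
  suffices negPart f ≤ (negPart f').comap φ from this hx
  refine iSup₂_le fun μ hμ y hy => mem_negPart (μ := μ) ?_ hμ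
  rw [h, Module.End.mem_eigenspace_iff.1 hy, map_smul]

theorem map_mem_nonnegPart {f : Module.End ℂ V} {f' : Module.End ℂ W} (φ : V →ₗ[ℂ] W)
    (h : ∀ x, f' (φ x) = φ (f x)) {x : V} (hx : x ∈ nonnegPart f) : φ x ∈ nonnegPart f' := by
  suffices nonnegPart f ≤ (nonnegPart f').comap φ from this hx
  refine iSup₂_le fun μ hμ y hy => mem_nonnegPart (μ := μ) ?_ hμ
  rw [h, Module.End.mem_eigenspace_iff.1 hy, map_smul]

end SpectralParts

/-! ### Invariance of the Casimir tensor. -/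

section CasimirInvariance

variable {g : Type*} [LieRing g] [LieAlgebra ℂ g]

theorem contractSecond_lie (B : LinearMap.BilinForm ℂ g) (hinv : B.lieInvariant g) (y z : g)
    (t : g ⊗[ℂ] g) :
    contractSecond B y ⁅z, t⁆ = ⁅z, contractSecond B y t⁆ - contractSecond B ⁅z, y⁆ t := by
  induction t using TensorProduct.induction_on with
  | zero => simp
  | tmul a b =>
    rw [TensorProduct.LieModule.lie_tmul_right, map_add, contractSecond_tmul, contractSecond_tmul,
      contractSecond_tmul, contractSecond_tmul, lie_smul, hinv, neg_smul, sub_eq_add_neg]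
  | add s t hs ht => rw [lie_add, map_add, hs, ht, map_add, map_add, lie_add]; abel

theorem lie_casimirTensor [FiniteDimensional ℂ g] (B : LinearMap.BilinForm ℂ g)
    (hB : B.Nondegenerate) (hinv : B.lieInvariant g) (z : g) : ⁅z, casimirTensor B hB⁆ = 0 := by
  refine eq_zero_of_contractSecond B hB fun y => ?_
  rw [contractSecond_lie B hinv, contractSecond_casimirTensor, contractSecond_casimirTensor,
    sub_self]

theorem lie_casimirBracket [FiniteDimensional ℂ g] (B : LinearMap.BilinForm ℂ g)
    (hB : B.Nondegenerate) (hinv : B.lieInvariant g) (z x : g) :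
    ⁅z, casimirBracket B hB x⁆ = casimirBracket B hB ⁅z, x⁆ := by
  rw [← sub_eq_zero]
  refine eq_zero_of_contractSecond B hB fun y => ?_
  rw [map_sub, contractSecond_lie B hinv, contractSecond_casimirBracket,
    contractSecond_casimirBracket, contractSecond_casimirBracket, lie_lie, sub_self]

theorem rTensor_ad_lie {d z : g} (h : ⁅d, z⁆ = 0) (t : g ⊗[ℂ] g) :
    (LieAlgebra.ad ℂ g d : Module.End ℂ g).rTensor g ⁅z, t⁆ =
      ⁅z, (LieAlgebra.ad ℂ g d : Module.End ℂ g).rTensor g t⁆ := by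
  induction t using TensorProduct.induction_on with
  | zero => simp
  | tmul a b =>
    have : ⁅d, ⁅z, a⁆⁆ = ⁅z, ⁅d, a⁆⁆ := by rw [leibniz_lie, h, zero_lie, zero_add]
    simp [TensorProduct.LieModule.lie_tmul_right, this]
  | add s t hs ht => simp only [lie_add, map_add, hs, ht]

end CasimirInvariance

/-! ### Positive roots, separating Cartan elements and root vectors. -/

section RootTensors

set_option linter.unusedSectionVars false

variable {g : Type*} [LieRing g] [LieAlgebra ℂ g] [FiniteDimensional ℂ g]
  [LieAlgebra.IsSimple ℂ g] {H : LieSubalgebra ℂ g} [H.IsCartanSubalgebra]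
  (b : (LieAlgebra.IsKilling.rootSystem H).Base)

theorem root_apply_eq (α : H.root) (h : H) :
    (LieAlgebra.IsKilling.rootSystem H).root α h = (α.1 : H → ℂ) h := rfl

theorem exists_prescribed_simple_root_values (c : H.root → ℂ) :
    ∃ d : H, ∀ j ∈ b.support, (j.1 : H → ℂ) d = c j := by
  classical
  refine ⟨(Module.evalEquiv ℂ H).symm (∑ j : b.support, c j • b.toWeightBasis.dualBasis j),
    fun j hj => ?_⟩
  have := Module.apply_evalEquiv_symm_apply (R := ℂ) (M := H)
    ((LieAlgebra.IsKilling.rootSystem H).root j)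
    (∑ j : b.support, c j • b.toWeightBasis.dualBasis j)
  rw [← root_apply_eq, this, ← b.toWeightBasis_apply ⟨j, hj⟩, LinearMap.sum_apply]
  rw [Finset.sum_eq_single ⟨j, hj⟩]
  · rw [LinearMap.smul_apply, Module.Basis.dualBasis_apply_self, if_pos rfl, smul_eq_mul, mul_one]
  · intro k _ hk
    rw [LinearMap.smul_apply, Module.Basis.dualBasis_apply_self, if_neg hk.symm, smul_zero]
  · exact fun h => absurd (Finset.mem_univ _) h

/-- Proportional roots differ at most by a sign, and -α_i has negative height. -/
theorem eq_of_isPos_of_eq_smul {i α : H.root} (hi : i ∈ b.support) (hα : b.IsPos α) {k : ℂ}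
    (h : (LieAlgebra.IsKilling.rootSystem H).root α =
      k • (LieAlgebra.IsKilling.rootSystem H).root i) : α = i := by
  rcases LieAlgebra.IsKilling.eq_neg_or_eq_of_eq_smul i.1 α.1
    (H.isNonZero_coe_root α) k (by ext x; exact LinearMap.congr_fun h x) with h' | h'
  · exfalso
    have h1 : (LieAlgebra.IsKilling.rootSystem H).root α =
        (0 : ℤ) • (LieAlgebra.IsKilling.rootSystem H).root i -
          (LieAlgebra.IsKilling.rootSystem H).root i := by
      rw [zero_smul, zero_sub]
      ext x
      have := DFunLike.congr_fun h' x
      exact this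
    have h2 := RootPairing.Base.isPos_of_mem_support hi
    have h3 := LieAlgebra.IsKilling.rootSystem H |>.root_reflectionPerm i i
    have h4 : α = (LieAlgebra.IsKilling.rootSystem H).reflectionPerm i i := by
      apply (LieAlgebra.IsKilling.rootSystem H).root.injective
      rw [h1, h3, RootPairing.reflection_apply_self, zero_smul, zero_sub]
    have h5 : b.height ((LieAlgebra.IsKilling.rootSystem H).reflectionPerm i i) = -b.height i :=
      b.height_reflectionPerm_self i
    rw [RootPairing.Base.isPos_iff, h4, h5] at hα
    rw [RootPairing.Base.isPos_iff] at h2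
    omega
  · exact Subtype.ext h'

theorem add_ne_zero_of_isPos {α β : H.root} (hα : b.IsPos α) (hβ : b.IsPos β) :
    (α.1 : H → ℂ) + (β.1 : H → ℂ) ≠ 0 := by
  intro h
  have h4 : α = (LieAlgebra.IsKilling.rootSystem H).reflectionPerm β β := by
    apply (LieAlgebra.IsKilling.rootSystem H).root.injective
    rw [RootPairing.root_reflectionPerm, RootPairing.reflection_apply_self]
    ext x
    exact eq_neg_of_add_eq_zero_left (congrFun h x)
  have h5 : b.height ((LieAlgebra.IsKilling.rootSystem H).reflectionPerm β β) = -b.height β :=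
    b.height_reflectionPerm_self β
  rw [RootPairing.Base.isPos_iff, h4, h5] at hα
  rw [RootPairing.Base.isPos_iff] at hβ
  omega

theorem exists_positive_on_positive_roots :
    ∃ d : H, ∀ α : H.root, b.IsPos α → 0 < ((α.1 : H → ℂ) d).re := by
  obtain ⟨d, hd⟩ := exists_prescribed_simple_root_values b fun _ => 1
  refine ⟨d, fun α hα => ?_⟩
  refine hα.induction_on_add (p := fun α => 0 < ((α.1 : H → ℂ) d).re) ?_ ?_
  · intro j hj
    rw [hd j hj, Complex.one_re]; exact one_pos
  · intro i j k hk hi hj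
    change 0 < ((LieAlgebra.IsKilling.rootSystem H).root k d).re
    rw [hk, LinearMap.add_apply, root_apply_eq, root_apply_eq, hd j hj, Complex.add_re,
      Complex.one_re]
    positivity

/-- Take d to be 0 on α_i and 1 on the other simple roots: a positive root vanishing on d is a
multiple of α_i, hence α_i itself. This d separates α_i from the other positive roots. -/
theorem exists_positive_on_other_positive_roots {i : H.root} (hi : i ∈ b.support) :
    ∃ d : H, (i.1 : H → ℂ) d = 0 ∧
      ∀ α : H.root, b.IsPos α → α ≠ i → 0 < ((α.1 : H → ℂ) d).re := by
  classical
  obtain ⟨d, hd⟩ := exists_prescribed_simple_root_values b fun j => if j = i then 0 else 1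
  refine ⟨d, by rw [hd i hi, if_pos rfl], fun α hα hne => ?_⟩
  have key : 0 ≤ ((α.1 : H → ℂ) d).re ∧ (((α.1 : H → ℂ) d).re = 0 → ∃ k : ℂ,
      (LieAlgebra.IsKilling.rootSystem H).root α =
        k • (LieAlgebra.IsKilling.rootSystem H).root i) := by
    refine hα.induction_on_add (p := fun α => 0 ≤ ((α.1 : H → ℂ) d).re ∧
      (((α.1 : H → ℂ) d).re = 0 → ∃ k : ℂ, (LieAlgebra.IsKilling.rootSystem H).root α =
        k • (LieAlgebra.IsKilling.rootSystem H).root i)) ?_ ?_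
    · intro j hj
      rw [hd j hj]
      split_ifs with h
      · subst h
        exact ⟨le_rfl, fun _ => ⟨1, (one_smul _ _).symm⟩⟩
      · rw [Complex.one_re]
        exact ⟨zero_le_one, fun h => absurd h one_ne_zero⟩
    · intro l j k hk ⟨h1, h2⟩ hj
      have h3 : (k.1 : H → ℂ) d = (l.1 : H → ℂ) d + (j.1 : H → ℂ) d := by
        rw [← root_apply_eq, hk]; rfl
      rw [h3, hd j hj, Complex.add_re]
      split_ifs with h
      · subst h
        rw [Complex.zero_re, add_zero]
        refine ⟨h1, fun h4 => ?_⟩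
        obtain ⟨c, hc⟩ := h2 h4
        exact ⟨c + 1, by rw [hk, hc, add_smul, one_smul]⟩
      · rw [Complex.one_re]
        exact ⟨by positivity, fun h4 => by linarith⟩
  refine lt_of_le_of_ne key.1 fun h => hne ?_
  obtain ⟨k, hk⟩ := key.2 h.symm
  exact eq_of_isPos_of_eq_smul b hi hα hk

/-- The finite set of positive roots. -/
def posRoots : Finset H.root := by
  classical exact Finset.univ.filter fun α => b.IsPos α

theorem mem_posRoots {α : H.root} : α ∈ posRoots b ↔ b.IsPos α := by
  classical simp [posRoots]

variable {B : LinearMap.BilinForm ℂ g} {b}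

theorem form_eq_zero_of_weights (hinv : B.lieInvariant g) {χ ψ : H → ℂ} {x y : g}
    (hx : ∀ h : H, ⁅(h : g), x⁆ = χ h • x) (hy : ∀ h : H, ⁅(h : g), y⁆ = ψ h • y)
    (hne : χ + ψ ≠ 0) : B x y = 0 := by
  obtain ⟨h, hh⟩ := Function.ne_iff.1 hne
  have := hinv (h : g) x y
  rw [hx, hy, map_smul, map_smul, LinearMap.smul_apply, smul_eq_mul, smul_eq_mul] at this
  have h2 : (χ h + ψ h) * B x y = 0 := by rw [add_mul, this]; ring
  exact (mul_eq_zero.1 h2).resolve_left hh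

namespace RootVectors

variable (r : RootVectors H B)

theorem lie_pos (α : H.root) (h : H) : ⁅(h : g), r.pos α⁆ = (α.1 : H → ℂ) h • r.pos α :=
  LieAlgebra.IsKilling.lie_eq_smul_of_mem_rootSpace (r.pos_mem α) h

theorem lie_neg (α : H.root) (h : H) : ⁅(h : g), r.neg α⁆ = (-(α.1 : H → ℂ)) h • r.neg α :=
  LieAlgebra.IsKilling.lie_eq_smul_of_mem_rootSpace (r.neg_mem α) h

theorem cartan_lie_cartan (h h' : H) : ⁅(h : g), (h' : g)⁆ = 0 := by
  have : ⁅h, h'⁆ = 0 := trivial_lie_zero _ _ _ _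
  exact congrArg Subtype.val this

theorem form_neg_pos (hinv : B.lieInvariant g) (hs : B.IsSymm) (α β : H.root) [Decidable (α = β)] :
    B (r.neg α) (r.pos β) = if α = β then 1 else 0 := by
  split_ifs with h
  · subst h
    rw [hs.eq, r.form_eq_one]
  · refine form_eq_zero_of_weights hinv (r.lie_neg α) (r.lie_pos β) fun h0 => h ?_
    rw [neg_add_eq_zero] at h0
    exact Subtype.ext (DFunLike.coe_injective h0)

theorem form_pos_neg (hinv : B.lieInvariant g) (hs : B.IsSymm) (α β : H.root) [Decidable (α = β)] :
    B (r.pos α) (r.neg β) = if α = β then 1 else 0 := by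
  classical
  rw [hs.eq, r.form_neg_pos hinv hs]
  simp only [eq_comm]

theorem form_pos_pos (hinv : B.lieInvariant g) {α β : H.root} (hα : b.IsPos α) (hβ : b.IsPos β) :
    B (r.pos α) (r.pos β) = 0 :=
  form_eq_zero_of_weights hinv (r.lie_pos α) (r.lie_pos β) (add_ne_zero_of_isPos b hα hβ)

theorem form_neg_neg (hinv : B.lieInvariant g) {α β : H.root} (hα : b.IsPos α) (hβ : b.IsPos β) :
    B (r.neg α) (r.neg β) = 0 :=
  form_eq_zero_of_weights hinv (r.lie_neg α) (r.lie_neg β) (by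
    rw [← neg_add]; exact neg_ne_zero.2 (add_ne_zero_of_isPos b hα hβ))

theorem coe_root_ne_zero (α : H.root) : (α.1 : H → ℂ) ≠ 0 := H.isNonZero_coe_root α

theorem form_pos_cartan (hinv : B.lieInvariant g) (α : H.root) (h : H) :
    B (r.pos α) (h : g) = 0 :=
  form_eq_zero_of_weights hinv (r.lie_pos α) (ψ := 0)
    (fun h' => by rw [cartan_lie_cartan, Pi.zero_apply, zero_smul])
    (by rw [add_zero]; exact coe_root_ne_zero α)

theorem form_neg_cartan (hinv : B.lieInvariant g) (α : H.root) (h : H) :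
    B (r.neg α) (h : g) = 0 :=
  form_eq_zero_of_weights hinv (r.lie_neg α) (ψ := 0)
    (fun h' => by rw [cartan_lie_cartan, Pi.zero_apply, zero_smul])
    (by rw [add_zero]; exact neg_ne_zero.2 (coe_root_ne_zero α))

theorem pos_ne_zero (α : H.root) : r.pos α ≠ 0 := fun h => by
  have := r.form_eq_one α
  rw [h, map_zero, LinearMap.zero_apply] at this
  exact zero_ne_one this

theorem neg_ne_zero' (α : H.root) : r.neg α ≠ 0 := fun h => by
  have := r.form_eq_one α
  rw [h, map_zero] at this
  exact zero_ne_one this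

/-- A linear condition on `g` can be checked on the Cartan subalgebra and on root vectors. -/
theorem triangular_induction (b : (LieAlgebra.IsKilling.rootSystem H).Base) (S : Submodule ℂ g)
    (h0 : ∀ h : H, (h : g) ∈ S) (hpos : ∀ α : H.root, b.IsPos α → r.pos α ∈ S)
    (hneg : ∀ α : H.root, b.IsPos α → r.neg α ∈ S) (y : g) : y ∈ S := by
  have htop := LieModule.iSup_genWeightSpace_eq_top' ℂ H g
  have htop' : (⨆ χ : LieModule.Weight ℂ H g,
      (LieModule.genWeightSpace g χ : Submodule ℂ g)) = ⊤ := by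
    rw [← LieSubmodule.iSup_toSubmodule, htop, LieSubmodule.top_toSubmodule]
  have hy : y ∈ ⨆ χ : LieModule.Weight ℂ H g,
      (LieModule.genWeightSpace g χ : Submodule ℂ g) := by rw [htop']; trivial
  suffices hle : (⨆ χ : LieModule.Weight ℂ H g,
      (LieModule.genWeightSpace g χ : Submodule ℂ g)) ≤ S from hle hy
  refine iSup_le fun χ x hx => ?_
  have hx' : x ∈ LieAlgebra.rootSpace H (χ : H → ℂ) := hx
  by_cases hχ : χ.IsZero
  · rw [hχ.eq, LieAlgebra.rootSpace_zero_eq] at hx'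
    exact h0 ⟨x, hx'⟩
  · have hone := LieAlgebra.IsKilling.finrank_rootSpace_eq_one χ hχ
    let α : H.root := ⟨χ, by simpa using hχ⟩
    rcases RootPairing.Base.IsPos.or_neg b α with h | h
    · obtain ⟨c, hc⟩ := (finrank_eq_one_iff_of_nonzero'
        (⟨r.pos α, r.pos_mem α⟩ : LieAlgebra.rootSpace H (χ : H → ℂ))
        (fun h => r.pos_ne_zero α (congrArg Subtype.val h))).1 hone ⟨x, hx'⟩
      rw [← show c • r.pos α = x from congrArg Subtype.val hc]
      exact S.smul_mem _ (hpos α h)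
    -- A negative root is -β with β positive, and its one-dimensional root space is spanned by x_β⁻.
    · set β : H.root := (LieAlgebra.IsKilling.rootSystem H).reflectionPerm α α with hβ
      have hβα : -(β.1 : H → ℂ) = χ := by
        have h5 : (LieAlgebra.IsKilling.rootSystem H).root β =
            -(LieAlgebra.IsKilling.rootSystem H).root α := by
          rw [hβ, RootPairing.root_reflectionPerm, RootPairing.reflection_apply_self]
        funext x
        have h6 := LinearMap.congr_fun h5 x
        rw [LinearMap.neg_apply, root_apply_eq, root_apply_eq] at h6
        rw [Pi.neg_apply, h6, neg_neg]
      have hmem := r.neg_mem β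
      rw [hβα] at hmem
      obtain ⟨c, hc⟩ := (finrank_eq_one_iff_of_nonzero'
        (⟨r.neg β, hmem⟩ : LieAlgebra.rootSpace H (χ : H → ℂ))
        (fun h => r.neg_ne_zero' β (congrArg Subtype.val h))).1 hone ⟨x, hx'⟩
      rw [← show c • r.neg β = x from congrArg Subtype.val hc]
      exact S.smul_mem _ (hneg β h)

end RootVectors

end RootTensors

/-! ### The lower triangular half of [h ⊗ 1, Ω]. -/

section TriangularParts

set_option linter.unusedSectionVars false

variable {g : Type*} [LieRing g] [LieAlgebra ℂ g] [FiniteDimensional ℂ g]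
  [LieAlgebra.IsSimple ℂ g] {H : LieSubalgebra ℂ g} [H.IsCartanSubalgebra]
  (b : (LieAlgebra.IsKilling.rootSystem H).Base) {B : LinearMap.BilinForm ℂ g}

namespace RootVectors

variable (r : RootVectors H B)

/-- The tensor `∑_{α > 0} α(h) x_α⁻ ⊗ x_α⁺`. -/
def lowerTensor (h : H) : g ⊗[ℂ] g :=
  ∑ α ∈ posRoots b, (α.1 : H → ℂ) h • (r.neg α ⊗ₜ[ℂ] r.pos α)

/-- The tensor `∑_{α > 0} α(h) x_α⁺ ⊗ x_α⁻`. -/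
def upperTensor (h : H) : g ⊗[ℂ] g :=
  ∑ α ∈ posRoots b, (α.1 : H → ℂ) h • (r.pos α ⊗ₜ[ℂ] r.neg α)

/-- `[h ⊗ 1, Ω] = ∑_{α > 0} α(h) (x_α⁺ ⊗ x_α⁻ - x_α⁻ ⊗ x_α⁺)`. -/
theorem casimirBracket_cartan (hB : B.Nondegenerate) (hs : B.IsSymm) (hinv : B.lieInvariant g)
    (h : H) :
    casimirBracket B hB (h : g) = r.upperTensor b h - r.lowerTensor b h := by
  classical
  rw [← sub_eq_zero]
  refine eq_zero_of_contractSecond B hB fun y => ?_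
  rw [map_sub, contractSecond_casimirBracket, sub_eq_zero]
  have hc : ∀ y, contractSecond B y (r.upperTensor b h - r.lowerTensor b h) =
      ∑ α ∈ posRoots b, ((α.1 : H → ℂ) h * B (r.neg α) y) • r.pos α -
        ∑ α ∈ posRoots b, ((α.1 : H → ℂ) h * B (r.pos α) y) • r.neg α := by
    intro y
    simp only [upperTensor, lowerTensor, map_sub, map_sum, map_smul, contractSecond_tmul, mul_smul]
  -- Contraction turns the claim into an equality of endomorphisms; their difference `F` is tested
  -- on the triangular decomposition.
  let F : g →ₗ[ℂ] g := LieAlgebra.ad ℂ g (h : g) -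
    (∑ α ∈ posRoots b, (((α.1 : H → ℂ) h • B (r.neg α)).smulRight (r.pos α)) -
      ∑ α ∈ posRoots b, (((α.1 : H → ℂ) h • B (r.pos α)).smulRight (r.neg α)))
  have hF : ∀ y, F y = ⁅(h : g), y⁆ - (∑ α ∈ posRoots b, ((α.1 : H → ℂ) h * B (r.neg α) y) • r.pos α -
        ∑ α ∈ posRoots b, ((α.1 : H → ℂ) h * B (r.pos α) y) • r.neg α) := by
    intro y
    simp [F, LinearMap.sub_apply, LinearMap.sum_apply]
  rw [hc, ← sub_eq_zero, ← hF, ← LinearMap.mem_ker]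
  refine r.triangular_induction b (LinearMap.ker F) ?_ ?_ ?_ y
  · intro h'
    rw [LinearMap.mem_ker, hF, cartan_lie_cartan, Finset.sum_eq_zero, Finset.sum_eq_zero]
    · simp
    · intro α _
      rw [r.form_pos_cartan hinv, mul_zero, zero_smul]
    · intro α _
      rw [r.form_neg_cartan hinv, mul_zero, zero_smul]
  · intro β hβ
    rw [LinearMap.mem_ker, hF, r.lie_pos, Finset.sum_eq_single β, Finset.sum_eq_zero]
    · rw [r.form_neg_pos hinv hs, if_pos rfl, mul_one, sub_zero, sub_self]
    · intro α hα
      rw [r.form_pos_pos hinv ((mem_posRoots b).1 hα) hβ, mul_zero, zero_smul]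
    · intro α _ hne
      rw [r.form_neg_pos hinv hs, if_neg hne, mul_zero, zero_smul]
    · exact fun hn => absurd ((mem_posRoots b).2 hβ) hn
  · intro β hβ
    rw [LinearMap.mem_ker, hF, r.lie_neg, Finset.sum_eq_zero, Finset.sum_eq_single β]
    · rw [r.form_pos_neg hinv hs, if_pos rfl, mul_one, Pi.neg_apply, neg_smul]
      abel
    · intro α _ hne
      rw [r.form_pos_neg hinv hs, if_neg hne, mul_zero, zero_smul]
    · exact fun hn => absurd ((mem_posRoots b).2 hβ) hn
    · intro α hα
      rw [r.form_neg_neg hinv ((mem_posRoots b).1 hα) hβ, mul_zero, zero_smul]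

theorem lie_neg_tmul_pos (α : H.root) (k : H) : ⁅(k : g), r.neg α ⊗ₜ[ℂ] r.pos α⁆ = 0 := by
  rw [TensorProduct.LieModule.lie_tmul_right, r.lie_neg, r.lie_pos, Pi.neg_apply,
    TensorProduct.tmul_smul, ← TensorProduct.smul_tmul', neg_smul, neg_add_cancel]

theorem lie_cartan_lowerTensor (k h : H) : ⁅(k : g), r.lowerTensor b h⁆ = 0 := by
  rw [lowerTensor, lie_sum]
  exact Finset.sum_eq_zero fun α _ => by rw [lie_smul, r.lie_neg_tmul_pos, smul_zero]

theorem rTensor_ad_neg_tmul_pos (α : H.root) (d : H) :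
    (LieAlgebra.ad ℂ g (d : g) : Module.End ℂ g).rTensor g (r.neg α ⊗ₜ[ℂ] r.pos α) =
      (-(α.1 : H → ℂ) d) • (r.neg α ⊗ₜ[ℂ] r.pos α) := by
  rw [LinearMap.rTensor_tmul, LieAlgebra.ad_apply, r.lie_neg, Pi.neg_apply,
    ← TensorProduct.smul_tmul']

theorem rTensor_ad_pos_tmul_neg (α : H.root) (d : H) :
    (LieAlgebra.ad ℂ g (d : g) : Module.End ℂ g).rTensor g (r.pos α ⊗ₜ[ℂ] r.neg α) =
      ((α.1 : H → ℂ) d) • (r.pos α ⊗ₜ[ℂ] r.neg α) := by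
  rw [LinearMap.rTensor_tmul, LieAlgebra.ad_apply, r.lie_pos, ← TensorProduct.smul_tmul']

variable {b}

/-- Since [z, h] = 0, invariance gives z · [h ⊗ 1, Ω] = 0, so z acts equally on the two triangular
halves. As α_i(h) = 0 removes the α_i-term, an element d of ker α_i separates the halves by sign,
and each is killed. -/
theorem lie_lowerTensor_eq_zero (hB : B.Nondegenerate) (hs : B.IsSymm) (hinv : B.lieInvariant g)
    {i : H.root} (hi : i ∈ b.support) {h : H} (hh : (i.1 : H → ℂ) h = 0) {z : g}
    (hz : ∀ k : H, (i.1 : H → ℂ) k = 0 → ⁅(k : g), z⁆ = 0) : ⁅z, r.lowerTensor b h⁆ = 0 := by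
  obtain ⟨d, hd0, hd⟩ := exists_positive_on_other_positive_roots b hi
  have hcomm := rTensor_ad_lie (hz d hd0)
  let f : Module.End ℂ (g ⊗[ℂ] g) := (LieAlgebra.ad ℂ g (d : g) : Module.End ℂ g).rTensor g
  have hlow : r.lowerTensor b h ∈ negPart f := by
    refine sum_mem fun α hα => ?_
    by_cases hαi : α = i
    · rw [hαi, hh, zero_smul]; exact zero_mem _
    · refine Submodule.smul_mem _ _ (mem_negPart (r.rTensor_ad_neg_tmul_pos α d) ?_)
      rw [Complex.neg_re, neg_lt_zero]
      exact hd α ((mem_posRoots b).1 hα) hαi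
  have hup : r.upperTensor b h ∈ nonnegPart f := by
    refine sum_mem fun α hα => ?_
    by_cases hαi : α = i
    · rw [hαi, hh, zero_smul]; exact zero_mem _
    · exact Submodule.smul_mem _ _ (mem_nonnegPart (r.rTensor_ad_pos_tmul_neg α d)
        (hd α ((mem_posRoots b).1 hα) hαi).le)
  have h1 := lie_casimirBracket B hB hinv z (h : g)
  rw [r.casimirBracket_cartan b hB hs hinv, ← lie_skew z, hz h hh, neg_zero, map_zero, lie_sub,
    sub_eq_zero] at h1
  let φ : g ⊗[ℂ] g →ₗ[ℂ] g ⊗[ℂ] g := LieModule.toEnd ℂ g (g ⊗[ℂ] g) z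
  refine eq_zero_of_mem_negPart_of_mem_nonnegPart (f := f) (map_mem_negPart φ hcomm hlow) ?_
  rw [← h1]
  exact map_mem_nonnegPart φ hcomm hup

/-- The part of the lower tensor of `t_i` away from the simple root `i`. -/
def lowerRest (b : (LieAlgebra.IsKilling.rootSystem H).Base) (i : H.root) : g ⊗[ℂ] g :=
  r.lowerTensor b (r.t i) - (i.1 : H → ℂ) (r.t i) • (r.neg i ⊗ₜ[ℂ] r.pos i)

theorem lowerRest_eq {i : H.root} (hi : i ∈ b.support) [DecidableEq H.root] : r.lowerRest b i =
    ∑ α ∈ (posRoots b).erase i, (α.1 : H → ℂ) (r.t i) • (r.neg α ⊗ₜ[ℂ] r.pos α) := by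
  rw [lowerRest, lowerTensor, ← Finset.add_sum_erase _ _
    ((mem_posRoots b).2 (RootPairing.Base.isPos_of_mem_support hi)), add_sub_cancel_left]

theorem lie_pos_neg (i : H.root) : ⁅r.pos i, r.neg i⁆ = (r.t i : g) := rfl

theorem lie_pos_cartan (i : H.root) (h : H) :
    ⁅r.pos i, (h : g)⁆ = -((i.1 : H → ℂ) h • r.pos i) := by
  rw [← lie_skew, r.lie_pos]

theorem lie_neg_cartan (i : H.root) (h : H) :
    ⁅r.neg i, (h : g)⁆ = (i.1 : H → ℂ) h • r.neg i := by
  rw [← lie_skew, r.lie_neg, Pi.neg_apply, neg_smul, neg_neg]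

theorem lie_neg_pos (i : H.root) : ⁅r.neg i, r.pos i⁆ = -(r.t i : g) := by
  rw [← lie_skew, r.lie_pos_neg]

/-- The relation ad x_i⁻ ad x_i⁺ t_i = α_i(t_i) t_i passes to [t_i ⊗ 1, Ω] by equivariance, and then
to its part with negative ad d-eigenvalues. -/
theorem lie_lie_lowerRest (hB : B.Nondegenerate) (hs : B.IsSymm) (hinv : B.lieInvariant g)
    {i : H.root} (hi : i ∈ b.support) :
    ⁅r.neg i, ⁅r.pos i, r.lowerRest b i⁆⁆ = (i.1 : H → ℂ) (r.t i) • r.lowerRest b i := by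
  classical
  obtain ⟨d, hd0, hd⟩ := exists_positive_on_other_positive_roots b hi
  have hcomm1 := rTensor_ad_lie (d := (d : g)) (z := r.pos i) (by rw [r.lie_pos, hd0, zero_smul])
  have hcomm2 := rTensor_ad_lie (d := (d : g)) (z := r.neg i)
    (by rw [r.lie_neg, Pi.neg_apply, hd0, neg_zero, zero_smul])
  let f : Module.End ℂ (g ⊗[ℂ] g) := (LieAlgebra.ad ℂ g (d : g) : Module.End ℂ g).rTensor g
  set c := (i.1 : H → ℂ) (r.t i) with hc
  let L : g ⊗[ℂ] g →ₗ[ℂ] g ⊗[ℂ] g := (LieModule.toEnd ℂ g (g ⊗[ℂ] g) (r.neg i)) ∘ₗ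
    (LieModule.toEnd ℂ g (g ⊗[ℂ] g) (r.pos i)) - c • LinearMap.id
  have hL : ∀ x, L x = ⁅r.neg i, ⁅r.pos i, x⁆⁆ - c • x := fun x => rfl
  have hLf : ∀ x, f (L x) = L (f x) := by
    intro x
    rw [hL, hL, map_sub, map_smul]
    change (LinearMap.rTensor g _) _ - _ = _
    rw [hcomm2, hcomm1]
  let s : g ⊗[ℂ] g := ∑ α ∈ (posRoots b).erase i, (α.1 : H → ℂ) (r.t i) • (r.pos α ⊗ₜ[ℂ] r.neg α)
  have hs' : r.upperTensor b (r.t i) = c • (r.pos i ⊗ₜ[ℂ] r.neg i) + s := by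
    rw [upperTensor, ← Finset.add_sum_erase _ _
      ((mem_posRoots b).2 (RootPairing.Base.isPos_of_mem_support hi))]
  have hlow : r.lowerRest b i ∈ negPart f := by
    rw [r.lowerRest_eq hi]
    refine sum_mem fun α hα => ?_
    refine Submodule.smul_mem _ _ (mem_negPart (r.rTensor_ad_neg_tmul_pos α d) ?_)
    rw [Complex.neg_re, neg_lt_zero]
    exact hd α ((mem_posRoots b).1 (Finset.mem_of_mem_erase hα)) (Finset.ne_of_mem_erase hα)
  -- Both terms of the simple root α_i have ad d-eigenvalue zero, so even its lower term belongs to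
  -- the nonnegative part. This is why `lowerRest` omits it.
  have hup : s + c • (r.pos i ⊗ₜ[ℂ] r.neg i) - c • (r.neg i ⊗ₜ[ℂ] r.pos i) ∈ nonnegPart f := by
    refine sub_mem (add_mem (sum_mem fun α hα => ?_) (Submodule.smul_mem _ _ ?_))
      (Submodule.smul_mem _ _ ?_)
    · exact Submodule.smul_mem _ _ (mem_nonnegPart (r.rTensor_ad_pos_tmul_neg α d)
        (hd α ((mem_posRoots b).1 (Finset.mem_of_mem_erase hα)) (Finset.ne_of_mem_erase hα)).le)
    · exact mem_nonnegPart (r.rTensor_ad_pos_tmul_neg i d) (by rw [hd0, Complex.zero_re])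
    · exact mem_nonnegPart (r.rTensor_ad_neg_tmul_pos i d)
        (by rw [hd0, neg_zero, Complex.zero_re])
  have h1 : L (casimirBracket B hB (r.t i : g)) = 0 := by
    rw [hL, lie_casimirBracket B hB hinv, lie_casimirBracket B hB hinv, r.lie_pos_cartan,
      _root_.lie_neg,
      lie_smul, r.lie_neg_pos, smul_neg, neg_neg, map_smul, sub_self]
  have h2 : casimirBracket B hB (r.t i : g) =
      (s + c • (r.pos i ⊗ₜ[ℂ] r.neg i) - c • (r.neg i ⊗ₜ[ℂ] r.pos i)) - r.lowerRest b i := by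
    rw [r.casimirBracket_cartan b hB hs hinv, hs', lowerRest]
    abel
  rw [h2, map_sub, sub_eq_zero] at h1
  rw [← sub_eq_zero, ← hL]
  refine eq_zero_of_mem_negPart_of_mem_nonnegPart (f := f) (map_mem_negPart L hLf hlow) ?_
  rw [← h1]
  exact map_mem_nonnegPart L hLf hup

/-- The form thus identifies t_α with α, so linear relations between the t_α become relations
between roots. -/
theorem form_t (hinv : B.lieInvariant g) (i : H.root) (h : H) :
    B (r.t i : g) (h : g) = (i.1 : H → ℂ) h := by
  have := hinv (r.neg i) (r.pos i) (h : g)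
  rw [r.lie_neg_pos, r.lie_neg_cartan, map_neg, LinearMap.neg_apply, map_smul, r.form_eq_one,
    smul_eq_mul, mul_one] at this
  exact neg_injective this

/-- The element t_α is a multiple of the Killing dual of α, on which α does not vanish; the multiple
is nonzero because (t_α, ·) = α. -/
theorem apply_t_ne_zero (hinv : B.lieInvariant g) (i : H.root) : (i.1 : H → ℂ) (r.t i) ≠ 0 := by
  have h1 := LieAlgebra.IsKilling.lie_eq_killingForm_smul_of_mem_rootSpace_of_mem_rootSpace_neg
    (r.pos_mem i) (r.neg_mem i)
  set k := killingForm ℂ g (r.pos i) (r.neg i)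
  set v := (LieAlgebra.IsKilling.cartanEquivDual H).symm i.1 with hv
  have h2 : r.t i = k • v := Subtype.ext h1
  have h3 : (i.1 : H → ℂ) v ≠ 0 := LieAlgebra.IsKilling.root_apply_cartanEquivDual_symm_ne_zero
    (H.isNonZero_coe_root i)
  have h4 : (i.1 : H → ℂ) (r.t i) = k * (i.1 : H → ℂ) v := by
    rw [h2, ← root_apply_eq, map_smul, smul_eq_mul, root_apply_eq]
  rw [h4]
  refine mul_ne_zero (fun hk => ?_) h3
  apply coe_root_ne_zero i
  funext h
  rw [← r.form_t hinv i h, h2, hk, zero_smul, ZeroMemClass.coe_zero, map_zero,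
    LinearMap.zero_apply, Pi.zero_apply]

theorem eq_zero_of_smul_t_eq_smul_t (hinv : B.lieInvariant g) {i j : H.root} (hi : i ∈ b.support)
    (hj : j ∈ b.support) (hij : i ≠ j) {x y : ℂ} (h : x • (r.t i : g) = y • (r.t j : g)) :
    x • (r.t i : g) = 0 := by
  by_contra hx
  have hx0 : x ≠ 0 := fun h0 => hx (by rw [h0, zero_smul])
  refine hij (eq_of_isPos_of_eq_smul b hj (RootPairing.Base.isPos_of_mem_support hi)
    (k := x⁻¹ * y) ?_)
  ext k
  have h1 := congrArg (fun v => B v (k : g)) h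
  simp only [map_smul, LinearMap.smul_apply, r.form_t hinv, smul_eq_mul] at h1
  rw [LinearMap.smul_apply, root_apply_eq, root_apply_eq, smul_eq_mul, mul_assoc, ← h1,
    inv_mul_cancel_left₀ hx0]

end RootVectors

end TriangularParts

/-! ### Inner derivations and products of two copies of g. -/

section Commutator

attribute [local instance 100] LieRing.ofAssociativeRing

variable {M : Type*} [Ring M] [Algebra ℂ M]

/-- The inner derivation `y ↦ [d, y]`. -/
def innerDer (d : M) : Module.End ℂ M := LinearMap.mulLeft ℂ d - LinearMap.mulRight ℂ d

theorem innerDer_apply (d y : M) : innerDer d y = d * y - y * d := rfl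

theorem innerDer_mul (d x y : M) : innerDer d (x * y) = innerDer d x * y + x * innerDer d y := by
  simp only [innerDer_apply]; noncomm_ring

theorem mul_mem_negPart {d x y : M} (hx : x ∈ negPart (innerDer d))
    (hy : y ∈ negPart (innerDer d)) : x * y ∈ negPart (innerDer d) := by
  suffices h : ∀ μ : ℂ, μ.re < 0 → ∀ x ∈ Module.End.eigenspace (innerDer d) μ,
      x * y ∈ negPart (innerDer d) by
    suffices h' : negPart (innerDer d) ≤ (negPart (innerDer d)).comap (LinearMap.mulRight ℂ y) from
      h' hx
    exact iSup₂_le fun μ hμ x hx => h μ hμ x hx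
  intro μ hμ x hx
  suffices h' : negPart (innerDer d) ≤ (negPart (innerDer d)).comap (LinearMap.mulLeft ℂ x) from
    h' hy
  refine iSup₂_le fun ν hν y hy => mem_negPart (μ := μ + ν) ?_ ?_
  · rw [LinearMap.mulLeft_apply, innerDer_mul, Module.End.mem_eigenspace_iff.1 hx,
      Module.End.mem_eigenspace_iff.1 hy, smul_mul_assoc, mul_smul_comm, add_smul]
  · rw [Complex.add_re]
    have : ν.re < 0 := hν
    linarith

theorem mul_mem_nonnegPart {d x y : M} (hx : x ∈ nonnegPart (innerDer d))
    (hy : y ∈ nonnegPart (innerDer d)) : x * y ∈ nonnegPart (innerDer d) := by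
  suffices h : ∀ μ : ℂ, 0 ≤ μ.re → ∀ x ∈ Module.End.eigenspace (innerDer d) μ,
      x * y ∈ nonnegPart (innerDer d) by
    suffices h' : nonnegPart (innerDer d) ≤
        (nonnegPart (innerDer d)).comap (LinearMap.mulRight ℂ y) from h' hx
    exact iSup₂_le fun μ hμ x hx => h μ hμ x hx
  intro μ hμ x hx
  suffices h' : nonnegPart (innerDer d) ≤
      (nonnegPart (innerDer d)).comap (LinearMap.mulLeft ℂ x) from h' hy
  refine iSup₂_le fun ν hν y hy => mem_nonnegPart (μ := μ + ν) ?_ ?_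
  · rw [LinearMap.mulLeft_apply, innerDer_mul, Module.End.mem_eigenspace_iff.1 hx,
      Module.End.mem_eigenspace_iff.1 hy, smul_mul_assoc, mul_smul_comm, add_smul]
  · rw [Complex.add_re]
    have : 0 ≤ ν.re := hν
    linarith

theorem commutator_mem_negPart {d a x : M} (ha : d * a = a * d) (hx : x ∈ negPart (innerDer d)) :
    a * x - x * a ∈ negPart (innerDer d) := by
  refine map_mem_negPart (innerDer a) (fun y => ?_) hx
  rw [innerDer_apply, innerDer_apply, innerDer_apply, innerDer_apply]
  linear_combination (norm := noncomm_ring) ha * y - y * ha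

variable {g : Type*} [LieRing g] [LieAlgebra ℂ g]

/-- The linear map `x ⊗ y ↦ ρ(x) σ(y)`. -/
def mulTensor (ρ σ : g →ₗ[ℂ] M) : g ⊗[ℂ] g →ₗ[ℂ] M :=
  LinearMap.mul' ℂ M ∘ₗ TensorProduct.map ρ σ

@[simp] theorem mulTensor_tmul (ρ σ : g →ₗ[ℂ] M) (x y : g) :
    mulTensor ρ σ (x ⊗ₜ y) = ρ x * σ y := rfl

theorem mulTensor_lie {ρ σ : g →ₗ[ℂ] M} {z : g} {w : M}
    (h1 : ∀ x, ρ ⁅z, x⁆ = w * ρ x - ρ x * w) (h2 : ∀ x, σ ⁅z, x⁆ = w * σ x - σ x * w)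
    (t : g ⊗[ℂ] g) :
    mulTensor ρ σ ⁅z, t⁆ = w * mulTensor ρ σ t - mulTensor ρ σ t * w := by
  induction t using TensorProduct.induction_on with
  | zero => simp
  | tmul a b =>
    rw [TensorProduct.LieModule.lie_tmul_right, map_add, mulTensor_tmul, mulTensor_tmul,
      mulTensor_tmul, h1, h2]
    noncomm_ring
  | add s t hs ht => rw [lie_add, map_add, hs, ht, map_add]; noncomm_ring

theorem mulTensor_rTensor {ρ σ : g →ₗ[ℂ] M} {z : g} {w : M}
    (h1 : ∀ x, ρ ⁅z, x⁆ = w * ρ x - ρ x * w) (h2 : ∀ x, w * σ x = σ x * w) (t : g ⊗[ℂ] g) :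
    mulTensor ρ σ ((LieAlgebra.ad ℂ g z : Module.End ℂ g).rTensor g t) =
      w * mulTensor ρ σ t - mulTensor ρ σ t * w := by
  induction t using TensorProduct.induction_on with
  | zero => simp
  | tmul a b =>
    rw [LinearMap.rTensor_tmul, LieAlgebra.ad_apply, mulTensor_tmul, mulTensor_tmul, h1]
    linear_combination (norm := noncomm_ring) -(ρ a * h2 b)
  | add s t hs ht => rw [map_add, map_add, hs, ht, map_add]; noncomm_ring

theorem mulTensor_commute {ρ σ : g →ₗ[ℂ] M} {w : M} (h1 : ∀ x, w * ρ x = ρ x * w)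
    (h2 : ∀ x, w * σ x = σ x * w) (t : g ⊗[ℂ] g) :
    w * mulTensor ρ σ t = mulTensor ρ σ t * w := by
  induction t using TensorProduct.induction_on with
  | zero => simp
  | tmul a b => rw [mulTensor_tmul, ← mul_assoc, h1, mul_assoc, h2, mul_assoc]
  | add s t hs ht => rw [map_add, mul_add, hs, ht, add_mul]

end Commutator

/-! ### The quadratic identity behind primitivity of [T(h), T(h')]. -/

section LowerTensorIdentity

set_option linter.unusedSectionVars false

variable {g : Type*} [LieRing g] [LieAlgebra ℂ g] [FiniteDimensional ℂ g]
  [LieAlgebra.IsSimple ℂ g] {H : LieSubalgebra ℂ g} [H.IsCartanSubalgebra]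
  (b : (LieAlgebra.IsKilling.rootSystem H).Base) {B : LinearMap.BilinForm ℂ g}

namespace RootVectors

variable (r : RootVectors H B)

theorem comm_lowerTensor (h : H) :
    TensorProduct.comm ℂ g g (r.lowerTensor b h) = r.upperTensor b h := by
  simp only [lowerTensor, upperTensor, map_sum, map_smul, TensorProduct.comm_tmul]

theorem rTensor_ad_lowerTensor_comm (h h' : H) :
    (LieAlgebra.ad ℂ g (h : g) : Module.End ℂ g).rTensor g (r.lowerTensor b h') =
      (LieAlgebra.ad ℂ g (h' : g) : Module.End ℂ g).rTensor g (r.lowerTensor b h) := by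
  simp only [lowerTensor, map_sum, map_smul, rTensor_ad_neg_tmul_pos, smul_smul]
  exact Finset.sum_congr rfl fun α _ => by congr 1; ring

theorem rTensor_ad_upperTensor_comm (h h' : H) :
    (LieAlgebra.ad ℂ g (h : g) : Module.End ℂ g).rTensor g (r.upperTensor b h') =
      (LieAlgebra.ad ℂ g (h' : g) : Module.End ℂ g).rTensor g (r.upperTensor b h) := by
  simp only [upperTensor, map_sum, map_smul, rTensor_ad_pos_tmul_neg, smul_smul]
  exact Finset.sum_congr rfl fun α _ => by congr 1; ring

/-- For two commuting copies of `g` in an algebra, with `r(h) = ∑_{α > 0} α(h) x_α⁻ ⊗ x_α⁺` and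
`A(h) = 2 (ν(h) ⊗ 1 + 1 ⊗ ν(h))`, one has `2 [r(h), r(h')] + [A(h), r(h')] + [r(h), A(h')] = 0`. -/
theorem lowerTensor_identity (hB : B.Nondegenerate) (hs : B.IsSymm) (hinv : B.lieInvariant g)
    {M : Type*} [Ring M] [Algebra ℂ M] (ρ σ : g →ₗ[ℂ] M)
    (hρ : ∀ x y, ρ ⁅x, y⁆ = ρ x * ρ y - ρ y * ρ x) (hσ : ∀ x y, σ ⁅x, y⁆ = σ x * σ y - σ y * σ x)
    (hcomm : ∀ x y, ρ x * σ y = σ y * ρ x) (h h' : H) {R R' A A' : M}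
    (hR : R = mulTensor ρ σ (r.lowerTensor b h)) (hR' : R' = mulTensor ρ σ (r.lowerTensor b h'))
    (hA : A = mulTensor ρ ρ (r.lowerTensor b h) + mulTensor σ σ (r.lowerTensor b h))
    (hA' : A' = mulTensor ρ ρ (r.lowerTensor b h') + mulTensor σ σ (r.lowerTensor b h')) :
    2 * (R * R' - R' * R) + (A * R' - R' * A) + (R * A' - A' * R) = 0 := by
  obtain ⟨d, hd⟩ := exists_positive_on_positive_roots b
  have hρσ : ∀ z x, (ρ + σ) ⁅z, x⁆ = (ρ + σ) z * (ρ + σ) x - (ρ + σ) x * (ρ + σ) z := by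
    intro z x
    simp only [LinearMap.add_apply, hρ, hσ]
    linear_combination (norm := noncomm_ring) hcomm x z - hcomm z x
  have hρ' : ∀ z x, ρ ⁅z, x⁆ = (ρ + σ) z * ρ x - ρ x * (ρ + σ) z := by
    intro z x
    rw [LinearMap.add_apply, hρ]
    linear_combination (norm := noncomm_ring) hcomm x z
  have hσ' : ∀ z x, σ ⁅z, x⁆ = (ρ + σ) z * σ x - σ x * (ρ + σ) z := by
    intro z x
    rw [LinearMap.add_apply, hσ]
    linear_combination (norm := noncomm_ring) -hcomm z x
  set S := mulTensor ρ σ (r.upperTensor b h) with hS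
  set S' := mulTensor ρ σ (r.upperTensor b h') with hS'
  set Ω := mulTensor ρ σ (casimirTensor B hB) with hΩ
  have hΔ : ∀ t, mulTensor (ρ + σ) (ρ + σ) t = mulTensor ρ ρ t + mulTensor σ σ t +
      mulTensor ρ σ t + mulTensor ρ σ (TensorProduct.comm ℂ g g t) := by
    intro t
    induction t using TensorProduct.induction_on with
    | zero => simp
    | tmul x y =>
      simp only [mulTensor_tmul, TensorProduct.comm_tmul, LinearMap.add_apply]
      linear_combination (norm := noncomm_ring) -hcomm y x
    | add s t hs ht => simp only [map_add, hs, ht]; abel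
  have hΔ1 : mulTensor (ρ + σ) (ρ + σ) (r.lowerTensor b h) = A + R + S := by
    rw [hΔ, comm_lowerTensor, hA, hR]
  have hΔ2 : mulTensor (ρ + σ) (ρ + σ) (r.lowerTensor b h') = A' + R' + S' := by
    rw [hΔ, comm_lowerTensor, hA', hR']
  -- The diagonal copy ρ + σ commutes with Ω, hence so does A + R + S, the diagonal image of 2ν(h).
  have hΩ0 : ∀ z, Ω * (ρ + σ) z = (ρ + σ) z * Ω := by
    intro z
    have := mulTensor_lie (hρ' z) (hσ' z) (casimirTensor B hB)
    rw [lie_casimirTensor B hB hinv, map_zero] at this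
    exact (sub_eq_zero.1 this.symm).symm
  have hΩ1 : Ω * (A + R + S) = (A + R + S) * Ω := by
    rw [← hΔ1]; exact mulTensor_commute hΩ0 hΩ0 _
  have hΩ2 : Ω * (A' + R' + S') = (A' + R' + S') * Ω := by
    rw [← hΔ2]; exact mulTensor_commute hΩ0 hΩ0 _
  have hw : ∀ k : H, mulTensor ρ σ (r.upperTensor b k) - mulTensor ρ σ (r.lowerTensor b k) =
      ρ k * Ω - Ω * ρ k := by
    intro k
    rw [← map_sub, ← r.casimirBracket_cartan b hB hs hinv]
    exact mulTensor_rTensor (hρ _) (hcomm _) _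
  have hw1 : S - R = ρ h * Ω - Ω * ρ h := by rw [hS, hR]; exact hw h
  have hw2 : S' - R' = ρ h' * Ω - Ω * ρ h' := by rw [hS', hR']; exact hw h'
  have hA0 : ∀ k l : H, ρ k * (mulTensor ρ ρ (r.lowerTensor b l) +
      mulTensor σ σ (r.lowerTensor b l)) = (mulTensor ρ ρ (r.lowerTensor b l) +
      mulTensor σ σ (r.lowerTensor b l)) * ρ k := by
    intro k l
    have h1 := mulTensor_lie (hρ (k : g)) (hρ k) (r.lowerTensor b l)
    rw [r.lie_cartan_lowerTensor, map_zero] at h1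
    have h2 := mulTensor_commute (hcomm (k : g)) (hcomm k) (r.lowerTensor b l)
    rw [mul_add, h2, add_mul, sub_eq_zero.1 h1.symm]
  have hRsymm : ρ h * R' - R' * ρ h = ρ h' * R - R * ρ h' := by
    rw [hR, hR', ← mulTensor_rTensor (hρ (h : g)) (hcomm h),
      ← mulTensor_rTensor (hρ (h' : g)) (hcomm h'), r.rTensor_ad_lowerTensor_comm]
  have hSsymm : ρ h * S' - S' * ρ h = ρ h' * S - S * ρ h' := by
    rw [hS, hS', ← mulTensor_rTensor (hρ (h : g)) (hcomm h),
      ← mulTensor_rTensor (hρ (h' : g)) (hcomm h'), r.rTensor_ad_upperTensor_comm]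
  have hsymm : ρ h * (A' + R' + S') - (A' + R' + S') * ρ h =
      ρ h' * (A + R + S) - (A + R + S) * ρ h' := by
    have e1 : ρ h * A' = A' * ρ h := by rw [hA']; exact hA0 h h'
    have e2 : ρ h' * A = A * ρ h' := by rw [hA]; exact hA0 h' h
    linear_combination (norm := noncomm_ring) hRsymm + hSsymm + e1 - e2
  -- As S - R = [ρ(h), Ω] and Ω commutes with X' = A' + R' + S', the Jacobi identity gives [S - R,
  -- X'] = [[ρ(h), X'], Ω], and [ρ(h), X'] is symmetric in h and h' by `hsymm`.
  have hF : (S - R) * (A' + R' + S') - (A' + R' + S') * (S - R) =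
      (S' - R') * (A + R + S) - (A + R + S) * (S' - R') := by
    rw [hw1, hw2]
    generalize A + R + S = X at *
    generalize A' + R' + S' = X' at *
    linear_combination (norm := noncomm_ring) ρ h * hΩ2 - hΩ2 * ρ h - ρ h' * hΩ1 + hΩ1 * ρ h' +
      hsymm * Ω - Ω * hsymm
  -- In `hF` the commutators mixing R and S cancel, so the expression takes the same value on the
  -- lower and the upper tensors.
  have hE : 2 * (R * R' - R' * R) + (A * R' - R' * A) + (R * A' - A' * R) =
      2 * (S * S' - S' * S) + (A * S' - S' * A) + (S * A' - A' * S) := by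
    linear_combination (norm := noncomm_ring) -hF
  have hD : ∀ t, innerDer (ρ d) (mulTensor ρ σ t) =
      mulTensor ρ σ ((LieAlgebra.ad ℂ g (d : g) : Module.End ℂ g).rTensor g t) := fun t =>
    (mulTensor_rTensor (hρ _) (hcomm _) t).symm
  have hneg : ∀ k, mulTensor ρ σ (r.lowerTensor b k) ∈ negPart (innerDer (ρ d)) := fun k =>
    map_mem_negPart _ hD (sum_mem fun α hα => Submodule.smul_mem _ _
      (mem_negPart (r.rTensor_ad_neg_tmul_pos α d)
        (by rw [Complex.neg_re, neg_lt_zero]; exact hd α ((mem_posRoots b).1 hα))))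
  have hpos : ∀ k, mulTensor ρ σ (r.upperTensor b k) ∈ nonnegPart (innerDer (ρ d)) := fun k =>
    map_mem_nonnegPart _ hD (sum_mem fun α hα => Submodule.smul_mem _ _
      (mem_nonnegPart (r.rTensor_ad_pos_tmul_neg α d) (hd α ((mem_posRoots b).1 hα)).le))
  have hAd : ρ d * A = A * ρ d := by rw [hA]; exact hA0 d h
  have hAd' : ρ d * A' = A' * ρ d := by rw [hA']; exact hA0 d h'
  have hRn : R ∈ negPart (innerDer (ρ d)) := by rw [hR]; exact hneg h
  have hRn' : R' ∈ negPart (innerDer (ρ d)) := by rw [hR']; exact hneg h'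
  have hAp : A ∈ nonnegPart (innerDer (ρ d)) :=
    mem_nonnegPart (μ := 0) (by rw [innerDer_apply, hAd, sub_self, zero_smul]) le_rfl
  have hAp' : A' ∈ nonnegPart (innerDer (ρ d)) :=
    mem_nonnegPart (μ := 0) (by rw [innerDer_apply, hAd', sub_self, zero_smul]) le_rfl
  -- The element ρ(d) commutes with A and A', acts negatively on R, R' and nonnegatively on S, S'.
  refine eq_zero_of_mem_negPart_of_mem_nonnegPart (f := innerDer (ρ d)) ?_ ?_
  · have e : 2 * (R * R' - R' * R) + (A * R' - R' * A) + (R * A' - A' * R) =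
        (R * R' - R' * R) + (R * R' - R' * R) + (A * R' - R' * A) - (A' * R - R * A') := by
      noncomm_ring
    have c1 := sub_mem (mul_mem_negPart hRn hRn') (mul_mem_negPart hRn' hRn)
    rw [e]
    exact sub_mem (add_mem (add_mem c1 c1) (commutator_mem_negPart hAd hRn'))
      (commutator_mem_negPart hAd' hRn)
  · have hSp : S ∈ nonnegPart (innerDer (ρ d)) := hpos h
    have hSp' : S' ∈ nonnegPart (innerDer (ρ d)) := hpos h'
    have c1 := sub_mem (mul_mem_nonnegPart hSp hSp') (mul_mem_nonnegPart hSp' hSp)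
    rw [hE, two_mul]
    exact add_mem (add_mem (add_mem c1 c1)
      (sub_mem (mul_mem_nonnegPart hAp hSp') (mul_mem_nonnegPart hSp' hAp)))
      (sub_mem (mul_mem_nonnegPart hSp hAp') (mul_mem_nonnegPart hAp' hSp))

end RootVectors

end LowerTensorIdentity

/-! ### Coproducts in the quantization and the corrected elements T(h). -/

namespace HomogeneousQuantization

section Corrected

attribute [local instance 100] LieRing.ofAssociativeRing

set_option linter.unusedSectionVars false

variable {g : Type*} [LieRing g] [LieAlgebra ℂ g] [FiniteDimensional ℂ g]
  {B : LinearMap.BilinForm ℂ g} {hB : B.Nondegenerate}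
  {A : Type*} [Ring A] [HopfAlgebra ℂ[X] A] [Algebra ℂ A] [IsScalarTower ℂ ℂ[X] A]
  (Q : HomogeneousQuantization B hB A)

/-- The linear map underlying the embedding `g → A`. -/
def liftLinear : g →ₗ[ℂ] A := Q.lieLift

/-- The map `x ↦ x ⊗ 1` into `A ⊗ A`. -/
def liftLeft : g →ₗ[ℂ] A ⊗[ℂ[X]] A where
  toFun x := Q.lift x ⊗ₜ 1
  map_add' x y := by rw [lift_add, TensorProduct.add_tmul]
  map_smul' c x := by rw [lift_smul, RingHom.id_apply, TensorProduct.smul_tmul']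

/-- The map `x ↦ 1 ⊗ x` into `A ⊗ A`. -/
def liftRight : g →ₗ[ℂ] A ⊗[ℂ[X]] A where
  toFun x := 1 ⊗ₜ Q.lift x
  map_add' x y := by rw [lift_add, TensorProduct.tmul_add]
  map_smul' c x := by rw [lift_smul, RingHom.id_apply, TensorProduct.tmul_smul]

theorem liftLeft_apply (x : g) : Q.liftLeft x = Q.lift x ⊗ₜ[ℂ[X]] 1 := rfl

theorem liftRight_apply (x : g) : Q.liftRight x = 1 ⊗ₜ[ℂ[X]] Q.lift x := rfl

theorem liftLeft_lie (x y : g) :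
    Q.liftLeft ⁅x, y⁆ = Q.liftLeft x * Q.liftLeft y - Q.liftLeft y * Q.liftLeft x := by
  simp only [liftLeft_apply, Algebra.TensorProduct.tmul_mul_tmul, mul_one, lift_lie,
    TensorProduct.sub_tmul]

theorem liftRight_lie (x y : g) :
    Q.liftRight ⁅x, y⁆ = Q.liftRight x * Q.liftRight y - Q.liftRight y * Q.liftRight x := by
  simp only [liftRight_apply, Algebra.TensorProduct.tmul_mul_tmul, mul_one, lift_lie,
    TensorProduct.tmul_sub]

theorem liftLeft_mul_liftRight (x y : g) :
    Q.liftLeft x * Q.liftRight y = Q.liftRight y * Q.liftLeft x := by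
  simp only [liftLeft_apply, liftRight_apply, Algebra.TensorProduct.tmul_mul_tmul, mul_one,
    one_mul]

/-- The linear map `x ⊗ y ↦ x y` from `g ⊗ g` to `A`. -/
def liftMul : g ⊗[ℂ] g →ₗ[ℂ] A := mulTensor Q.liftLinear Q.liftLinear

theorem liftMul_tmul (x y : g) : Q.liftMul (x ⊗ₜ y) = Q.lift x * Q.lift y := rfl

/-- The linear map `x ⊗ y ↦ x ⊗ y` from `g ⊗ g` to `A ⊗ A`. -/
def liftTensor : g ⊗[ℂ] g →ₗ[ℂ] A ⊗[ℂ[X]] A := mulTensor Q.liftLeft Q.liftRight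

theorem liftTensor_tmul (x y : g) : Q.liftTensor (x ⊗ₜ y) = Q.lift x ⊗ₜ[ℂ[X]] Q.lift y := by
  rw [liftTensor, mulTensor_tmul, liftLeft_apply, liftRight_apply,
    Algebra.TensorProduct.tmul_mul_tmul, one_mul, mul_one]

theorem embedTensor_eq_liftTensor (t : g ⊗[ℂ] g) : Q.embedTensor t = Q.liftTensor t := by
  induction t using TensorProduct.induction_on with
  | zero => simp
  | tmul x y => rw [embedTensor_tmul, liftTensor_tmul]
  | add s t hs ht => rw [map_add, map_add, hs, ht]

theorem liftMul_lie (z : g) (t : g ⊗[ℂ] g) :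
    Q.liftMul ⁅z, t⁆ = Q.lift z * Q.liftMul t - Q.liftMul t * Q.lift z :=
  mulTensor_lie (Q.lift_lie z) (Q.lift_lie z) t

theorem mulTensor_liftLeft (t : g ⊗[ℂ] g) :
    mulTensor Q.liftLeft Q.liftLeft t = Q.liftMul t ⊗ₜ[ℂ[X]] 1 := by
  induction t using TensorProduct.induction_on with
  | zero => simp
  | tmul x y =>
    rw [mulTensor_tmul, liftLeft_apply, liftLeft_apply, Algebra.TensorProduct.tmul_mul_tmul,
      mul_one, liftMul_tmul]
  | add s t hs ht => rw [map_add, map_add, hs, ht, TensorProduct.add_tmul]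

theorem mulTensor_liftRight (t : g ⊗[ℂ] g) :
    mulTensor Q.liftRight Q.liftRight t = 1 ⊗ₜ[ℂ[X]] Q.liftMul t := by
  induction t using TensorProduct.induction_on with
  | zero => simp
  | tmul x y =>
    rw [mulTensor_tmul, liftRight_apply, liftRight_apply, Algebra.TensorProduct.tmul_mul_tmul,
      mul_one, liftMul_tmul]
  | add s t hs ht => rw [map_add, map_add, hs, ht, TensorProduct.tmul_add]

theorem comul_mul (a c : A) : Coalgebra.comul (R := ℂ[X]) (a * c) =
    Coalgebra.comul (R := ℂ[X]) a * Coalgebra.comul (R := ℂ[X]) c :=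
  map_mul (Bialgebra.comulAlgHom ℂ[X] A) a c

theorem comul_liftMul (t : g ⊗[ℂ] g) : Coalgebra.comul (R := ℂ[X]) (Q.liftMul t) =
    Q.liftMul t ⊗ₜ 1 + 1 ⊗ₜ Q.liftMul t + Q.liftTensor t +
      Q.liftTensor (TensorProduct.comm ℂ g g t) := by
  induction t using TensorProduct.induction_on with
  | zero => simp
  | tmul x y =>
    rw [liftMul_tmul, comul_mul, comul_lift, comul_lift, TensorProduct.comm_tmul, liftTensor_tmul,
      liftTensor_tmul, add_mul, mul_add, mul_add]
    simp only [Algebra.TensorProduct.tmul_mul_tmul, mul_one, one_mul]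
    abel
  | add s t hs ht =>
    simp only [map_add, hs, ht, TensorProduct.add_tmul, TensorProduct.tmul_add]
    abel

theorem lift_mul_sub_mul (x : g) (t : g ⊗[ℂ] g) :
    (Q.lift x ⊗ₜ[ℂ[X]] (1 : A)) * Q.liftTensor t - Q.liftTensor t * (Q.lift x ⊗ₜ[ℂ[X]] (1 : A)) =
      Q.liftTensor ((LieAlgebra.ad ℂ g x : Module.End ℂ g).rTensor g t) :=
  (mulTensor_rTensor (Q.liftLeft_lie x) (Q.liftLeft_mul_liftRight x) t).symm

namespace IsDegreeOneGenerator

variable {Q} {J : g →ₗ[ℂ] A}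

/-- The scalar `ħ / 2`. -/
def halfHbar : ℂ[X] := (1 / 2 : ℂ) • Polynomial.X

theorem lift_mul_sub (hJ : Q.IsDegreeOneGenerator J) (x y : g) :
    Q.lift x * J y - J y * Q.lift x = J ⁅x, y⁆ := by
  rw [hJ.map_lie, embed_envIncl, Ring.lie_def]

theorem mul_lift_sub (hJ : Q.IsDegreeOneGenerator J) (x y : g) :
    J x * Q.lift y - Q.lift y * J x = J ⁅x, y⁆ := by
  rw [← lie_skew, map_neg, ← hJ.lift_mul_sub, neg_sub]

theorem comul (hJ : Q.IsDegreeOneGenerator J) (x : g) : Coalgebra.comul (R := ℂ[X]) (J x) =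
    J x ⊗ₜ 1 + 1 ⊗ₜ J x + halfHbar • Q.liftTensor (casimirBracket B hB x) := by
  rw [hJ.comul_eq, embed_envIncl, embedTensor_eq_liftTensor, Ring.lie_def, lift_mul_sub_mul]
  rfl

/-- `[J(x) ⊗ 1 + 1 ⊗ J(x), t]` for `t ∈ g ⊗ g`. -/
theorem bracket_liftTensor_tmul (hJ : Q.IsDegreeOneGenerator J) (x y z : g) :
    (J x ⊗ₜ 1 + 1 ⊗ₜ J x) * Q.liftTensor (y ⊗ₜ z) - Q.liftTensor (y ⊗ₜ z) * (J x ⊗ₜ 1 + 1 ⊗ₜ J x) =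
      J ⁅x, y⁆ ⊗ₜ[ℂ[X]] Q.lift z + Q.lift y ⊗ₜ[ℂ[X]] J ⁅x, z⁆ := by
  rw [liftTensor_tmul, ← hJ.mul_lift_sub, ← hJ.mul_lift_sub, TensorProduct.sub_tmul,
    TensorProduct.tmul_sub, add_mul, mul_add]
  simp only [Algebra.TensorProduct.tmul_mul_tmul, one_mul, mul_one]
  abel

end IsDegreeOneGenerator

end Corrected

section CartanCorrected

attribute [local instance 100] LieRing.ofAssociativeRing

set_option linter.unusedSectionVars false

variable {g : Type*} [LieRing g] [LieAlgebra ℂ g] [FiniteDimensional ℂ g]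
  [LieAlgebra.IsSimple ℂ g] {H : LieSubalgebra ℂ g} [H.IsCartanSubalgebra]
  {b : (LieAlgebra.IsKilling.rootSystem H).Base} {B : LinearMap.BilinForm ℂ g}
  {hB : B.Nondegenerate} {r : RootVectors H B}
  {A : Type*} [Ring A] [HopfAlgebra ℂ[X] A] [Algebra ℂ A] [IsScalarTower ℂ ℂ[X] A]
  {Q : HomogeneousQuantization B hB A} {J : g →ₗ[ℂ] A}

open IsDegreeOneGenerator

theorem embed_nu (h : H) :
    Q.embed (r.nu b h) = (1 / 2 : ℂ) • Q.liftMul (r.lowerTensor b h) := by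
  rw [RootVectors.nu, map_smul, map_sum, RootVectors.lowerTensor, map_sum]
  congr 1
  refine Finset.sum_congr ?_ fun α _ => ?_
  · ext α; simp [mem_posRoots]
  · rw [map_smul, map_smul, map_mul, embed_envIncl, embed_envIncl, liftMul_tmul]

variable (Q J r b) in
/-- The element `T(h) = J(h) - ħ ν(h)`. -/
def corrected (h : H) : A := J h - halfHbar • Q.liftMul (r.lowerTensor b h)

/-- Each positive root contributes α(h) α(h') (x_α⁻ ⊗ J(x_α⁺) - J(x_α⁻) ⊗ x_α⁺) to either side. -/
theorem bracket_lowerTensor_symm (hJ : Q.IsDegreeOneGenerator J) (h h' : H) :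
    (J h ⊗ₜ 1 + 1 ⊗ₜ J h) * Q.liftTensor (r.lowerTensor b h') -
      Q.liftTensor (r.lowerTensor b h') * (J h ⊗ₜ[ℂ[X]] 1 + 1 ⊗ₜ[ℂ[X]] J h) =
    (J h' ⊗ₜ 1 + 1 ⊗ₜ J h') * Q.liftTensor (r.lowerTensor b h) -
      Q.liftTensor (r.lowerTensor b h) * (J h' ⊗ₜ[ℂ[X]] 1 + 1 ⊗ₜ[ℂ[X]] J h') := by
  simp only [RootVectors.lowerTensor, map_sum, map_smul, Finset.mul_sum, Finset.sum_mul,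
    ← Finset.sum_sub_distrib, mul_smul_comm, smul_mul_assoc, ← smul_sub]
  refine Finset.sum_congr rfl fun α _ => ?_
  rw [hJ.bracket_liftTensor_tmul, hJ.bracket_liftTensor_tmul, r.lie_neg, r.lie_neg, r.lie_pos,
    r.lie_pos]
  simp only [map_smul, TensorProduct.tmul_smul, ← TensorProduct.smul_tmul', smul_add, smul_smul,
    Pi.neg_apply, mul_neg, mul_comm]

/-- The root α contributes α(h) α(h') (x_α⁻ J(x_α⁺) - J(x_α⁻) x_α⁺). This symmetry cancels the
ħ-linear terms when [T(h), T(h')] is expanded. -/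
theorem bracket_liftMul_lowerTensor_symm (hJ : Q.IsDegreeOneGenerator J) (h h' : H) :
    J h * Q.liftMul (r.lowerTensor b h') - Q.liftMul (r.lowerTensor b h') * J h =
    J h' * Q.liftMul (r.lowerTensor b h) - Q.liftMul (r.lowerTensor b h) * J h' := by
  simp only [RootVectors.lowerTensor, map_sum, map_smul, Finset.mul_sum, Finset.sum_mul,
    ← Finset.sum_sub_distrib, mul_smul_comm, smul_mul_assoc, ← smul_sub]
  refine Finset.sum_congr rfl fun α _ => ?_
  have key : ∀ k : H, J k * Q.liftMul (r.neg α ⊗ₜ r.pos α) - Q.liftMul (r.neg α ⊗ₜ r.pos α) * J k =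
      (α.1 : H → ℂ) k • (Q.lift (r.neg α) * J (r.pos α) - J (r.neg α) * Q.lift (r.pos α)) := by
    intro k
    have h1 := hJ.mul_lift_sub k (r.neg α)
    have h2 := hJ.mul_lift_sub k (r.pos α)
    rw [r.lie_neg, map_smul, Pi.neg_apply, neg_smul] at h1
    rw [r.lie_pos, map_smul] at h2
    rw [liftMul_tmul, smul_sub, ← mul_smul_comm, ← smul_mul_assoc, ← h2, ← neg_neg (_ • J _), ← h1]
    noncomm_ring
  rw [key, key, smul_smul, smul_smul, mul_comm]

/-- J(h) contributes (ħ/2)(upper - lower) and -ħν(h) contributes -(ħ/2)(upper + lower); the upper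
halves cancel. -/
theorem comul_corrected (hs : B.IsSymm) (hinv : B.lieInvariant g) (hJ : Q.IsDegreeOneGenerator J)
    (h : H) : Coalgebra.comul (R := ℂ[X]) (corrected b r Q J h) =
      corrected b r Q J h ⊗ₜ 1 + 1 ⊗ₜ corrected b r Q J h -
        (2 * halfHbar) • Q.liftTensor (r.lowerTensor b h) := by
  rw [corrected, map_sub, map_smul, comul_liftMul, hJ.comul, r.casimirBracket_cartan b hB hs hinv,
    r.comm_lowerTensor, map_sub, TensorProduct.sub_tmul, TensorProduct.tmul_sub,
    ← TensorProduct.smul_tmul', TensorProduct.tmul_smul]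
  module

theorem comul_bracket_corrected (hs : B.IsSymm) (hinv : B.lieInvariant g)
    (hJ : Q.IsDegreeOneGenerator J) (h h' : H) :
    Coalgebra.comul (R := ℂ[X]) (corrected b r Q J h * corrected b r Q J h' -
      corrected b r Q J h' * corrected b r Q J h) =
    (corrected b r Q J h * corrected b r Q J h' - corrected b r Q J h' * corrected b r Q J h) ⊗ₜ 1 +
      1 ⊗ₜ (corrected b r Q J h * corrected b r Q J h' -
        corrected b r Q J h' * corrected b r Q J h) := by
  have key := r.lowerTensor_identity b hB hs hinv Q.liftLeft Q.liftRight Q.liftLeft_lie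
    Q.liftRight_lie Q.liftLeft_mul_liftRight h h' rfl rfl rfl rfl
  rw [mulTensor_liftLeft, mulTensor_liftRight, mulTensor_liftLeft, mulTensor_liftRight] at key
  change 2 * (Q.liftTensor _ * Q.liftTensor _ - Q.liftTensor _ * Q.liftTensor _) +
    (_ * Q.liftTensor _ - Q.liftTensor _ * _) + (Q.liftTensor _ * _ - _ * Q.liftTensor _) = 0 at key
  have symm := bracket_lowerTensor_symm (b := b) (r := r) hJ h h'
  rw [map_sub, comul_mul, comul_mul, comul_corrected hs hinv hJ, comul_corrected hs hinv hJ]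
  set R := Q.liftTensor (r.lowerTensor b h)
  set R' := Q.liftTensor (r.lowerTensor b h')
  set n := Q.liftMul (r.lowerTensor b h)
  set n' := Q.liftMul (r.lowerTensor b h')
  have hT : corrected b r Q J h ⊗ₜ[ℂ[X]] (1 : A) + 1 ⊗ₜ[ℂ[X]] corrected b r Q J h =
      (J h ⊗ₜ 1 + 1 ⊗ₜ J h) - halfHbar • (n ⊗ₜ 1 + 1 ⊗ₜ n) := by
    rw [corrected, TensorProduct.sub_tmul, TensorProduct.tmul_sub,
      ← TensorProduct.smul_tmul', TensorProduct.tmul_smul]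
    module
  have hT' : corrected b r Q J h' ⊗ₜ[ℂ[X]] (1 : A) + 1 ⊗ₜ[ℂ[X]] corrected b r Q J h' =
      (J h' ⊗ₜ 1 + 1 ⊗ₜ J h') - halfHbar • (n' ⊗ₜ 1 + 1 ⊗ₜ n') := by
    rw [corrected, TensorProduct.sub_tmul, TensorProduct.tmul_sub,
      ← TensorProduct.smul_tmul', TensorProduct.tmul_smul]
    module
  have hTT : (corrected b r Q J h ⊗ₜ[ℂ[X]] (1 : A) + 1 ⊗ₜ[ℂ[X]] corrected b r Q J h) *
        (corrected b r Q J h' ⊗ₜ 1 + 1 ⊗ₜ corrected b r Q J h') -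
      (corrected b r Q J h' ⊗ₜ 1 + 1 ⊗ₜ corrected b r Q J h') *
        (corrected b r Q J h ⊗ₜ 1 + 1 ⊗ₜ corrected b r Q J h) =
      (corrected b r Q J h * corrected b r Q J h' - corrected b r Q J h' * corrected b r Q J h) ⊗ₜ 1 +
      1 ⊗ₜ (corrected b r Q J h * corrected b r Q J h' -
        corrected b r Q J h' * corrected b r Q J h) := by
    simp only [add_mul, mul_add, Algebra.TensorProduct.tmul_mul_tmul, one_mul, mul_one,
      TensorProduct.sub_tmul, TensorProduct.tmul_sub]
    abel
  rw [← hTT, hT, hT']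
  generalize J h ⊗ₜ[ℂ[X]] (1 : A) + 1 ⊗ₜ[ℂ[X]] J h = X at *
  generalize J h' ⊗ₜ[ℂ[X]] (1 : A) + 1 ⊗ₜ[ℂ[X]] J h' = X' at *
  generalize n ⊗ₜ[ℂ[X]] (1 : A) + 1 ⊗ₜ[ℂ[X]] n = a at *
  generalize n' ⊗ₜ[ℂ[X]] (1 : A) + 1 ⊗ₜ[ℂ[X]] n' = a' at *
  clear_value R R'
  -- The cross terms of order ħ vanish by symmetry in h and h'. Those of order ħ² are 2(ħ/2)² times
  -- the expression of `lowerTensor_identity`.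
  have e1 : ((2 * halfHbar) • (X * R' - R' * X - (X' * R - R * X')) : A ⊗[ℂ[X]] A) = 0 := by
    rw [symm, sub_self, smul_zero]
  have e2 := congrArg (fun t => (2 * (halfHbar * halfHbar)) • t) key
  simp only [smul_zero] at e2
  rw [two_mul (_ - _)] at e2
  simp only [sub_mul, mul_sub, smul_mul_assoc, mul_smul_comm, smul_smul, smul_sub,
    smul_add] at e1 e2 ⊢
  linear_combination (norm := module) e2 - e1

end CartanCorrected

end HomogeneousQuantization

/-! ### Vanishing of [T(t_i), T(t_j)] and the relation for J. -/

namespace HomogeneousQuantization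

section CartanBrackets

attribute [local instance 100] LieRing.ofAssociativeRing

set_option linter.unusedSectionVars false

variable {g : Type*} [LieRing g] [LieAlgebra ℂ g] [FiniteDimensional ℂ g]
  [LieAlgebra.IsSimple ℂ g] {H : LieSubalgebra ℂ g} [H.IsCartanSubalgebra]
  {b : (LieAlgebra.IsKilling.rootSystem H).Base} {B : LinearMap.BilinForm ℂ g}
  {hB : B.Nondegenerate} {r : RootVectors H B}
  {A : Type*} [Ring A] [HopfAlgebra ℂ[X] A] [Algebra ℂ A] [IsScalarTower ℂ ℂ[X] A]
  {Q : HomogeneousQuantization B hB A} {J : g →ₗ[ℂ] A}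

open IsDegreeOneGenerator

theorem halfHbar_smul (a : A) : halfHbar • a = (1 / 2 : ℂ) • (Polynomial.X : ℂ[X]) • a := by
  rw [halfHbar, smul_assoc]

theorem halfHbar_sq_smul (a : A) :
    (halfHbar * halfHbar) • a = (Polynomial.X ^ 2 : ℂ[X]) • (1 / 4 : ℂ) • a := by
  rw [halfHbar, smul_mul_smul_comm, ← pow_two Polynomial.X, smul_assoc, smul_comm]
  norm_num

theorem liftMul_mem_deg (t : g ⊗[ℂ] g) : Q.liftMul t ∈ Q.deg 0 := by
  induction t using TensorProduct.induction_on with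
  | zero => rw [map_zero]; exact zero_mem _
  | tmul x y => exact Q.mul_mem (Q.lift_mem x) (Q.lift_mem y)
  | add s t hs ht => rw [map_add]; exact add_mem hs ht

theorem corrected_mem_deg (hJ : Q.IsDegreeOneGenerator J) (h : H) :
    corrected b r Q J h ∈ Q.deg 1 := by
  rw [corrected, halfHbar_smul]
  exact sub_mem (hJ.mem_deg _)
    (Submodule.smul_mem _ _ (Q.hbar_smul_mem (liftMul_mem_deg _)))

theorem exists_bracket_corrected (hs : B.IsSymm) (hinv : B.lieInvariant g)
    (hJ : Q.IsDegreeOneGenerator J) (h h' : H) :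
    ∃ x : g, corrected b r Q J h * corrected b r Q J h' -
      corrected b r Q J h' * corrected b r Q J h = (Polynomial.X ^ 2 : ℂ[X]) • Q.lift x :=
  Q.exists_lift_of_primitive (LieAlgebra.center_eq_bot ℂ g)
    (sub_mem (Q.mul_mem (corrected_mem_deg hJ h) (corrected_mem_deg hJ h'))
      (Q.mul_mem (corrected_mem_deg hJ h') (corrected_mem_deg hJ h)))
    (comul_bracket_corrected hs hinv hJ h h')

theorem corrected_add (h h' : H) :
    corrected b r Q J (h + h') = corrected b r Q J h + corrected b r Q J h' := by
  have : r.lowerTensor b (h + h') = r.lowerTensor b h + r.lowerTensor b h' := by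
    simp only [RootVectors.lowerTensor, ← Finset.sum_add_distrib, ← add_smul]
    refine Finset.sum_congr rfl fun α _ => ?_
    rw [← root_apply_eq, map_add]; rfl
  rw [corrected, this, map_add, smul_add, H.coe_add, map_add, corrected, corrected]
  abel

theorem corrected_smul (c : ℂ) (h : H) :
    corrected b r Q J (c • h) = c • corrected b r Q J h := by
  have : r.lowerTensor b (c • h) = c • r.lowerTensor b h := by
    simp only [RootVectors.lowerTensor, Finset.smul_sum, smul_smul]
    refine Finset.sum_congr rfl fun α _ => ?_
    rw [← root_apply_eq, map_smul]; rfl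
  rw [corrected, this, map_smul, H.coe_smul, map_smul, corrected, smul_sub,
    smul_comm c halfHbar]

theorem innerDer_hbar_pow_smul_lift (n : ℕ) (z x : g) :
    innerDer (Q.lift z) ((Polynomial.X ^ n : ℂ[X]) • Q.lift x) =
      (Polynomial.X ^ n : ℂ[X]) • Q.lift ⁅z, x⁆ := by
  rw [innerDer_apply, mul_smul_comm, smul_mul_assoc, ← smul_sub, lift_lie]

theorem hbar_pow_smul_lift_injective (Q : HomogeneousQuantization B hB A) (n : ℕ) :
    Function.Injective fun x : g => (Polynomial.X ^ n : ℂ[X]) • Q.lift x := fun _ _ h =>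
  Q.lift_injective (LieAlgebra.center_eq_bot ℂ g) (Q.hbar_pow_smul_injective n h)

theorem innerDer_bracket (z a y : A) :
    innerDer z (a * y - y * a) = (innerDer z a * y - y * innerDer z a) +
      (a * innerDer z y - innerDer z y * a) := by
  simp only [innerDer_apply]; noncomm_ring

theorem mem_cartan_of_commute {x : g} (hx : ∀ k : H, ⁅(k : g), x⁆ = 0) : x ∈ H := by
  have h1 : x ∈ LieModule.weightSpace g (0 : H → ℂ) :=
    (LieModule.mem_weightSpace _ _).2 fun k => by
      rw [Pi.zero_apply, zero_smul]; exact hx k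
  have h2 : x ∈ LieAlgebra.rootSpace H (0 : H → ℂ) :=
    LieModule.weightSpace_le_genWeightSpace _ _ h1
  rw [LieAlgebra.rootSpace_zero_eq] at h2
  exact h2

theorem innerDer_corrected (hJ : Q.IsDegreeOneGenerator J) (z : g) (h : H) :
    innerDer (Q.lift z) (corrected b r Q J h) =
      J ⁅z, (h : g)⁆ - halfHbar • Q.liftMul ⁅z, r.lowerTensor b h⁆ := by
  rw [corrected, map_sub, innerDer_apply, hJ.lift_mul_sub, innerDer_apply, mul_smul_comm,
    smul_mul_assoc, ← smul_sub, liftMul_lie]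

/-- The bracket is ħ²x with x in the Cartan subalgebra. Since T(h) commutes with x_i^±, it inherits
the eigenvalue equation of `lie_lie_lowerRest`, which for such x reads α_i(x) t_i = α_i(t_i) x. -/
theorem exists_bracket_corrected_t_of_apply_eq_zero (hs : B.IsSymm) (hinv : B.lieInvariant g)
    (hJ : Q.IsDegreeOneGenerator J) {i : H.root} (hi : i ∈ b.support) {h : H}
    (hh : (i.1 : H → ℂ) h = 0) :
    ∃ y : ℂ, corrected b r Q J h * corrected b r Q J (r.t i) -
      corrected b r Q J (r.t i) * corrected b r Q J h =
      (Polynomial.X ^ 2 : ℂ[X]) • Q.lift (y • (r.t i : g)) := by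
  obtain ⟨x, hx⟩ := exists_bracket_corrected (b := b) (r := r) hs hinv hJ h (r.t i)
  set c := (i.1 : H → ℂ) (r.t i) with hc
  have hxH : x ∈ H := by
    refine mem_cartan_of_commute fun k => ?_
    have h0 : ∀ l : H, innerDer (Q.lift k) (corrected b r Q J l) = 0 := fun l => by
      rw [innerDer_corrected hJ, RootVectors.cartan_lie_cartan, r.lie_cartan_lowerTensor, map_zero,
        map_zero, smul_zero, sub_zero]
    have h1 := congrArg (innerDer (Q.lift (k : g))) hx
    rw [innerDer_bracket, h0, h0, innerDer_hbar_pow_smul_lift] at h1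
    apply hbar_pow_smul_lift_injective Q 2
    change (Polynomial.X ^ 2 : ℂ[X]) • Q.lift ⁅(k : g), x⁆ =
      (Polynomial.X ^ 2 : ℂ[X]) • Q.liftLinear 0
    rw [← h1, map_zero, smul_zero]
    noncomm_ring
  have hE : innerDer (Q.lift (r.pos i)) (corrected b r Q J h) = 0 := by
    rw [innerDer_corrected hJ, r.lie_pos_cartan, hh, zero_smul, _root_.neg_zero, map_zero,
      r.lie_lowerTensor_eq_zero hB hs hinv hi hh fun k hk => by rw [r.lie_pos, hk, zero_smul],
      map_zero, smul_zero, sub_zero]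
  have hF : innerDer (Q.lift (r.neg i)) (corrected b r Q J h) = 0 := by
    rw [innerDer_corrected hJ, r.lie_neg_cartan, hh, zero_smul, map_zero,
      r.lie_lowerTensor_eq_zero hB hs hinv hi hh fun k hk => by
        rw [r.lie_neg, Pi.neg_apply, hk, neg_zero, zero_smul],
      map_zero, smul_zero, sub_zero]
  set T := corrected b r Q J h
  -- `Y` is T(t_i) without its x_i⁻x_i⁺ term. That term commutes with T(h), and without it ad x_i⁻
  -- ad x_i⁺ acts by the scalar c.
  set Y : A := J (r.t i : g) - halfHbar • Q.liftMul (r.lowerRest b i) with hY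
  have hTt : corrected b r Q J (r.t i) =
      Y - halfHbar • c • (Q.lift (r.neg i) * Q.lift (r.pos i)) := by
    rw [hY, corrected, RootVectors.lowerRest, map_sub, map_smul, liftMul_tmul, smul_sub]
    abel
  have hYY : innerDer (Q.lift (r.neg i)) (innerDer (Q.lift (r.pos i)) Y) = c • Y := by
    have h1 : innerDer (Q.lift (r.pos i)) Y =
        J ⁅r.pos i, (r.t i : g)⁆ - halfHbar • Q.liftMul ⁅r.pos i, r.lowerRest b i⁆ := by
      rw [hY, map_sub, innerDer_apply, hJ.lift_mul_sub, innerDer_apply, mul_smul_comm,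
        smul_mul_assoc, ← smul_sub, liftMul_lie]
    rw [h1, map_sub, innerDer_apply, hJ.lift_mul_sub, innerDer_apply, mul_smul_comm,
        smul_mul_assoc, ← smul_sub, ← liftMul_lie, r.lie_lie_lowerRest hB hs hinv hi,
        r.lie_pos_cartan, _root_.lie_neg, lie_smul, r.lie_neg_pos, smul_neg, neg_neg, map_smul,
        map_smul, ← hc, hY, smul_sub, smul_comm c halfHbar]
  have hW : T * corrected b r Q J (r.t i) - corrected b r Q J (r.t i) * T = T * Y - Y * T := by
    rw [innerDer_apply, sub_eq_zero] at hE hF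
    have h1 : T * (Q.lift (r.neg i) * Q.lift (r.pos i)) =
        (Q.lift (r.neg i) * Q.lift (r.pos i)) * T := by
      rw [← mul_assoc, ← hF, mul_assoc, ← hE, mul_assoc]
    rw [hTt, mul_sub, sub_mul, mul_smul_comm, mul_smul_comm, smul_mul_assoc, smul_mul_assoc, h1]
    abel
  have hWW : innerDer (Q.lift (r.neg i)) (innerDer (Q.lift (r.pos i)) (T * Y - Y * T)) =
      c • (T * Y - Y * T) := by
    rw [innerDer_bracket, hE, zero_mul, mul_zero, sub_zero, zero_add, innerDer_bracket, hF, zero_mul,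
      mul_zero, sub_zero, zero_add, hYY, mul_smul_comm, smul_mul_assoc, smul_sub]
  rw [← hW, hx, innerDer_hbar_pow_smul_lift, innerDer_hbar_pow_smul_lift, smul_comm c,
    ← lift_smul] at hWW
  have h2 : ⁅r.neg i, ⁅r.pos i, x⁆⁆ = c • x := hbar_pow_smul_lift_injective Q 2 hWW
  have h3 := r.lie_pos_cartan i ⟨x, hxH⟩
  change ⁅r.pos i, x⁆ = _ at h3
  rw [h3, _root_.lie_neg, lie_smul, r.lie_neg_pos, smul_neg, neg_neg] at h2
  refine ⟨c⁻¹ * (i.1 : H → ℂ) ⟨x, hxH⟩, ?_⟩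
  rw [hx, mul_smul, h2, smul_smul, inv_mul_cancel₀ (r.apply_t_ne_zero hinv i), one_smul]

/-- Subtracting from h the multiple of t_i with the same α_i-value reduces to the previous case,
because T(t_i) commutes with itself. -/
theorem exists_bracket_corrected_t (hs : B.IsSymm) (hinv : B.lieInvariant g)
    (hJ : Q.IsDegreeOneGenerator J) {i : H.root} (hi : i ∈ b.support) (h : H) :
    ∃ y : ℂ, corrected b r Q J h * corrected b r Q J (r.t i) -
      corrected b r Q J (r.t i) * corrected b r Q J h =
      (Polynomial.X ^ 2 : ℂ[X]) • Q.lift (y • (r.t i : g)) := by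
  set k := (i.1 : H → ℂ) h / (i.1 : H → ℂ) (r.t i) with hk
  have h0 : (i.1 : H → ℂ) (h - k • r.t i) = 0 := by
    rw [← root_apply_eq, map_sub, map_smul, root_apply_eq, root_apply_eq, smul_eq_mul, hk,
      div_mul_cancel₀ _ (r.apply_t_ne_zero hinv i), sub_self]
  obtain ⟨y, hy⟩ := exists_bracket_corrected_t_of_apply_eq_zero (b := b) (r := r) hs hinv hJ hi h0
  refine ⟨y, ?_⟩
  rw [← hy]
  conv_lhs => rw [show h = (h - k • r.t i) + k • r.t i by abel, corrected_add, corrected_smul]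
  rw [add_mul, mul_add, smul_mul_assoc, mul_smul_comm]
  abel

/-- For i ≠ j the bracket lies in both ħ²ℂt_i and ħ²ℂt_j, and distinct simple roots are not
proportional. -/
theorem bracket_corrected_t (hs : B.IsSymm) (hinv : B.lieInvariant g)
    (hJ : Q.IsDegreeOneGenerator J) {i j : H.root} (hi : i ∈ b.support) (hj : j ∈ b.support) :
    corrected b r Q J (r.t i) * corrected b r Q J (r.t j) -
      corrected b r Q J (r.t j) * corrected b r Q J (r.t i) = 0 := by
  by_cases hij : i = j
  · rw [hij, sub_self]
  obtain ⟨y, hy⟩ := exists_bracket_corrected_t (b := b) (r := r) hs hinv hJ hj (r.t i)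
  obtain ⟨z, hz⟩ := exists_bracket_corrected_t (b := b) (r := r) hs hinv hJ hi (r.t j)
  have h1 : z • (r.t i : g) = (-y) • (r.t j : g) := by
    apply hbar_pow_smul_lift_injective Q 2
    change (Polynomial.X ^ 2 : ℂ[X]) • Q.lift _ = (Polynomial.X ^ 2 : ℂ[X]) • Q.liftLinear _
    rw [← hz, neg_smul, map_neg, smul_neg]
    change _ = -((Polynomial.X ^ 2 : ℂ[X]) • Q.lift _)
    rw [← hy, neg_sub]
  have h2 := r.eq_zero_of_smul_t_eq_smul_t hinv hi hj hij h1
  rw [← neg_sub, hz, h2]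
  change -((Polynomial.X ^ 2 : ℂ[X]) • Q.liftLinear 0) = 0
  rw [map_zero, smul_zero, neg_zero]

theorem bracket_J_t (hs : B.IsSymm) (hinv : B.lieInvariant g)
    (hJ : Q.IsDegreeOneGenerator J) {i j : H.root} (hi : i ∈ b.support) (hj : j ∈ b.support) :
    ⁅J (r.t i), J (r.t j)⁆ =
      (Polynomial.X ^ 2 : ℂ[X]) • Q.embed ⁅r.nu b (r.t j), r.nu b (r.t i)⁆ := by
  have h1 := bracket_corrected_t (b := b) (r := r) hs hinv hJ hi hj
  have h2 := bracket_liftMul_lowerTensor_symm (b := b) (r := r) hJ (r.t i) (r.t j)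
  rw [Ring.lie_def, Ring.lie_def, map_sub, map_mul, map_mul, embed_nu, embed_nu]
  rw [corrected, corrected] at h1
  set n := Q.liftMul (r.lowerTensor b (r.t i))
  set n' := Q.liftMul (r.lowerTensor b (r.t j))
  have h3 : (Polynomial.X ^ 2 : ℂ[X]) • ((1 / 2 : ℂ) • n' * (1 / 2 : ℂ) • n -
      (1 / 2 : ℂ) • n * (1 / 2 : ℂ) • n') = (halfHbar * halfHbar) • (n' * n - n * n') := by
    rw [halfHbar_sq_smul, smul_mul_smul_comm, smul_mul_smul_comm, ← smul_sub]
    norm_num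
  rw [h3]
  have h4 := congrArg (fun t => halfHbar • t) h2
  simp only [sub_mul, mul_sub, smul_mul_assoc, mul_smul_comm, smul_smul, smul_sub] at h1 h4 ⊢
  linear_combination (norm := module) h1 + h4

end CartanBrackets

end HomogeneousQuantization

/-! ### Rank one: computations with abstract generators. -/

section SlTwoRelations

set_option linter.unusedSimpArgs false

open TensorProduct Algebra.TensorProduct

variable {R A : Type*} [CommRing R] [Ring A] [Algebra R A]

/-- If `e, f, h` and `E, F, T` satisfy the relations of degree zero and one between the
Drinfeld generators of the Yangian of `sl₂`, then the usual coproduct formulas imply that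
`[[E, F], T]` is primitive. -/
theorem primitive_of_sl2_relations (c k : R) {e f h E F T G : A}
    (r1 : E * f = f * E + G) (r2 : e * F = F * e + G) (r3 : h * f = f * h - c • f)
    (r4 : e * h = h * e - c • e) (r5 : h * F = F * h - c • F) (r6 : E * h = h * E - c • E)
    (r7 : F * f = f * F - (k * c) • (f * f)) (r8 : E * e = e * E + (k * c) • (e * e))
    (r9 : G = T + k • (h * h)) (r10 : T * f = f * T - c • F) (r11 : T * e = e * T + c • E)
    (r12 : T * h = h * T) {E' F' T' : A ⊗[R] A}
    (hE : E' = E ⊗ₜ 1 + 1 ⊗ₜ E + (2 * k) • (h ⊗ₜ e))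
    (hF : F' = F ⊗ₜ 1 + 1 ⊗ₜ F + (2 * k) • (f ⊗ₜ h))
    (hT : T' = T ⊗ₜ 1 + 1 ⊗ₜ T - (2 * k * c) • (f ⊗ₜ e)) :
    (E' * F' - F' * E') * T' - T' * (E' * F' - F' * E') =
      ((E * F - F * E) * T - T * (E * F - F * E)) ⊗ₜ 1 +
        1 ⊗ₜ ((E * F - F * E) * T - T * (E * F - F * E)) := by
  have r13 : G * f = f * G - c • F - (k * c) • ((2 : R) • (f * h) - c • f) := by
    rw [r9, add_mul, mul_add, r10, smul_mul_assoc, mul_smul_comm, mul_assoc, r3, mul_sub,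
      ← mul_assoc, r3, sub_mul, mul_smul_comm, smul_mul_assoc, r3, mul_assoc]
    module
  have r14 : G * e = e * G + c • E + (k * c) • ((2 : R) • (h * e) - c • e) := by
    rw [r9, add_mul, mul_add, r11, smul_mul_assoc, mul_smul_comm, mul_assoc,
      ← mul_assoc e h h, r4, sub_mul, smul_mul_assoc, mul_assoc h e h, r4, mul_sub, mul_smul_comm]
    module
  have r15 : G * T = T * G := by
    rw [r9, add_mul, mul_add, smul_mul_assoc, mul_smul_comm, mul_assoc, ← r12, ← mul_assoc, ← r12,
      mul_assoc]
  have r16 : (E * F - F * E) * f = f * (E * F - F * E) + (T * F - F * T) -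
      (k * c) • ((2 : R) • (F * h) - c • F + (2 : R) • (f * G) - c • F -
        (k * c) • ((2 : R) • (f * h) - c • f)) := by
    have e1 : (E * F - F * E) * f = f * (E * F - F * E) + (G * F - F * G) -
        (k * c) • (G * f + f * G) := by
      rw [sub_mul, mul_assoc, mul_assoc, r1, r7, mul_sub, mul_smul_comm, ← mul_assoc E f F,
        ← mul_assoc E f f, r1, mul_add, ← mul_assoc F f E, r7, add_mul, add_mul,  mul_assoc f E f,
        r1, sub_mul, smul_mul_assoc]
      simp only [mul_add, mul_sub, smul_add, mul_assoc]
      abel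
    have e2 : G * F - F * G = T * F - F * T - (k * c) • ((2 : R) • (F * h) - c • F) := by
      rw [r9, add_mul, mul_add, smul_mul_assoc, mul_smul_comm, mul_assoc, r5, mul_sub, ← mul_assoc,
        r5, mul_smul_comm, r5, sub_mul, smul_mul_assoc, mul_assoc]
      module
    rw [e1, e2, r13]
    module
  have r17 : (E * F - F * E) * e = e * (E * F - F * E) + (T * E - E * T) +
      (k * c) • ((2 : R) • (e * G) + c • E + (k * c) • ((2 : R) • (h * e) - c • e) +
        (2 : R) • (h * E) - c • E) := by
    have r2' : F * e = e * F - G := by rw [r2]; abel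
    have e1 : (E * F - F * E) * e = e * (E * F - F * E) + (G * E - E * G) +
        (k * c) • (e * G + G * e) := by
      rw [sub_mul, mul_assoc, mul_assoc, r8, r2', mul_add, mul_sub, mul_smul_comm, ← mul_assoc E e F,
        ← mul_assoc F e e, ← mul_assoc F e E, r8, r2', sub_mul, sub_mul, mul_assoc e F e, r2',
        add_mul, smul_mul_assoc]
      simp only [mul_sub, smul_add, smul_sub, mul_assoc]
      abel
    have e2 : G * E - E * G = T * E - E * T + (k * c) • ((2 : R) • (h * E) - c • E) := by
      rw [r9, add_mul, mul_add, smul_mul_assoc, mul_smul_comm, mul_assoc, ← mul_assoc E h h, r6,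
        sub_mul, smul_mul_assoc, mul_assoc h E h, r6, mul_sub, mul_smul_comm]
      module
    rw [e1, e2, r14]
    module
  -- All words are put in normal order by the relations; bracketing `hK` with the one-sided T' then
  -- makes every mixed tensor cancel.
  have hK : E' * F' - F' * E' = (E * F - F * E) ⊗ₜ 1 + 1 ⊗ₜ (E * F - F * E) +
      (2 * k) • (G ⊗ₜ h + h ⊗ₜ G - c • (f ⊗ₜ E) - c • (F ⊗ₜ e)) +
      (2 * k * (2 * k)) • (c • c • (f ⊗ₜ[R] e) - c • ((f * h) ⊗ₜ e) - c • (f ⊗ₜ (h * e))) := by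
    rw [hE, hF]
    simp only [add_mul, mul_add, smul_mul_assoc, mul_smul_comm, tmul_mul_tmul, one_mul, mul_one,
      r1, r2, r3, r4, r5, r6, add_tmul, tmul_add, sub_tmul, tmul_sub, ← smul_tmul', tmul_smul]
    module
  rw [hK, hT]
  generalize E * F - F * E = P at *
  have h10' : ∀ x, T * (f * x) = f * (T * x) - c • (F * x) := fun x => by
    rw [← mul_assoc, r10, sub_mul, smul_mul_assoc, mul_assoc]
  have h4' : ∀ x, e * (h * x) = h * (e * x) - c • (e * x) := fun x => by
    rw [← mul_assoc, r4, sub_mul, smul_mul_assoc, mul_assoc]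
  have h12' : ∀ x, T * (h * x) = h * (T * x) := fun x => by
    rw [← mul_assoc, r12, mul_assoc]
  clear r9 hE hF hT hK
  simp only [add_mul, mul_add, sub_mul, mul_sub, smul_mul_assoc, mul_smul_comm, tmul_mul_tmul,
    one_mul, mul_one, mul_assoc, r3, r4, r7, r8, r10, r11, r12, r13, r14, r15, r16,
    r17, h10', h4', h12', add_tmul, tmul_add, sub_tmul, tmul_sub, ← smul_tmul', tmul_smul]
  module

/-- This is the origin of the right-hand side of the rank one relation: replacing J(e), J(f), J(h)
by the corrected generators changes the triple bracket only in order k². -/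
theorem sl2_corrected_bracket (c k : R) {e f h x y z E F T : A}
    (a1 : e * f = f * e + h) (a2 : h * f = f * h - c • f) (a3 : e * h = h * e - c • e)
    (b1 : x * f = f * x + z) (b2 : x * h = h * x - c • x) (b3 : x * e = e * x)
    (b4 : y * f = f * y) (b5 : y * h = h * y + c • y) (b6 : y * e = e * y - z)
    (b7 : z * f = f * z - c • y) (b8 : z * h = h * z) (b9 : z * e = e * z + c • x)
    (hE : E = x + k • (h * e)) (hF : F = y + k • (f * h)) (hT : T = z - (k * c) • (f * e)) :
    (E * F - F * E) * T - T * (E * F - F * E) =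
      ((x * y - y * x) * z - z * (x * y - y * x)) - (k * k) • c • c • ((f * x - y * e) * h) := by
  have a1' : ∀ w, e * (f * w) = f * (e * w) + h * w := fun w => by
    rw [← mul_assoc, a1, add_mul, mul_assoc]
  have a2' : ∀ w, h * (f * w) = f * (h * w) - c • (f * w) := fun w => by
    rw [← mul_assoc, a2, sub_mul, mul_assoc, smul_mul_assoc]
  have a3' : ∀ w, e * (h * w) = h * (e * w) - c • (e * w) := fun w => by
    rw [← mul_assoc, a3, sub_mul, mul_assoc, smul_mul_assoc]
  have b1' : ∀ w, x * (f * w) = f * (x * w) + z * w := fun w => by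
    rw [← mul_assoc, b1, add_mul, mul_assoc]
  have b2' : ∀ w, x * (h * w) = h * (x * w) - c • (x * w) := fun w => by
    rw [← mul_assoc, b2, sub_mul, mul_assoc, smul_mul_assoc]
  have b3' : ∀ w, x * (e * w) = e * (x * w) := fun w => by
    rw [← mul_assoc, b3, mul_assoc]
  have b4' : ∀ w, y * (f * w) = f * (y * w) := fun w => by
    rw [← mul_assoc, b4, mul_assoc]
  have b5' : ∀ w, y * (h * w) = h * (y * w) + c • (y * w) := fun w => by
    rw [← mul_assoc, b5, add_mul, mul_assoc, smul_mul_assoc]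
  have b6' : ∀ w, y * (e * w) = e * (y * w) - z * w := fun w => by
    rw [← mul_assoc, b6, sub_mul, mul_assoc]
  have b7' : ∀ w, z * (f * w) = f * (z * w) - c • (y * w) := fun w => by
    rw [← mul_assoc, b7, sub_mul, mul_assoc, smul_mul_assoc]
  have b8' : ∀ w, z * (h * w) = h * (z * w) := fun w => by
    rw [← mul_assoc, b8, mul_assoc]
  have b9' : ∀ w, z * (e * w) = e * (z * w) + c • (x * w) := fun w => by
    rw [← mul_assoc, b9, add_mul, mul_assoc, smul_mul_assoc]
  have hH : E * F - F * E = (x * y - y * x) + k • ((2 : R) • (h * z) - c • (f * x) - c • (e * y) +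
      c • z) + (k * k) • (h * (h * h) - (2 * c) • (h * (f * e)) - (c * c) • (f * e)) := by
    rw [hE, hF]
    simp only [add_mul, mul_add, sub_mul, mul_sub, smul_mul_assoc, mul_smul_comm, mul_assoc, a1,
      a2, a3, b1, b2, b3, b4, b5, b6, b7, b8, b9, a1', a2', a3', b1', b2', b3', b4', b5', b6', b7',
      b8', b9']
    module
  rw [hH, hT]
  simp only [add_mul, mul_add, sub_mul, mul_sub, smul_mul_assoc, mul_smul_comm, mul_assoc, a1,
      a2, a3, b1, b2, b3, b4, b5, b6, b7, b8, b9, a1', a2', a3', b1', b2', b3', b4', b5', b6', b7',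
      b8', b9']
  module

/-- The element `D = [[J(e), J(f)], J(h)] - s (f J(e) - J(f) e) h` spans, together with a second
element `V`, a space on which `ad f ∘ ad e` acts with eigenvalues `0` and `3c`. -/
theorem exists_ad_f_ad_e_companion (c s : R) {e f h x y z D : A}
    (a1 : e * f = f * e + h) (a2 : h * f = f * h - c • f) (a3 : e * h = h * e - c • e)
    (b1 : x * f = f * x + z) (b2 : x * h = h * x - c • x) (b3 : x * e = e * x)
    (b4 : y * f = f * y) (b5 : y * h = h * y + c • y) (b6 : y * e = e * y - z)
    (b7 : z * f = f * z - c • y) (b8 : z * h = h * z) (b9 : z * e = e * z + c • x)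
    (hD : D = ((x * y - y * x) * z - z * (x * y - y * x)) - s • ((f * x - y * e) * h)) :
    ∃ V : A, f * (e * D - D * e) - (e * D - D * e) * f = (2 * c) • D - c • V ∧
      f * (e * V - V * e) - (e * V - V * e) * f = c • V - (2 * c) • D := by
  have a1' : ∀ w, e * (f * w) = f * (e * w) + h * w := fun w => by
    rw [← mul_assoc, a1, add_mul, mul_assoc]
  have a2' : ∀ w, h * (f * w) = f * (h * w) - c • (f * w) := fun w => by
    rw [← mul_assoc, a2, sub_mul, mul_assoc, smul_mul_assoc]
  have a3' : ∀ w, e * (h * w) = h * (e * w) - c • (e * w) := fun w => by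
    rw [← mul_assoc, a3, sub_mul, mul_assoc, smul_mul_assoc]
  have b1' : ∀ w, x * (f * w) = f * (x * w) + z * w := fun w => by
    rw [← mul_assoc, b1, add_mul, mul_assoc]
  have b2' : ∀ w, x * (h * w) = h * (x * w) - c • (x * w) := fun w => by
    rw [← mul_assoc, b2, sub_mul, mul_assoc, smul_mul_assoc]
  have b3' : ∀ w, x * (e * w) = e * (x * w) := fun w => by
    rw [← mul_assoc, b3, mul_assoc]
  have b4' : ∀ w, y * (f * w) = f * (y * w) := fun w => by
    rw [← mul_assoc, b4, mul_assoc]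
  have b5' : ∀ w, y * (h * w) = h * (y * w) + c • (y * w) := fun w => by
    rw [← mul_assoc, b5, add_mul, mul_assoc, smul_mul_assoc]
  have b6' : ∀ w, y * (e * w) = e * (y * w) - z * w := fun w => by
    rw [← mul_assoc, b6, sub_mul, mul_assoc]
  have b7' : ∀ w, z * (f * w) = f * (z * w) - c • (y * w) := fun w => by
    rw [← mul_assoc, b7, sub_mul, mul_assoc, smul_mul_assoc]
  have b8' : ∀ w, z * (h * w) = h * (z * w) := fun w => by
    rw [← mul_assoc, b8, mul_assoc]
  have b9' : ∀ w, z * (e * w) = e * (z * w) + c • (x * w) := fun w => by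
    rw [← mul_assoc, b9, add_mul, mul_assoc, smul_mul_assoc]
  -- The companion is the sum of the other two cyclic brackets. By Jacobi v = -u, so u is an
  -- eigenvector for 3c.
  have h1 : ∀ u v : A, u = (x * y - y * x) * z - z * (x * y - y * x) →
      v = ((z * x - x * z) * y - y * (z * x - x * z)) +
        ((y * z - z * y) * x - x * (y * z - z * y)) →
      f * (e * u - u * e) - (e * u - u * e) * f = (2 * c) • u - c • v ∧
        f * (e * v - v * e) - (e * v - v * e) * f = c • v - (2 * c) • u := by
    rintro u v rfl rfl
    constructor
    · simp only [add_mul, mul_add, sub_mul, mul_sub, smul_mul_assoc, mul_smul_comm, mul_assoc, a1,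
        a2, a3, b1, b2, b3, b4, b5, b6, b7, b8, b9, a1', a2', a3', b1', b2', b3', b4', b5', b6',
        b7', b8', b9']
      module
    · simp only [add_mul, mul_add, sub_mul, mul_sub, smul_mul_assoc, mul_smul_comm, mul_assoc, a1,
        a2, a3, b1, b2, b3, b4, b5, b6, b7, b8, b9, a1', a2', a3', b1', b2', b3', b4', b5', b6',
        b7', b8', b9']
      module
  -- The same cyclic pattern for the correction term. Here u + v is killed by ad f ad e and 2u - v
  -- has eigenvalue 3c.
  have h2 : ∀ u v : A, u = (f * x - y * e) * h → v = (z * e - h * x) * f + (y * h - f * z) * e →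
      f * (e * u - u * e) - (e * u - u * e) * f = (2 * c) • u - c • v ∧
        f * (e * v - v * e) - (e * v - v * e) * f = c • v - (2 * c) • u := by
    rintro u v rfl rfl
    constructor
    · simp only [add_mul, mul_add, sub_mul, mul_sub, smul_mul_assoc, mul_smul_comm, mul_assoc, a1,
        a2, a3, b1, b2, b3, b4, b5, b6, b7, b8, b9, a1', a2', a3', b1', b2', b3', b4', b5', b6',
        b7', b8', b9']
      module
    · simp only [add_mul, mul_add, sub_mul, mul_sub, smul_mul_assoc, mul_smul_comm, mul_assoc, a1,
        a2, a3, b1, b2, b3, b4, b5, b6, b7, b8, b9, a1', a2', a3', b1', b2', b3', b4', b5', b6',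
        b7', b8', b9']
      module
  obtain ⟨p1, p2⟩ := h1 _ _ rfl rfl
  obtain ⟨q1, q2⟩ := h2 _ _ rfl rfl
  subst hD
  generalize ((z * x - x * z) * y - y * (z * x - x * z)) +
    ((y * z - z * y) * x - x * (y * z - z * y)) = v at *
  generalize (z * e - h * x) * f + (y * h - f * z) * e = v' at *
  generalize (x * y - y * x) * z - z * (x * y - y * x) = u at *
  generalize (f * x - y * e) * h = u' at *
  have q1' := congrArg (fun t => s • t) q1
  have q2' := congrArg (fun t => s • t) q2
  refine ⟨v - s • v', ?_, ?_⟩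
  · simp only [mul_sub, sub_mul, mul_smul_comm, smul_mul_assoc, smul_sub] at p1 q1' ⊢
    linear_combination (norm := module) p1 - q1'
  · simp only [mul_sub, sub_mul, mul_smul_comm, smul_mul_assoc, smul_sub] at p2 q2' ⊢
    linear_combination (norm := module) p2 - q2'

/-- The element `[[J(e), J(f)], J(h)] - k² c² (f J(e) - J(f) e) h` is primitive for every algebra
map `Δ` which satisfies the coproduct formulas of Drinfeld's `J`-presentation. -/
theorem primitive_sl2_bracket_sub (c k : R) {e f h x y z : A} (Δ : A →ₐ[R] A ⊗[R] A)
    (a1 : e * f = f * e + h) (a2 : h * f = f * h - c • f) (a3 : e * h = h * e - c • e)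
    (b1 : x * f = f * x + z) (b2 : x * h = h * x - c • x) (b3 : x * e = e * x)
    (b4 : y * f = f * y) (b5 : y * h = h * y + c • y) (b6 : y * e = e * y - z)
    (b7 : z * f = f * z - c • y) (b8 : z * h = h * z) (b9 : z * e = e * z + c • x)
    (d1 : Δ e = e ⊗ₜ 1 + 1 ⊗ₜ e) (d2 : Δ f = f ⊗ₜ 1 + 1 ⊗ₜ f) (d3 : Δ h = h ⊗ₜ 1 + 1 ⊗ₜ h)
    (d4 : Δ x = x ⊗ₜ 1 + 1 ⊗ₜ x + k • (h ⊗ₜ e - e ⊗ₜ h))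
    (d5 : Δ y = y ⊗ₜ 1 + 1 ⊗ₜ y + k • (f ⊗ₜ h - h ⊗ₜ f))
    (d6 : Δ z = z ⊗ₜ 1 + 1 ⊗ₜ z + k • c • (e ⊗ₜ f - f ⊗ₜ e)) {D : A}
    (hD : D = ((x * y - y * x) * z - z * (x * y - y * x)) -
      (k * k) • c • c • ((f * x - y * e) * h)) :
    Δ D = D ⊗ₜ 1 + 1 ⊗ₜ D := by
  have a1' : ∀ w, e * (f * w) = f * (e * w) + h * w := fun w => by
    rw [← mul_assoc, a1, add_mul, mul_assoc]
  have a2' : ∀ w, h * (f * w) = f * (h * w) - c • (f * w) := fun w => by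
    rw [← mul_assoc, a2, sub_mul, mul_assoc, smul_mul_assoc]
  have a3' : ∀ w, e * (h * w) = h * (e * w) - c • (e * w) := fun w => by
    rw [← mul_assoc, a3, sub_mul, mul_assoc, smul_mul_assoc]
  -- The corrections k he, k fh and -kc fe cancel one of the two mixed tensors in each of the
  -- coproducts of x, y and z.
  obtain ⟨E, hE⟩ : ∃ E, E = x + k • (h * e) := ⟨_, rfl⟩
  obtain ⟨F, hF⟩ : ∃ F, F = y + k • (f * h) := ⟨_, rfl⟩
  obtain ⟨T, hT⟩ : ∃ T, T = z - (k * c) • (f * e) := ⟨_, rfl⟩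
  rw [← sl2_corrected_bracket c k a1 a2 a3 b1 b2 b3 b4 b5 b6 b7 b8 b9 hE hF hT] at hD
  rw [hD]
  simp only [map_sub, map_mul]
  have b1' : ∀ w, x * (f * w) = f * (x * w) + z * w := fun w => by
    rw [← mul_assoc, b1, add_mul, mul_assoc]
  have b2' : ∀ w, x * (h * w) = h * (x * w) - c • (x * w) := fun w => by
    rw [← mul_assoc, b2, sub_mul, mul_assoc, smul_mul_assoc]
  refine primitive_of_sl2_relations c k (e := e) (f := f) (h := h) (G := T + k • (h * h))
    ?_ ?_ a2 a3 ?_ ?_ ?_ ?_ rfl ?_ ?_ ?_ ?_ ?_ ?_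
  all_goals first
    | (rw [hE]; simp only [map_add, map_sub, map_smul, map_mul, d1, d2, d3, d4])
    | (rw [hF]; simp only [map_add, map_sub, map_smul, map_mul, d1, d2, d3, d5])
    | (rw [hT]; simp only [map_add, map_sub, map_smul, map_mul, d1, d2, d3, d6])
    | skip
  all_goals try rw [hE]
  all_goals try rw [hF]
  all_goals try rw [hT]
  all_goals
    simp only [add_mul, mul_add, sub_mul, mul_sub, smul_mul_assoc, mul_smul_comm, mul_assoc, a1,
      a2, a3, b1, b2, b3, b4, b5, b6, b7, b8, b9, a1', a2', a3', tmul_mul_tmul, one_mul, mul_one,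
      add_tmul, tmul_add, sub_tmul, tmul_sub, ← smul_tmul', tmul_smul]
    try module

theorem commute_sl2_bracket_sub (c s : R) {e f h x y z D : A}
    (a2 : h * f = f * h - c • f) (a3 : e * h = h * e - c • e)
    (b2 : x * h = h * x - c • x) (b5 : y * h = h * y + c • y) (b8 : z * h = h * z)
    (hD : D = ((x * y - y * x) * z - z * (x * y - y * x)) - s • ((f * x - y * e) * h)) :
    h * D - D * h = 0 := by
  have b2' : ∀ w, x * (h * w) = h * (x * w) - c • (x * w) := fun w => by
    rw [← mul_assoc, b2, sub_mul, mul_assoc, smul_mul_assoc]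
  have b5' : ∀ w, y * (h * w) = h * (y * w) + c • (y * w) := fun w => by
    rw [← mul_assoc, b5, add_mul, mul_assoc, smul_mul_assoc]
  have b8' : ∀ w, z * (h * w) = h * (z * w) := fun w => by
    rw [← mul_assoc, b8, mul_assoc]
  have a2' : ∀ w, h * (f * w) = f * (h * w) - c • (f * w) := fun w => by
    rw [← mul_assoc, a2, sub_mul, mul_assoc, smul_mul_assoc]
  have a3' : ∀ w, e * (h * w) = h * (e * w) - c • (e * w) := fun w => by
    rw [← mul_assoc, a3, sub_mul, mul_assoc, smul_mul_assoc]
  rw [hD]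
  simp only [add_mul, mul_add, sub_mul, mul_sub, smul_mul_assoc, mul_smul_comm, mul_assoc,
    a2, a3, b2, b5, b8, a2', a3', b2', b5', b8']
  module

end SlTwoRelations

/-! ### The rank one relation in the quantization. -/

section SlTwo

attribute [local instance 100] LieRing.ofAssociativeRing

variable {g : Type*} [LieRing g] [LieAlgebra ℂ g]

theorem finrank_le_three_of_equiv_sl_two (φ : g ≃ₗ⁅ℂ⁆ LieAlgebra.SpecialLinear.sl (Fin 2) ℂ) :
    Module.finrank ℂ g ≤ 3 := by
  rw [φ.toLinearEquiv.finrank_eq]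
  have h1 : (LieAlgebra.SpecialLinear.sl (Fin 2) ℂ).toSubmodule ≠ ⊤ := fun h => by
    have h2 : (1 : Matrix (Fin 2) (Fin 2) ℂ) ∈
        (LieAlgebra.SpecialLinear.sl (Fin 2) ℂ).toSubmodule := h ▸ Submodule.mem_top
    have h3 : Matrix.trace (1 : Matrix (Fin 2) (Fin 2) ℂ) = 0 := h2
    simp at h3
  have h2 := Submodule.finrank_lt h1
  rw [Module.finrank_matrix] at h2
  simp only [Fintype.card_fin, Module.finrank_self] at h2
  change Module.finrank ℂ (LieAlgebra.SpecialLinear.sl (Fin 2) ℂ).toSubmodule ≤ 3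
  omega

variable [FiniteDimensional ℂ g] [LieAlgebra.IsSimple ℂ g]
  {H : LieSubalgebra ℂ g} [H.IsCartanSubalgebra]
  {B : LinearMap.BilinForm ℂ g} {hB : B.Nondegenerate}

namespace RootVectors

variable (r : RootVectors H B)

/-- The three vectors are eigenvectors of ad t_i for the distinct eigenvalues c, -c and 0, so they
form a basis. -/
theorem exists_eq_of_finrank_le_three (hinv : B.lieInvariant g) (h3 : Module.finrank ℂ g ≤ 3)
    (i : H.root) (x : g) : ∃ α β γ : ℂ,
      x = α • r.pos i + β • r.neg i + γ • (r.t i : g) := by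
  have hc := r.apply_t_ne_zero hinv i
  have ht : (r.t i : g) ≠ 0 := fun h => by
    have := r.form_t hinv i (r.t i)
    rw [h, map_zero] at this
    exact hc this.symm
  have hli : LinearIndependent ℂ ![r.pos i, r.neg i, (r.t i : g)] := by
    refine Module.End.eigenvectors_linearIndependent' (LieAlgebra.ad ℂ g (r.t i : g))
      ![(i.1 : H → ℂ) (r.t i), -(i.1 : H → ℂ) (r.t i), 0] ?_ _ fun j => ?_
    · have h2 : (i.1 : H → ℂ) (r.t i) ≠ -(i.1 : H → ℂ) (r.t i) := fun h =>
        hc (self_eq_neg.1 h)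
      intro a d
      fin_cases a <;> fin_cases d <;> simp [hc, h2, h2.symm, hc.symm]
    · fin_cases j
      · exact ⟨Module.End.mem_eigenspace_iff.2 (r.lie_pos i (r.t i)), r.pos_ne_zero i⟩
      · exact ⟨Module.End.mem_eigenspace_iff.2 (r.lie_neg i (r.t i)), r.neg_ne_zero' i⟩
      · refine ⟨Module.End.mem_eigenspace_iff.2 ?_, ht⟩
        change ⁅(r.t i : g), (r.t i : g)⁆ = (0 : ℂ) • _
        rw [lie_self, zero_smul]
  have hcard : Fintype.card (Fin 3) = Module.finrank ℂ g :=
    le_antisymm hli.fintype_card_le_finrank (by simpa using h3)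
  have hx : x ∈ Submodule.span ℂ (Set.range ![r.pos i, r.neg i, (r.t i : g)]) := by
    rw [hli.span_eq_top_of_card_eq_finrank' hcard]; exact Submodule.mem_top
  obtain ⟨k, hk⟩ := (Submodule.mem_span_range_iff_exists_fun ℂ).1 hx
  exact ⟨k 0, k 1, k 2, by rw [← hk, Fin.sum_univ_three]; rfl⟩

theorem form_pos_self (hinv : B.lieInvariant g) (i : H.root) : B (r.pos i) (r.pos i) = 0 := by
  have h := hinv (r.t i : g) (r.pos i) (r.pos i)
  rw [r.lie_pos] at h
  simp only [map_smul, LinearMap.smul_apply, smul_eq_mul] at h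
  have h2 : (i.1 : H → ℂ) (r.t i) * B (r.pos i) (r.pos i) = 0 := self_eq_neg.1 h
  exact (mul_eq_zero.1 h2).resolve_left (r.apply_t_ne_zero hinv i)

theorem form_neg_self (hinv : B.lieInvariant g) (i : H.root) : B (r.neg i) (r.neg i) = 0 := by
  have h := hinv (r.t i : g) (r.neg i) (r.neg i)
  rw [r.lie_neg] at h
  simp only [map_smul, LinearMap.smul_apply, smul_eq_mul, Pi.neg_apply] at h
  have h2 : -(i.1 : H → ℂ) (r.t i) * B (r.neg i) (r.neg i) = 0 := self_eq_neg.1 h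
  exact (mul_eq_zero.1 h2).resolve_left (neg_ne_zero.2 (r.apply_t_ne_zero hinv i))

theorem casimirBracket_sl_two (hs : B.IsSymm) (hinv : B.lieInvariant g)
    (h3 : Module.finrank ℂ g ≤ 3) (i : H.root) :
    casimirBracket B hB (r.pos i) = (r.t i : g) ⊗ₜ r.pos i - r.pos i ⊗ₜ (r.t i : g) ∧
    casimirBracket B hB (r.neg i) = r.neg i ⊗ₜ (r.t i : g) - (r.t i : g) ⊗ₜ r.neg i ∧
    casimirBracket B hB (r.t i : g) = (i.1 : H → ℂ) (r.t i) •
      (r.pos i ⊗ₜ r.neg i - r.neg i ⊗ₜ r.pos i) := by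
  have key : ∀ (x : g) (s : g ⊗[ℂ] g), (∀ α β γ : ℂ,
      ⁅x, α • r.pos i + β • r.neg i + γ • (r.t i : g)⁆ =
        contractSecond B (α • r.pos i + β • r.neg i + γ • (r.t i : g)) s) →
      casimirBracket B hB x = s := by
    intro x s h
    rw [← sub_eq_zero]
    refine eq_zero_of_contractSecond B hB fun y => ?_
    rw [map_sub, contractSecond_casimirBracket, sub_eq_zero]
    obtain ⟨α, β, γ, rfl⟩ := r.exists_eq_of_finrank_le_three hinv h3 i y
    exact h α β γ
  have f1 := r.form_pos_self hinv i
  have f2 := r.form_neg_self hinv i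
  have f3 := r.form_eq_one i
  have f4 : B (r.neg i) (r.pos i) = 1 := by rw [hs.eq, f3]
  have f5 := r.form_pos_cartan hinv i (r.t i)
  have f6 := r.form_neg_cartan hinv i (r.t i)
  have f7 : B (r.t i : g) (r.pos i) = 0 := by rw [hs.eq, f5]
  have f8 : B (r.t i : g) (r.neg i) = 0 := by rw [hs.eq, f6]
  refine ⟨key _ _ fun α β γ => ?_, key _ _ fun α β γ => ?_, key _ _ fun α β γ => ?_⟩
  all_goals
    simp only [lie_add, lie_smul, map_sub, map_smul, map_add, contractSecond_tmul, f1, f2, f3, f4,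
      f5, f6, f7, f8, r.form_t hinv, r.lie_pos_cartan, r.lie_neg_cartan, r.lie_neg_pos,
      r.lie_pos_neg, r.lie_pos, r.lie_neg, lie_self, smul_eq_mul, Pi.neg_apply]
    module

end RootVectors

namespace HomogeneousQuantization

variable {r : RootVectors H B}
  {A : Type*} [Ring A] [HopfAlgebra ℂ[X] A] [Algebra ℂ A] [IsScalarTower ℂ ℂ[X] A]
  {Q : HomogeneousQuantization B hB A} {J : g →ₗ[ℂ] A}

open IsDegreeOneGenerator

theorem bracket_J_sl_two (hs : B.IsSymm) (hinv : B.lieInvariant g)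
    (h3 : Module.finrank ℂ g ≤ 3) (hJ : Q.IsDegreeOneGenerator J) (i : H.root) :
    ⁅⁅J (r.pos i), J (r.neg i)⁆, J (r.t i)⁆ =
      (B (r.t i : g) (r.t i : g) / 2) ^ 2 • (Polynomial.X ^ 2 : ℂ[X]) •
        ((Q.embed (envIncl g (r.neg i)) * J (r.pos i) -
          J (r.neg i) * Q.embed (envIncl g (r.pos i))) * Q.embed (envIncl g (r.t i : g))) := by
  obtain ⟨ce, cf, ch⟩ := r.casimirBracket_sl_two (hB := hB) hs hinv h3 i
  have hc := r.apply_t_ne_zero hinv i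
  rw [r.form_t hinv]
  -- (h, h) = α_i(t_i) is the constant c of the abstract relations, where [h, e] = c e; there k is
  -- ħ/2, so that k²c² = (c/2)²ħ².
  set c := (i.1 : H → ℂ) (r.t i) with hcdef
  have hC : ∀ a : A, Polynomial.C c • a = c • a := fun a => by
    rw [Polynomial.C_eq_algebraMap, algebraMap_smul]
  simp only [embed_envIncl, Ring.lie_def]
  have lf := Q.lift_lie
  have l0 : Q.lift (0 : g) = 0 := map_zero Q.liftLinear
  have ln : ∀ x, Q.lift (-x) = -Q.lift x := map_neg Q.liftLinear
  have a1 := lf (r.pos i) (r.neg i)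
  have a2 := lf (r.t i : g) (r.neg i)
  have a3 := lf (r.pos i) (r.t i : g)
  have b1 := hJ.mul_lift_sub (r.pos i) (r.neg i)
  have b2 := hJ.mul_lift_sub (r.pos i) (r.t i : g)
  have b3 := hJ.mul_lift_sub (r.pos i) (r.pos i)
  have b4 := hJ.mul_lift_sub (r.neg i) (r.neg i)
  have b5 := hJ.mul_lift_sub (r.neg i) (r.t i : g)
  have b6 := hJ.mul_lift_sub (r.neg i) (r.pos i)
  have b7 := hJ.mul_lift_sub (r.t i : g) (r.neg i)
  have b8 := hJ.mul_lift_sub (r.t i : g) (r.t i : g)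
  have b9 := hJ.mul_lift_sub (r.t i : g) (r.pos i)
  simp only [r.lie_pos_cartan, r.lie_neg_cartan, r.lie_neg_pos, r.lie_pos_neg, r.lie_pos,
    r.lie_neg, lie_self, map_zero, map_neg, map_smul, lift_smul, ln, Pi.neg_apply, neg_smul,
    ← hcdef] at a1 a2 a3 b1 b2 b3 b4 b5 b6 b7 b8 b9
  obtain ⟨e, he⟩ : ∃ e, e = Q.lift (r.pos i) := ⟨_, rfl⟩
  obtain ⟨f, hf⟩ : ∃ f, f = Q.lift (r.neg i) := ⟨_, rfl⟩
  obtain ⟨h, hh⟩ : ∃ h, h = Q.lift (r.t i : g) := ⟨_, rfl⟩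
  obtain ⟨x, hx⟩ : ∃ x, x = J (r.pos i) := ⟨_, rfl⟩
  obtain ⟨y, hy⟩ : ∃ y, y = J (r.neg i) := ⟨_, rfl⟩
  obtain ⟨z, hz⟩ : ∃ z, z = J (r.t i : g) := ⟨_, rfl⟩
  rw [← he, ← hf, ← hh] at a1
  rw [← hf, ← hh] at a2
  rw [← he, ← hh] at a3
  rw [← hx, ← hf, ← hz] at b1
  rw [← hx, ← hh] at b2
  rw [← hx, ← he] at b3
  rw [← hy, ← hf] at b4
  rw [← hy, ← hh] at b5
  rw [← hy, ← he, ← hz] at b6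
  rw [← hz, ← hf, ← hy] at b7
  rw [← hz, ← hh] at b8
  rw [← hz, ← he, ← hx] at b9
  rw [← he, ← hf, ← hh, ← hx, ← hy, ← hz]
  replace a1 : e * f = f * e + h := by linear_combination (norm := module) -a1
  replace a2 : h * f = f * h - Polynomial.C c • f := by
    rw [hC]; linear_combination (norm := module) -a2
  replace a3 : e * h = h * e - Polynomial.C c • e := by
    rw [hC]; linear_combination (norm := module) -a3
  replace b1 : x * f = f * x + z := by linear_combination (norm := module) b1
  replace b2 : x * h = h * x - Polynomial.C c • x := by
    rw [hC]; linear_combination (norm := module) b2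
  replace b3 : x * e = e * x := by linear_combination (norm := module) b3
  replace b4 : y * f = f * y := by linear_combination (norm := module) b4
  replace b5 : y * h = h * y + Polynomial.C c • y := by
    rw [hC]; linear_combination (norm := module) b5
  replace b6 : y * e = e * y - z := by linear_combination (norm := module) b6
  replace b7 : z * f = f * z - Polynomial.C c • y := by
    rw [hC]; linear_combination (norm := module) b7
  replace b8 : z * h = h * z := by linear_combination (norm := module) b8
  replace b9 : z * e = e * z + Polynomial.C c • x := by
    rw [hC]; linear_combination (norm := module) b9
  have d1 := Q.comul_lift (r.pos i)
  have d2 := Q.comul_lift (r.neg i)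
  have d3 := Q.comul_lift (r.t i : g)
  have d4 := hJ.comul (r.pos i)
  have d5 := hJ.comul (r.neg i)
  have d6 := hJ.comul (r.t i : g)
  rw [ce, map_sub, liftTensor_tmul, liftTensor_tmul] at d4
  rw [cf, map_sub, liftTensor_tmul, liftTensor_tmul] at d5
  rw [ch, map_smul, map_sub, liftTensor_tmul, liftTensor_tmul,
    ← algebraMap_smul ℂ[X] c (_ - _), ← Polynomial.C_eq_algebraMap] at d6
  rw [← he] at d1
  rw [← hf] at d2
  rw [← hh] at d3
  rw [← hx, ← he, ← hh] at d4
  rw [← hy, ← hf, ← hh] at d5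
  rw [← hz, ← he, ← hf] at d6
  obtain ⟨D, hD⟩ : ∃ D, D = ((x * y - y * x) * z - z * (x * y - y * x)) -
      (halfHbar * halfHbar) • Polynomial.C c • Polynomial.C c • ((f * x - y * e) * h) :=
    ⟨_, rfl⟩
  have hprim : Coalgebra.comul (R := ℂ[X]) D = D ⊗ₜ 1 + 1 ⊗ₜ D :=
    primitive_sl2_bracket_sub (Polynomial.C c) halfHbar (Bialgebra.comulAlgHom ℂ[X] A)
      a1 a2 a3 b1 b2 b3 b4 b5 b6 b7 b8 b9 d1 d2 d3 d4 d5 d6 hD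
  have hD' : D = ((x * y - y * x) * z - z * (x * y - y * x)) -
      (c / 2) ^ 2 • (Polynomial.X ^ 2 : ℂ[X]) • ((f * x - y * e) * h) := by
    rw [hD, hC, hC, halfHbar_sq_smul, smul_comm ((c / 2) ^ 2)]
    congr 2
    module
  have hdeg : D ∈ Q.deg 3 := by
    have mx : x ∈ Q.deg 1 := hx ▸ hJ.mem_deg _
    have my : y ∈ Q.deg 1 := hy ▸ hJ.mem_deg _
    have mz : z ∈ Q.deg 1 := hz ▸ hJ.mem_deg _
    have me : e ∈ Q.deg 0 := he ▸ Q.lift_mem _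
    have mf : f ∈ Q.deg 0 := hf ▸ Q.lift_mem _
    have mh : h ∈ Q.deg 0 := hh ▸ Q.lift_mem _
    have mxy : x * y - y * x ∈ Q.deg 2 := sub_mem (Q.mul_mem mx my) (Q.mul_mem my mx)
    have mfx : f * x ∈ Q.deg 1 := Q.mul_mem mf mx
    have mye : y * e ∈ Q.deg 1 := Q.mul_mem my me
    have m1 : (f * x - y * e) * h ∈ Q.deg 1 := Q.mul_mem (sub_mem mfx mye) mh
    rw [hD', pow_two Polynomial.X, mul_smul]
    exact sub_mem (sub_mem (Q.mul_mem mxy mz) (Q.mul_mem mz mxy))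
      (Submodule.smul_mem _ _ (Q.hbar_smul_mem (Q.hbar_smul_mem m1)))
  suffices h0 : D = 0 from sub_eq_zero.1 (hD'.symm.trans h0)
  have hD'' : D = ((x * y - y * x) * z - z * (x * y - y * x)) -
      (halfHbar * halfHbar * Polynomial.C c * Polynomial.C c) • ((f * x - y * e) * h) := by
    rw [hD]; module
  obtain ⟨V, hV1, hV2⟩ := exists_ad_f_ad_e_companion _ _ a1 a2 a3 b1 b2 b3 b4 b5 b6 b7 b8 b9 hD''
  have hcomm := commute_sl2_bracket_sub _ _ a2 a3 b2 b5 b8 hD''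
  obtain ⟨w, hw⟩ := Q.exists_lift_of_primitive (LieAlgebra.center_eq_bot ℂ g) hdeg hprim
  have hinj := hbar_pow_smul_lift_injective Q 3
  have hw0 : ⁅(r.t i : g), w⁆ = 0 := by
    apply hinj
    change _ = (Polynomial.X ^ 3 : ℂ[X]) • Q.lift (0 : g)
    rw [l0, smul_zero, ← hcomm, hw, hh, ← innerDer_apply, innerDer_hbar_pow_smul_lift]
  obtain ⟨α, β, γ, rfl⟩ := r.exists_eq_of_finrank_le_three hinv h3 i w
  -- Commuting with t_i forces α = 0 and βx_i⁻ = 0, so w = γt_i, on which ad f ad e acts by c.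
  have hwt : ⁅r.neg i, ⁅r.pos i, α • r.pos i + β • r.neg i + γ • (r.t i : g)⁆⁆ =
      c • (α • r.pos i + β • r.neg i + γ • (r.t i : g)) := by
    have h1 : c • (α • r.pos i - β • r.neg i) = 0 := by
      rw [← hw0]
      simp only [lie_add, lie_smul, r.lie_pos, r.lie_neg, lie_self, Pi.neg_apply, ← hcdef]
      module
    have h2 : α • r.pos i = β • r.neg i :=
      sub_eq_zero.1 ((smul_eq_zero.1 h1).resolve_left hc)
    have h4 : α = 0 := by
      have := congrArg (fun v => B v (r.neg i)) h2
      simpa only [map_smul, LinearMap.smul_apply, r.form_eq_one, r.form_neg_self hinv, smul_eq_mul,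
        mul_one, mul_zero] using this
    rw [← h2, h4]
    simp only [zero_smul, zero_add, lie_smul, r.lie_pos_cartan, _root_.lie_neg, r.lie_neg_pos,
      ← hcdef]
    module
  have hK : f * (e * D - D * e) - (e * D - D * e) * f = c • D := by
    rw [hw, he, hf, ← innerDer_apply, ← innerDer_apply, innerDer_hbar_pow_smul_lift,
      innerDer_hbar_pow_smul_lift, hwt, lift_smul, smul_comm]
  have hCC : ∀ a : A, ((2 : ℂ[X]) * Polynomial.C c) • a = (2 * c) • a := fun a => by
    rw [two_mul, two_mul, add_smul, add_smul, hC]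
  rw [hC, hCC, hK] at hV1
  rw [hC, hCC] at hV2
  -- The eigenvalue c on D gives V = D in the first companion equation; the second then reads cD =
  -- -cD.
  have hV : c • V = c • D := by linear_combination (norm := module) hV1
  have hVD : V = D := smul_right_injective A hc hV
  rw [hVD, hK] at hV2
  have h2 : (2 * c) • D = 0 := by linear_combination (norm := module) hV2
  exact (smul_eq_zero.1 h2).resolve_left (mul_ne_zero two_ne_zero hc)

end HomogeneousQuantization

end SlTwo

end

theorem theorem4p1 {g : Type*} [LieRing g] [LieAlgebra ℂ g] [FiniteDimensional ℂ g]
    [LieAlgebra.IsSimple ℂ g] (H : LieSubalgebra ℂ g) [H.IsCartanSubalgebra]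
    (b : (LieAlgebra.IsKilling.rootSystem H).Base)
    (B : LinearMap.BilinForm ℂ g) (hB : B.Nondegenerate) (hsymm : B.IsSymm)
    (hinv : B.lieInvariant g) (r : RootVectors H B)
    {A : Type*} [Ring A] [HopfAlgebra ℂ[X] A] [Algebra ℂ A] [IsScalarTower ℂ ℂ[X] A]
    (Q : HomogeneousQuantization B hB A)
    (J : g →ₗ[ℂ] A) (hJ : Q.IsDegreeOneGenerator J) :
    (¬ Nonempty (g ≃ₗ⁅ℂ⁆ LieAlgebra.SpecialLinear.sl (Fin 2) ℂ) →
      ∀ i ∈ b.support, ∀ j ∈ b.support,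
        ⁅J (r.t i), J (r.t j)⁆ =
          (Polynomial.X ^ 2 : ℂ[X]) • Q.embed ⁅r.nu b (r.t j), r.nu b (r.t i)⁆) ∧
    (Nonempty (g ≃ₗ⁅ℂ⁆ LieAlgebra.SpecialLinear.sl (Fin 2) ℂ) →
      ∀ i ∈ b.support, ∀ e f h : g, e = r.pos i → f = r.neg i → h = r.t i →
        (⁅⁅J e, J f⁆, J h⁆ = (B h h / 2) ^ 2 • (Polynomial.X ^ 2 : ℂ[X]) •
          ((Q.embed (envIncl g f) * J e - J f * Q.embed (envIncl g e)) *
            Q.embed (envIncl g h))) ∧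
        (B h h = 2 →
          ⁅⁅J e, J f⁆, J h⁆ = (Polynomial.X ^ 2 : ℂ[X]) •
            ((Q.embed (envIncl g f) * J e - J f * Q.embed (envIncl g e)) *
              Q.embed (envIncl g h)))) := by
  refine ⟨fun _ i hi j hj => HomogeneousQuantization.bracket_J_t hsymm hinv hJ hi hj, ?_⟩
  rintro ⟨φ⟩ i - e f h rfl rfl rfl
  have key := HomogeneousQuantization.bracket_J_sl_two (r := r) hsymm hinv
    (finrank_le_three_of_equiv_sl_two φ) hJ i
  refine ⟨key, fun h2 => ?_⟩
  rw [key, h2, div_self two_ne_zero, one_pow, one_smul]
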